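/- Let $\mathbf{E}_1^3$ be $\mathbb{R}^3$ with the metric $dx_1^2+dx_2^2-dx_3^2$. A rotation group is the one-parameter group of rotations about a timelike, spacelike or lightlike axis, and a circle is an orbit of a point under a rotation group which is a regular spacelike curve (up to rigid motions: a Euclidean circle in a spacelike plane, a branch of a spacelike hyperbola in a timelike plane, a parabola in a lightlike plane). Let $M$ be a connected immersed smooth spacelike surface in $\mathbf{E}_1^3$, parametrized by $X(u,v)$ on a connected open set of $\mathbb{R}^2$ and foliated by circles in parallel planes: there is $\nu\neq 0$ such that for each $u$ the leaf $v\mapsto X(u,v)$ lies on a circle contained in a plane $\{\langle x,\nu\rangle=c(u)\}$. If the planes are spacelike or timelike, the leaf may be any open part of that circle; if they are lightlike, the leaf is the whole circle. Let $N$ be a smooth timelike unit normal field, and let the principal curvatures be the eigenvalues of $-dN$. Suppose that for some real constants $m\neq 0$ and $n$, at every point of $M$ the principal curvatures, suitably labelled, satisfy $$\kappa_1=m\kappa_2+n .$$ Then $M$ is (an open part of) a surface of revolution, i.e. it is locally invariant under some rotation group; or $m=-1$, $n=0$ and $M$ is (part of) a Riemann example of a maximal surface, i.e. a non-rotational spacelike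 surface with mean curvature $H=-(\kappa_1+\kappa_2)/2=0$ at every point which is foliated by circles in parallel planes. -/

import Mathlib

open scoped ContDiff Topology

namespace Minkowski

/-- The vector space underlying Minkowski 3-space. -/
abbrev E31 : Type := Fin 3 → ℝ

/-- The Lorentzian metric `dx₁² + dx₂² - dx₃²`. -/
def lor (x y : E31) : ℝ := x 0 * y 0 + x 1 * y 1 - x 2 * y 2

/-- Rotations about the timelike axis spanned by `(0,0,1)`. -/
noncomputable def rotTimelike (t : ℝ) (x : E31) : E31 :=
  ![Real.cos t * x 0 + Real.sin t * x 1, -Real.sin t * x 0 + Real.cos t * x 1, x 2]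

/-- Rotations about the spacelike axis spanned by `(1,0,0)`. -/
noncomputable def rotSpacelike (t : ℝ) (x : E31) : E31 :=
  ![x 0, Real.cosh t * x 1 + Real.sinh t * x 2, Real.sinh t * x 1 + Real.cosh t * x 2]

/-- Rotations about the lightlike axis spanned by `(0,1,1)`. -/
noncomputable def rotLightlike (t : ℝ) (x : E31) : E31 :=
  ![x 0 - t * x 1 + t * x 2,
    t * x 0 + (1 - t ^ 2 / 2) * x 1 + t ^ 2 / 2 * x 2,
    t * x 0 - t ^ 2 / 2 * x 1 + (1 + t ^ 2 / 2) * x 2]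

/-- Rigid motions: affine maps whose linear part preserves the metric
(the linear part is then automatically bijective). -/
def IsRigidMotion (g : E31 → E31) : Prop :=
  ∃ (L : E31 →ₗ[ℝ] E31) (w : E31),
    (∀ x y, lor (L x) (L y) = lor x y) ∧ ∀ x, g x = L x + w

/-- `ρ` is the one-parameter group of rotations about some axis: after a rigid motion it is one of
the three standard groups. -/
def IsRotationGroup (ρ : ℝ → E31 → E31) : Prop :=
  ∃ g : E31 → E31, IsRigidMotion g ∧
    ∃ R : ℝ → E31 → E31, (R = rotTimelike ∨ R = rotSpacelike ∨ R = rotLightlike) ∧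
      ∀ t x, ρ t (g x) = g (R t x)

/-- A (spacelike) circle: an orbit of a point under a rotation group that is a regular spacelike
curve. -/
def IsCircle (C : Set E31) : Prop :=
  ∃ (ρ : ℝ → E31 → E31) (p : E31), IsRotationGroup ρ ∧
    C = Set.range (fun t => ρ t p) ∧
    ∀ t, 0 < lor (deriv (fun s => ρ s p) t) (deriv (fun s => ρ s p) t)

/-- `X` is a smooth spacelike immersion of the plane domain `U`: the induced metric is positive
definite. -/
def IsSpacelikeImmersion (X : ℝ × ℝ → E31) (U : Set (ℝ × ℝ)) : Prop :=
  ContDiffOn ℝ ∞ X U ∧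
    ∀ q ∈ U, ∀ w : ℝ × ℝ, w ≠ 0 → 0 < lor (fderiv ℝ X q w) (fderiv ℝ X q w)

/-- `N` is a Gauss map of `X`: a smooth unit (necessarily timelike) normal field. -/
def IsGaussMap (X N : ℝ × ℝ → E31) (U : Set (ℝ × ℝ)) : Prop :=
  ContDiffOn ℝ ∞ N U ∧
    ∀ q ∈ U, lor (N q) (N q) = -1 ∧ ∀ w : ℝ × ℝ, lor (N q) (fderiv ℝ X q w) = 0

/-- `k₁`, `k₂` are the principal curvatures at `q`, in this order: there is an orthonormal basis
`dX a`, `dX b` of the tangent plane such that the Weingarten endomorphism `-dN` multiplies the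
first vector by `k₁` and the second one by `k₂`. -/
def ArePrincipalCurvatures (X N : ℝ × ℝ → E31) (q : ℝ × ℝ) (k₁ k₂ : ℝ) : Prop :=
  ∃ a b : ℝ × ℝ,
    lor (fderiv ℝ X q a) (fderiv ℝ X q a) = 1 ∧
    lor (fderiv ℝ X q b) (fderiv ℝ X q b) = 1 ∧
    lor (fderiv ℝ X q a) (fderiv ℝ X q b) = 0 ∧
    -fderiv ℝ N q a = k₁ • fderiv ℝ X q a ∧
    -fderiv ℝ N q b = k₂ • fderiv ℝ X q b

/-- The linear Weingarten relation `κ₁ = m κ₂ + n`: at every point the two principal curvatures,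
labelled in one of the two possible ways, satisfy it. -/
def IsLinearWeingarten (X N : ℝ × ℝ → E31) (U : Set (ℝ × ℝ)) (m n : ℝ) : Prop :=
  ∀ q ∈ U, ∃ k₁ k₂ : ℝ, ArePrincipalCurvatures X N q k₁ k₂ ∧ k₁ = m * k₂ + n

/-- Maximal surfaces: the mean curvature `H = -(κ₁ + κ₂) / 2` vanishes at every point. -/
def IsMaximal (X N : ℝ × ℝ → E31) (U : Set (ℝ × ℝ)) : Prop :=
  ∀ q ∈ U, ∃ k₁ k₂ : ℝ, ArePrincipalCurvatures X N q k₁ k₂ ∧ -(k₁ + k₂) / 2 = 0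

/-- The surface is foliated by circles in parallel planes, with the curves `u = const` as leaves:
for a fixed vector `ν ≠ 0`, the leaf of parameter `u` lies on a circle `C` contained in a plane
`⟨x, ν⟩ = c`. These planes are spacelike, timelike or lightlike according as `ν` is timelike,
spacelike or lightlike. In spacelike and timelike planes the leaf may be any open part of the
circle `C`; in lightlike planes it is the whole circle (a parabola). -/
def IsFoliatedByCircles (X : ℝ × ℝ → E31) (U : Set (ℝ × ℝ)) : Prop :=
  ∃ ν : E31, ν ≠ 0 ∧ ∀ u : ℝ, (∃ v, (u, v) ∈ U) →
    ∃ (C : Set E31) (c : ℝ), IsCircle C ∧ (∀ x ∈ C, lor x ν = c) ∧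
      (∀ v, (u, v) ∈ U → X (u, v) ∈ C) ∧
      (lor ν ν = 0 → ∀ x ∈ C, ∃ v, (u, v) ∈ U ∧ X (u, v) = x)

/-- The surface is an (open part of an immersed) surface of revolution: for one rotation group,
each point of the surface can be rotated by all sufficiently small angles without leaving the
surface (and staying in any prescribed neighbourhood of the parameter). -/
def IsSurfaceOfRevolution (X : ℝ × ℝ → E31) (U : Set (ℝ × ℝ)) : Prop :=
  ∃ ρ : ℝ → E31 → E31, IsRotationGroup ρ ∧
    ∀ q ∈ U, ∀ V ∈ 𝓝 q, ∀ᶠ t in 𝓝 (0 : ℝ), ρ t (X q) ∈ X '' (V ∩ U)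

/-- (Parts of) Riemann examples: the non-rotational maximal spacelike surfaces foliated by circles
in parallel planes. -/
def IsRiemannExample (X N : ℝ × ℝ → E31) (U : Set (ℝ × ℝ)) : Prop :=
  IsSpacelikeImmersion X U ∧ IsGaussMap X N U ∧ IsFoliatedByCircles X U ∧
    IsMaximal X N U ∧ ¬ IsSurfaceOfRevolution X U

end Minkowski

/-! The leaves are circles about parallel axes, and the content is that these axes coincide. If `m =
-1` and `n = 0`, the relation is `κ₁ + κ₂ = 0`, so a surface that is not of revolution is a Riemann
example by definition. For every other `(m, n)` with `m ≠ 0` the surface must be shown to be of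
revolution.

Both labellings of the principal curvatures are covered by one symmetric equation, `(1+m)² K - m S²
- n(1-m) S + n² = 0` with `S = κ₁ + κ₂`, `K = κ₁ κ₂`. Written with an unnormalized normal
(`weingarten_relation`), it becomes polynomial in the position on the leaf, up to a square root `τ`
of a multiple of `W³`. Here `W` is a quadratic function on the leaf which is positive because the
surface is spacelike. For fixed `u` the equation holds at infinitely many points of a conic, and
comparison of coefficients constrains the motion of the leaves.

An isometry makes the planes standard. Circles (spacelike planes) and hyperbolas (timelike planes)
are treated together as `ξ² + ε η² = R` with `ε = ±1`, parametrized rationally by `ζ = ξ + jη`, `j²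
= -ε`. If `n ≠ 0`, the term `n² W³` dominates as `ζ → ∞`, and its leading coefficient vanishes only
if the centre is stationary (`conic_leading_coeff`). If `n = 0` and `m ≠ -1`, the equation makes a
multiple of `Z (P² - w₀)` a square, with `P` and `Z` affine on the leaf (`conic_divisibility`).
Either `P` is constant, so that the centre is stationary, or `W ≤ 0`, which is impossible. This
needs moving planes, `c' ≠ 0`. That is automatic for hyperbolas. For circles `|c''| ≤ K |c'|`, so
`c'` vanishes nowhere or everywhere (`plane_dichotomy`), and in the latter case the surface is
planar. Stationary centres give a common axis.

In lightlike planes the leaves are whole parabolas `x₂ + x₁ = f x₀² + g x₀ + h`, so positivity and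
the relation hold for every real `x₀`. They force `df/dc = -f²` and `dg/dc = -fg`
(`parabola_rigidity`). Hence `g/f` and `c - 1/f` are constant, which places all the parabolas among
the orbits about one lightlike axis. -/

namespace Minkowski

/-! ### Directional derivatives of functions on the parameter domain, and of functions of `u` alone.
-/

section Calculus

variable {F : Type*} [NormedAddCommGroup F] [NormedSpace ℝ F] {U : Set (ℝ × ℝ)} {q : ℝ × ℝ}

/-- The derivative of `f` at `q` in the direction `w`. -/
noncomputable def pd (w : ℝ × ℝ) (f : ℝ × ℝ → F) (q : ℝ × ℝ) : F := fderiv ℝ f q w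

theorem diffAt_of_smooth {f : ℝ × ℝ → F} (hU : IsOpen U) (hf : ContDiffOn ℝ ∞ f U) (hq : q ∈ U) :
    DifferentiableAt ℝ f q :=
  (hf.contDiffAt (hU.mem_nhds hq)).differentiableAt (by simp)

theorem pd_smooth {f : ℝ × ℝ → F} (hU : IsOpen U) (hf : ContDiffOn ℝ ∞ f U) (w : ℝ × ℝ) :
    ContDiffOn ℝ ∞ (pd w f) U :=
  (hf.fderiv_of_isOpen hU (m := ∞) (by simp)).clm_apply contDiffOn_const

theorem pd_congr {f g : ℝ × ℝ → F} (hU : IsOpen U) (h : ∀ p ∈ U, f p = g p) (hq : q ∈ U)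
    (w : ℝ × ℝ) : pd w f q = pd w g q := by
  unfold pd
  rw [Filter.EventuallyEq.fderiv_eq (Filter.eventuallyEq_of_mem (hU.mem_nhds hq) h)]

theorem pd_comm {f : ℝ × ℝ → F} (hU : IsOpen U) (hf : ContDiffOn ℝ ∞ f U) (hq : q ∈ U)
    (w w' : ℝ × ℝ) : pd w (pd w' f) q = pd w' (pd w f) q := by
  have h2 : DifferentiableAt ℝ (fderiv ℝ f) q :=
    diffAt_of_smooth hU (hf.fderiv_of_isOpen hU (m := ∞) (by simp)) hq
  have key : ∀ a b : ℝ × ℝ, pd a (pd b f) q = fderiv ℝ (fderiv ℝ f) q a b := by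
    intro a b
    have h3 : pd b f = fun p => fderiv ℝ f p b := rfl
    have := (h2.hasFDerivAt.clm_apply (hasFDerivAt_const b q)).fderiv
    rw [h3, pd, this]
    simp
  rw [key, key]
  have := (hf.contDiffAt (hU.mem_nhds hq)).isSymmSndFDerivAt
    (by simp only [minSmoothness_of_isRCLikeNormedField]
        exact WithTop.coe_le_coe.2 (le_top : (2 : ℕ∞) ≤ ⊤))
  exact this w w'

theorem pd_split (f : ℝ × ℝ → F) (q a : ℝ × ℝ) :
    fderiv ℝ f q a = a.1 • pd (1, 0) f q + a.2 • pd (0, 1) f q := by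
  unfold pd
  rw [← map_smul, ← map_smul, ← map_add]
  congr 1
  ext <;> simp

theorem pd_add {f g : ℝ × ℝ → F} (w : ℝ × ℝ) (hf : DifferentiableAt ℝ f q)
    (hg : DifferentiableAt ℝ g q) : pd w (fun p => f p + g p) q = pd w f q + pd w g q := by
  simp [pd, fderiv_fun_add hf hg]

theorem pd_sub {f g : ℝ × ℝ → F} (w : ℝ × ℝ) (hf : DifferentiableAt ℝ f q)
    (hg : DifferentiableAt ℝ g q) : pd w (fun p => f p - g p) q = pd w f q - pd w g q := by
  simp [pd, fderiv_fun_sub hf hg]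

theorem pd_mul {f g : ℝ × ℝ → ℝ} (w : ℝ × ℝ) (hf : DifferentiableAt ℝ f q)
    (hg : DifferentiableAt ℝ g q) :
    pd w (fun p => f p * g p) q = pd w f q * g q + f q * pd w g q := by
  simp [pd, fderiv_fun_mul hf hg]; ring

theorem pd_const_mul {f : ℝ × ℝ → ℝ} (w : ℝ × ℝ) (c : ℝ) (hf : DifferentiableAt ℝ f q) :
    pd w (fun p => c * f p) q = c * pd w f q := by
  simp [pd, fderiv_const_mul hf]

theorem pd_apply {f : ℝ × ℝ → E31} (w : ℝ × ℝ) (hf : DifferentiableAt ℝ f q) (i : Fin 3) :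
    pd w (fun p => f p i) q = pd w f q i := by
  simp only [pd]
  rw [fderiv_apply hf]
  simp

theorem pd_fst_comp {a : ℝ → ℝ} (w : ℝ × ℝ) (ha : DifferentiableAt ℝ a q.1) :
    pd w (fun p => a p.1) q = w.1 * deriv a q.1 := by
  have h : HasFDerivAt (fun p : ℝ × ℝ => a p.1) _ q :=
    HasFDerivAt.comp (g := a) (f := Prod.fst) q ha.hasDerivAt.hasFDerivAt hasFDerivAt_fst
  simp [pd, h.fderiv]

theorem comp_apply_smooth {f : ℝ × ℝ → E31} (hf : ContDiffOn ℝ ∞ f U) (i : Fin 3) :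
    ContDiffOn ℝ ∞ (fun p => f p i) U :=
  (contDiffOn_pi.1 hf) i

/-- Near `p.1`, `a` is the restriction of `f` to a horizontal slice through `p`. This is how data
chosen separately for each leaf are shown to be smooth. -/
theorem smooth_of_fst_smooth {a : ℝ → ℝ} {f : ℝ × ℝ → ℝ} (hU : IsOpen U)
    (hf : ContDiffOn ℝ ∞ f U) (h : ∀ p ∈ U, f p = a p.1) :
    ContDiffOn ℝ ∞ a (Prod.fst '' U) := by
  rintro _ ⟨p, hp, rfl⟩
  apply ContDiffAt.contDiffWithinAt
  have hs : ContDiff ℝ ∞ (fun s : ℝ => (s, p.2)) := by fun_prop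
  have h1 : ContDiffAt ℝ ∞ (fun s : ℝ => f (s, p.2)) p.1 :=
    ContDiffAt.comp p.1 (hf.contDiffAt (hU.mem_nhds hp)) hs.contDiffAt
  refine h1.congr_of_eventuallyEq ?_
  have : ∀ᶠ s in 𝓝 p.1, (s, p.2) ∈ U :=
    hs.continuous.continuousAt.eventually_mem (hU.mem_nhds hp)
  filter_upwards [this] with s hs
  exact (h _ hs).symm

theorem isOpen_fst_image (hU : IsOpen U) : IsOpen (Prod.fst '' U) := isOpenMap_fst U hU

theorem fst_smooth {a : ℝ → ℝ} (ha : ContDiffOn ℝ ∞ a (Prod.fst '' U)) :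
    ContDiffOn ℝ ∞ (fun p : ℝ × ℝ => a p.1) U :=
  ha.comp contDiff_fst.contDiffOn (fun p hp => ⟨p, hp, rfl⟩)

theorem deriv_smooth {a : ℝ → ℝ} {I : Set ℝ} (hI : IsOpen I) (ha : ContDiffOn ℝ ∞ a I) :
    ContDiffOn ℝ ∞ (deriv a) I :=
  ha.deriv_of_isOpen hI (by simp)

theorem fst_diffAt {a : ℝ → ℝ} (hU : IsOpen U) (ha : ContDiffOn ℝ ∞ a (Prod.fst '' U))
    (hq : q ∈ U) : DifferentiableAt ℝ a q.1 :=
  (ha.contDiffAt ((isOpen_fst_image hU).mem_nhds ⟨q, hq, rfl⟩)).differentiableAt (by simp)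

theorem pd_fst {a : ℝ → ℝ} (hU : IsOpen U) (ha : ContDiffOn ℝ ∞ a (Prod.fst '' U))
    (hq : q ∈ U) (w : ℝ × ℝ) : pd w (fun p => a p.1) q = w.1 * deriv a q.1 :=
  pd_fst_comp w (fst_diffAt hU ha hq)

theorem pd_pd_fst {a : ℝ → ℝ} (hU : IsOpen U) (ha : ContDiffOn ℝ ∞ a (Prod.fst '' U))
    (hq : q ∈ U) (w w' : ℝ × ℝ) :
    pd w (pd w' (fun p => a p.1)) q = w.1 * w'.1 * deriv (deriv a) q.1 := by
  have hd := deriv_smooth (isOpen_fst_image hU) ha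
  rw [pd_congr (g := fun p => w'.1 * deriv a p.1) hU (fun p hp => pd_fst hU ha hp w') hq,
    pd_const_mul _ _ (diffAt_of_smooth hU (fst_smooth hd) hq), pd_fst hU hd hq]
  ring

theorem pd_pd_apply {f : ℝ × ℝ → E31} (hU : IsOpen U) (hf : ContDiffOn ℝ ∞ f U) (hq : q ∈ U)
    (w w' : ℝ × ℝ) (i : Fin 3) : pd w (pd w' (fun p => f p i)) q = pd w (pd w' f) q i := by
  rw [pd_congr (g := fun p => pd w' f p i) hU
    (fun p hp => pd_apply w' (diffAt_of_smooth hU hf hp) i) hq,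
    pd_apply w (diffAt_of_smooth hU (pd_smooth hU hf w') hq)]

theorem const_of_deriv_eq_zero {a : ℝ → ℝ} (hU : IsOpen U) (hc : IsConnected U)
    (ha : ContDiffOn ℝ ∞ a (Prod.fst '' U)) (h : ∀ p ∈ U, deriv a p.1 = 0) :
    ∃ k, ∀ p ∈ U, a p.1 = k := by
  obtain ⟨k, hk⟩ := (isOpen_fst_image hU).exists_is_const_of_deriv_eq_zero
    (hc.isPreconnected.image _ continuous_fst.continuousOn) (ha.differentiableOn (by simp))
    (by rintro _ ⟨p, hp, rfl⟩; exact h p hp)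
  exact ⟨k, fun p hp => hk p.1 ⟨p, hp, rfl⟩⟩

end Calculus

/-! ### The Lorentzian form. -/

section Form

theorem lor_comm (x y : E31) : lor x y = lor y x := by simp only [lor]; ring

theorem lor_add_left (x y z : E31) : lor (x + y) z = lor x z + lor y z := by
  simp only [lor, Pi.add_apply]; ring

theorem lor_sub_left (x y z : E31) : lor (x - y) z = lor x z - lor y z := by
  simp only [lor, Pi.sub_apply]; ring

theorem lor_smul_left (c : ℝ) (x z : E31) : lor (c • x) z = c * lor x z := by
  simp only [lor, Pi.smul_apply, smul_eq_mul]; ring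

theorem lor_add_right (x y z : E31) : lor z (x + y) = lor z x + lor z y := by
  simp only [lor, Pi.add_apply]; ring

theorem lor_smul_right (c : ℝ) (x z : E31) : lor z (c • x) = c * lor z x := by
  simp only [lor, Pi.smul_apply, smul_eq_mul]; ring

theorem lor_neg_left (x z : E31) : lor (-x) z = -lor x z := by
  simp only [lor, Pi.neg_apply]; ring

theorem pd_lor {U : Set (ℝ × ℝ)} {q : ℝ × ℝ} {f g : ℝ × ℝ → E31} (w : ℝ × ℝ) (hU : IsOpen U)
    (hf : ContDiffOn ℝ ∞ f U) (hg : ContDiffOn ℝ ∞ g U) (hq : q ∈ U) :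
    pd w (fun p => lor (f p) (g p)) q = lor (pd w f q) (g q) + lor (f q) (pd w g q) := by
  have hf' := fun i => diffAt_of_smooth hU (comp_apply_smooth hf i) hq
  have hg' := fun i => diffAt_of_smooth hU (comp_apply_smooth hg i) hq
  have hm : ∀ i, DifferentiableAt ℝ (fun p => f p i * g p i) q := fun i => (hf' i).mul (hg' i)
  simp only [lor]
  rw [pd_sub (f := fun p => f p 0 * g p 0 + f p 1 * g p 1) w ((hm 0).add (hm 1)) (hm 2),
    pd_add w (hm 0) (hm 1), pd_mul w (hf' 0) (hg' 0), pd_mul w (hf' 1) (hg' 1),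
    pd_mul w (hf' 2) (hg' 2)]
  simp only [pd_apply w (diffAt_of_smooth hU hf hq), pd_apply w (diffAt_of_smooth hU hg hq)]
  ring

/-- A vector orthogonal to three vectors with nonzero Gram determinant vanishes. -/
theorem eq_zero_of_orthogonal {a b c v : E31}
    (hdet : (lor a a * lor b b - lor a b ^ 2) * lor c c ≠ 0)
    (hac : lor c a = 0) (hbc : lor c b = 0)
    (ha : lor v a = 0) (hb : lor v b = 0) (hc : lor v c = 0) : v = 0 := by
  set d := a 0 * (b 1 * c 2 - b 2 * c 1) - a 1 * (b 0 * c 2 - b 2 * c 0)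
    + a 2 * (b 0 * c 1 - b 1 * c 0) with hd
  -- The Gram determinant of three vectors is minus the square of their determinant `d`. The vector
  -- `v` is then found by Cramer's rule.
  have hg : (lor a a * lor b b - lor a b ^ 2) * lor c c
      = -d ^ 2 + lor c a * (lor c a * lor b b - lor c b * lor a b)
        + lor c b * (lor c b * lor a a - lor c a * lor a b) := by
    simp only [lor, hd]; ring
  have hd0 : d ≠ 0 := by
    intro h
    rw [hac, hbc, h] at hg
    apply hdet
    rw [hg]; ring
  have h0 : d * v 0 = (b 1 * c 2 - b 2 * c 1) * lor v a + (c 1 * a 2 - c 2 * a 1) * lor v b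
      + (a 1 * b 2 - a 2 * b 1) * lor v c := by simp only [lor, hd]; ring
  have h1 : d * v 1 = (b 2 * c 0 - b 0 * c 2) * lor v a + (c 2 * a 0 - c 0 * a 2) * lor v b
      + (a 2 * b 0 - a 0 * b 2) * lor v c := by simp only [lor, hd]; ring
  have h2 : d * v 2 = -((b 0 * c 1 - b 1 * c 0) * lor v a + (c 0 * a 1 - c 1 * a 0) * lor v b
      + (a 0 * b 1 - a 1 * b 0) * lor v c) := by simp only [lor, hd]; ring
  rw [ha, hb, hc] at h0 h1 h2
  ext i
  fin_cases i
  · simpa [hd0] using h0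
  · simpa [hd0] using h1
  · simpa [hd0] using h2

end Form

/-! ### Fundamental forms and the Weingarten relation. -/

section Weingarten

variable {U : Set (ℝ × ℝ)} {X N : ℝ × ℝ → E31} {m n : ℝ} {q : ℝ × ℝ}

theorem gauss_orthogonal (hN : IsGaussMap X N U) (w : ℝ × ℝ) :
    ∀ p ∈ U, lor (N p) (pd w X p) = 0 := fun p hp => (hN.2 p hp).2 w

theorem gauss_second (hU : IsOpen U) (hX : IsSpacelikeImmersion X U) (hN : IsGaussMap X N U)
    (hq : q ∈ U) (w w' : ℝ × ℝ) :
    lor (pd w' N q) (pd w X q) = -lor (N q) (pd w' (pd w X) q) := by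
  have h := pd_congr (g := fun _ => (0 : ℝ)) hU (gauss_orthogonal hN w) hq w'
  rw [pd_lor w' hU hN.1 (pd_smooth hU hX.1 w) hq] at h
  simp [pd] at h
  simp only [pd]
  linarith

theorem metric_pos (hX : IsSpacelikeImmersion X U) (hq : q ∈ U) :
    0 < lor (pd (1, 0) X q) (pd (1, 0) X q) * lor (pd (0, 1) X q) (pd (0, 1) X q)
      - lor (pd (1, 0) X q) (pd (0, 1) X q) ^ 2 ∧
    0 < lor (pd (0, 1) X q) (pd (0, 1) X q) := by
  have hG : 0 < lor (pd (0, 1) X q) (pd (0, 1) X q) := hX.2 q hq (0, 1) (by simp)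
  refine ⟨?_, hG⟩
  set E := lor (pd (1, 0) X q) (pd (1, 0) X q)
  set F := lor (pd (1, 0) X q) (pd (0, 1) X q) with hF
  set G := lor (pd (0, 1) X q) (pd (0, 1) X q)
  -- The vector `G X_u - F X_v` is orthogonal to `X_v` and has square `G (EG - F²)`.
  have h := hX.2 q hq (G, -F) (by
    intro h
    have := congrArg Prod.fst h
    simp at this
    exact hG.ne' this)
  rw [pd_split] at h
  simp only [lor_add_left, lor_add_right, lor_smul_left, lor_smul_right] at h
  rw [lor_comm (pd (0, 1) X q) (pd (1, 0) X q), ← hF] at h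
  have h' : 0 < G * (E * G - F ^ 2) := by
    convert h using 1
    ring
  exact pos_of_mul_pos_right h' hG.le

/-- The sum and the product of the principal curvatures in terms of the fundamental forms. -/
theorem curvature_of_forms (hU : IsOpen U) (hX : IsSpacelikeImmersion X U) (hN : IsGaussMap X N U)
    (hq : q ∈ U) {k₁ k₂ : ℝ} (hk : ArePrincipalCurvatures X N q k₁ k₂) {E F G e f g : ℝ}
    (hE : lor (pd (1, 0) X q) (pd (1, 0) X q) = E) (hF : lor (pd (1, 0) X q) (pd (0, 1) X q) = F)
    (hG : lor (pd (0, 1) X q) (pd (0, 1) X q) = G)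
    (he : lor (N q) (pd (1, 0) (pd (1, 0) X) q) = e)
    (hf : lor (N q) (pd (1, 0) (pd (0, 1) X) q) = f)
    (hg : lor (N q) (pd (0, 1) (pd (0, 1) X) q) = g) :
    (k₁ + k₂) * (E * G - F ^ 2) = e * G - 2 * f * F + g * E ∧
      k₁ * k₂ * (E * G - F ^ 2) = e * g - f ^ 2 := by
  obtain ⟨a, b, haa, hbb, hab, ha, hb⟩ := hk
  have hF' : lor (pd (0, 1) X q) (pd (1, 0) X q) = F := by rw [lor_comm, hF]
  have hf' : lor (N q) (pd (0, 1) (pd (1, 0) X) q) = f := by rw [pd_comm hU hX.1 hq, hf]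
  have e11 := gauss_second hU hX hN hq (1, 0) (1, 0)
  have e12 := gauss_second hU hX hN hq (1, 0) (0, 1)
  have e21 := gauss_second hU hX hN hq (0, 1) (1, 0)
  have e22 := gauss_second hU hX hN hq (0, 1) (0, 1)
  rw [he] at e11
  rw [hf'] at e12
  rw [hf] at e21
  rw [hg] at e22
  simp only [pd_split X] at haa hbb hab ha hb
  rw [pd_split N] at ha hb
  have s1 := congrArg (fun v => lor v (pd (1, 0) X q)) ha
  have s2 := congrArg (fun v => lor v (pd (0, 1) X q)) ha
  have s3 := congrArg (fun v => lor v (pd (1, 0) X q)) hb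
  have s4 := congrArg (fun v => lor v (pd (0, 1) X q)) hb
  simp only [lor_add_left, lor_add_right, lor_smul_left, lor_smul_right, lor_neg_left,
    hE, hF, hG, hF', e11, e12, e21, e22] at haa hbb hab s1 s2 s3 s4
  have maa : a.1 * (a.1 * e + a.2 * f) + a.2 * (a.1 * f + a.2 * g) = k₁ := by
    linear_combination a.1 * s1 + a.2 * s2 + k₁ * haa
  have mab : b.1 * (a.1 * e + a.2 * f) + b.2 * (a.1 * f + a.2 * g) = 0 := by
    linear_combination b.1 * s1 + b.2 * s2 + k₁ * hab
  have mbb : b.1 * (b.1 * e + b.2 * f) + b.2 * (b.1 * f + b.2 * g) = k₂ := by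
    linear_combination b.1 * s3 + b.2 * s4 + k₂ * hbb
  -- `d` is the determinant of the change to the eigenbasis. The determinants of both forms and
  -- their mixed determinant all scale by `d²`.
  set d := a.1 * b.2 - a.2 * b.1 with hd
  have hd1 : d ^ 2 * (E * G - F ^ 2) = 1 := by
    have : d ^ 2 * (E * G - F ^ 2) =
      (a.1 * (a.1 * E + a.2 * F) + a.2 * (a.1 * F + a.2 * G)) *
      (b.1 * (b.1 * E + b.2 * F) + b.2 * (b.1 * F + b.2 * G)) -
      (a.1 * (b.1 * E + b.2 * F) + a.2 * (b.1 * F + b.2 * G)) ^ 2 := by rw [hd]; ring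
    rw [this]
    linear_combination (b.1 * (b.1 * E + b.2 * F) + b.2 * (b.1 * F + b.2 * G)) * haa + hbb
      - (a.1 * (b.1 * E + b.2 * F) + a.2 * (b.1 * F + b.2 * G)) * hab
  have hd2 : d ^ 2 * (e * g - f ^ 2) = k₁ * k₂ := by
    have : d ^ 2 * (e * g - f ^ 2) =
      (a.1 * (a.1 * e + a.2 * f) + a.2 * (a.1 * f + a.2 * g)) *
      (b.1 * (b.1 * e + b.2 * f) + b.2 * (b.1 * f + b.2 * g)) -
      (b.1 * (a.1 * e + a.2 * f) + b.2 * (a.1 * f + a.2 * g)) ^ 2 := by rw [hd]; ring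
    rw [this, maa, mab, mbb]; ring
  have hd3 : d ^ 2 * (e * G - 2 * f * F + g * E) = k₁ + k₂ := by
    have : d ^ 2 * (e * G - 2 * f * F + g * E) =
      (a.1 * (a.1 * E + a.2 * F) + a.2 * (a.1 * F + a.2 * G)) *
      (b.1 * (b.1 * e + b.2 * f) + b.2 * (b.1 * f + b.2 * g)) +
      (b.1 * (b.1 * E + b.2 * F) + b.2 * (b.1 * F + b.2 * G)) *
      (a.1 * (a.1 * e + a.2 * f) + a.2 * (a.1 * f + a.2 * g)) -
      2 * (a.1 * (b.1 * E + b.2 * F) + a.2 * (b.1 * F + b.2 * G)) *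
      (b.1 * (a.1 * e + a.2 * f) + b.2 * (a.1 * f + a.2 * g)) := by rw [hd]; ring
    rw [this, maa, mab, mbb]
    linear_combination k₂ * haa + k₁ * hbb
  constructor
  · linear_combination (e * G - 2 * f * F + g * E) * hd1 - (E * G - F ^ 2) * hd3
  · linear_combination (e * g - f ^ 2) * hd1 - (E * G - F ^ 2) * hd2

/-- The linear Weingarten relation, expressed with an unnormalized normal vector `ℓ`. -/
theorem weingarten_relation (hU : IsOpen U) (hX : IsSpacelikeImmersion X U)
    (hN : IsGaussMap X N U) (hW : IsLinearWeingarten X N U m n) (hq : q ∈ U)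
    {E F G e f g δ W θ s₁ s₂ : ℝ} {ℓ : E31} (hδ : 0 < δ)
    (hE : lor (pd (1, 0) X q) (pd (1, 0) X q) = E) (hF : lor (pd (1, 0) X q) (pd (0, 1) X q) = F)
    (hG : lor (pd (0, 1) X q) (pd (0, 1) X q) = G)
    (hu : lor ℓ (pd (1, 0) X q) = 0) (hv : lor ℓ (pd (0, 1) X q) = 0)
    (hℓ : lor ℓ ℓ = -(δ * W))
    (he : lor ℓ (pd (1, 0) (pd (1, 0) X) q) = e)
    (hf : lor ℓ (pd (1, 0) (pd (0, 1) X) q) = f)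
    (hg : lor ℓ (pd (0, 1) (pd (0, 1) X) q) = g)
    (hdet : E * G - F ^ 2 = θ ^ 2 * W)
    (htr : e * G - 2 * f * F + g * E = θ ^ 2 * s₁)
    (hdt : e * g - f ^ 2 = θ ^ 2 * s₂) :
    0 < W ∧ ∃ τ, τ ^ 2 = δ * W ^ 3 ∧
      (1 + m) ^ 2 * s₂ * W - m * s₁ ^ 2 + δ * n ^ 2 * W ^ 3 = n * (1 - m) * τ * s₁ := by
  have hpos := (metric_pos hX hq).1
  rw [hE, hF, hG, hdet] at hpos
  have hθ : θ ≠ 0 := by rintro rfl; simp at hpos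
  have hθ2 : 0 < θ ^ 2 := by positivity
  have hWp : 0 < W := pos_of_mul_pos_right hpos hθ2.le
  refine ⟨hWp, ?_⟩
  have hδW : δ * W ≠ 0 := by positivity
  -- The factor with `N = κ ℓ`: both vectors are orthogonal to the tangent plane.
  set κ := -lor (N q) ℓ / (δ * W) with hκ
  have hNN := (hN.2 q hq).1
  have hNu := gauss_orthogonal hN (1, 0) q hq
  have hNv := gauss_orthogonal hN (0, 1) q hq
  have hNℓ : N q - κ • ℓ = 0 := by
    refine eq_zero_of_orthogonal (a := pd (1, 0) X q) (b := pd (0, 1) X q) (c := ℓ) ?_ hu hv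
      ?_ ?_ ?_
    · rw [hE, hF, hG, hdet, hℓ]
      exact mul_ne_zero hpos.ne' (neg_ne_zero.2 hδW)
    · rw [lor_sub_left, lor_smul_left, hNu, hu]; ring
    · rw [lor_sub_left, lor_smul_left, hNv, hv]; ring
    · rw [lor_sub_left, lor_smul_left, hℓ, hκ]; field_simp; ring
  rw [sub_eq_zero] at hNℓ
  clear_value κ
  have hκ1 : κ ^ 2 * (δ * W) = 1 := by
    rw [hNℓ, lor_smul_left, lor_smul_right, hℓ] at hNN
    linear_combination -hNN
  have hκ0 : κ ≠ 0 := by intro h; rw [h] at hκ1; simp at hκ1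
  obtain ⟨k₁, k₂, hk, hrel⟩ := hW q hq
  obtain ⟨hS, hK⟩ := curvature_of_forms hU hX hN hq hk hE hF hG (e := κ * e) (f := κ * f)
    (g := κ * g) (by rw [hNℓ, lor_smul_left, he]) (by rw [hNℓ, lor_smul_left, hf])
    (by rw [hNℓ, lor_smul_left, hg])
  have hS' : (k₁ + k₂) * W = κ * s₁ := by
    have : θ ^ 2 * ((k₁ + k₂) * W) = θ ^ 2 * (κ * s₁) := by
      linear_combination hS - (k₁ + k₂) * hdet + κ * htr
    exact mul_left_cancel₀ hθ2.ne' this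
  have hK' : k₁ * k₂ * W = κ ^ 2 * s₂ := by
    have : θ ^ 2 * (k₁ * k₂ * W) = θ ^ 2 * (κ ^ 2 * s₂) := by
      linear_combination hK - k₁ * k₂ * hdet + κ ^ 2 * hdt
    exact mul_left_cancel₀ hθ2.ne' this
  -- The left side is `(k₁ - m k₂ - n)(k₂ - m k₁ - n)`, which is symmetric in the two curvatures.
  have hSK : (1 + m) ^ 2 * (k₁ * k₂) - m * (k₁ + k₂) ^ 2 - n * (1 - m) * (k₁ + k₂) + n ^ 2 = 0 := by
    rw [hrel]; ring
  -- Since `κ² δ W = 1`, this is a square root of `δ W³`; its sign records the orientation of `N`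
  -- relative to `ℓ`.
  refine ⟨W / κ, ?_, ?_⟩
  · field_simp
    linear_combination -hκ1
  · have h1 : s₁ = (k₁ + k₂) * W / κ := by field_simp; linear_combination -hS'
    have h2 : s₂ = k₁ * k₂ * W / κ ^ 2 := by field_simp; linear_combination -hK'
    have h3 : δ = 1 / (κ ^ 2 * W) := by field_simp; linear_combination hκ1
    rw [h1, h2, h3]
    field_simp
    linear_combination hSK

end Weingarten

end Minkowski

namespace Minkowski

/-! ### Smooth dependence of the conics on the leaf. -/

section ConicSmoothness

variable {U : Set (ℝ × ℝ)} {q : ℝ × ℝ}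

theorem hasDerivAt_snd {f : ℝ × ℝ → ℝ} (hU : IsOpen U) (hf : ContDiffOn ℝ ∞ f U) (hq : q ∈ U) :
    HasDerivAt (fun s => f (q.1, s)) (pd (0, 1) f q) q.2 := by
  have h1 : HasFDerivAt f (fderiv ℝ f q) (q.1, q.2) := (diffAt_of_smooth hU hf hq).hasFDerivAt
  have h2 : HasDerivAt (fun s : ℝ => (q.1, s)) ((0 : ℝ), (1 : ℝ)) q.2 :=
    (hasDerivAt_const _ _).prodMk (hasDerivAt_id _)
  exact h1.comp_hasDerivAt q.2 h2

theorem eventually_snd_mem (hU : IsOpen U) (hq : q ∈ U) : ∀ᶠ s in 𝓝 q.2, (q.1, s) ∈ U :=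
  (by fun_prop : Continuous fun s : ℝ => (q.1, s)).continuousAt.eventually_mem (hU.mem_nhds hq)

theorem eventually_fst_mem (hU : IsOpen U) (hq : q ∈ U) : ∀ᶠ s in 𝓝 q.1, (s, q.2) ∈ U :=
  (by fun_prop : Continuous fun s : ℝ => (s, q.2)).continuousAt.eventually_mem (hU.mem_nhds hq)

theorem conic_leaf_derivatives {x y : ℝ × ℝ → ℝ} {a b R ε : ℝ} (hU : IsOpen U)
    (hx : ContDiffOn ℝ ∞ x U) (hy : ContDiffOn ℝ ∞ y U) {u : ℝ}
    (h : ∀ v, (u, v) ∈ U → (x (u, v) - a) ^ 2 + ε * (y (u, v) - b) ^ 2 = R) {v : ℝ}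
    (hv : (u, v) ∈ U) :
    (x (u, v) - a) * pd (0, 1) x (u, v) + ε * ((y (u, v) - b) * pd (0, 1) y (u, v)) = 0 ∧
    pd (0, 1) x (u, v) ^ 2 + (x (u, v) - a) * pd (0, 1) (pd (0, 1) x) (u, v) +
      ε * (pd (0, 1) y (u, v) ^ 2 + (y (u, v) - b) * pd (0, 1) (pd (0, 1) y) (u, v)) = 0 := by
  have first : ∀ v, (u, v) ∈ U →
      (x (u, v) - a) * pd (0, 1) x (u, v) + ε * ((y (u, v) - b) * pd (0, 1) y (u, v)) = 0 := by
    intro v hv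
    have d := (((hasDerivAt_snd hU hx hv).sub_const a).pow 2).add
      ((((hasDerivAt_snd hU hy hv).sub_const b).pow 2).const_mul ε)
    have e : (fun s => (x (u, s) - a) ^ 2 + ε * (y (u, s) - b) ^ 2) =ᶠ[𝓝 v] fun _ => R := by
      filter_upwards [eventually_snd_mem hU hv] with s hs using h s hs
    have := d.unique ((hasDerivAt_const v R).congr_of_eventuallyEq e)
    simp at this
    linear_combination this / 2
  refine ⟨first v hv, ?_⟩
  have d := (((hasDerivAt_snd hU hx hv).sub_const a).mul
    (hasDerivAt_snd hU (pd_smooth hU hx (0, 1)) hv)).add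
      ((((hasDerivAt_snd hU hy hv).sub_const b).mul
        (hasDerivAt_snd hU (pd_smooth hU hy (0, 1)) hv)).const_mul ε)
  have e : (fun s => (x (u, s) - a) * pd (0, 1) x (u, s)
      + ε * ((y (u, s) - b) * pd (0, 1) y (u, s))) =ᶠ[𝓝 v] fun _ => 0 := by
    filter_upwards [eventually_snd_mem hU hv] with s hs using first s hs
  have := d.unique ((hasDerivAt_const v 0).congr_of_eventuallyEq e)
  linear_combination this

/-- The centres and the squared radii of a smooth family of conics depend smoothly on the
parameter of the family. -/
theorem conic_smooth {x y : ℝ × ℝ → ℝ} {a b R : ℝ → ℝ} {ε : ℝ} (hU : IsOpen U) (hε : ε ^ 2 = 1)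
    (hx : ContDiffOn ℝ ∞ x U) (hy : ContDiffOn ℝ ∞ y U)
    (h : ∀ p ∈ U, (x p - a p.1) ^ 2 + ε * (y p - b p.1) ^ 2 = R p.1)
    (hpos : ∀ p ∈ U, 0 < ε * pd (0, 1) x p ^ 2 + pd (0, 1) y p ^ 2) :
    ContDiffOn ℝ ∞ a (Prod.fst '' U) ∧ ContDiffOn ℝ ∞ b (Prod.fst '' U) ∧
      ContDiffOn ℝ ∞ R (Prod.fst '' U) := by
  have hxv := pd_smooth hU hx (0, 1)
  have hyv := pd_smooth hU hy (0, 1)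
  have hxvv := pd_smooth hU hxv (0, 1)
  have hyvv := pd_smooth hU hyv (0, 1)
  set Q : ℝ × ℝ → ℝ := fun p => pd (0, 1) x p ^ 2 + ε * pd (0, 1) y p ^ 2 with hQ
  set d : ℝ × ℝ → ℝ := fun p => pd (0, 1) x p * pd (0, 1) (pd (0, 1) y) p
    - pd (0, 1) y p * pd (0, 1) (pd (0, 1) x) p with hd
  have key : ∀ p ∈ U, d p ≠ 0 ∧ (x p - a p.1) * d p = Q p * pd (0, 1) y p ∧
      (y p - b p.1) * d p = -ε * Q p * pd (0, 1) x p := by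
    intro p hp
    obtain ⟨h1, h2⟩ := conic_leaf_derivatives (u := p.1) (v := p.2) (a := a p.1) (b := b p.1)
      (R := R p.1) hU hx hy (fun v hv => h _ hv) hp
    have k1 : (x p - a p.1) * d p = Q p * pd (0, 1) y p := by
      simp only [hd, hQ]
      linear_combination (exp := 1) pd (0, 1) (pd (0, 1) y) p * h1 - pd (0, 1) y p * h2
    have k2 : (y p - b p.1) * d p = -ε * Q p * pd (0, 1) x p := by
      simp only [hd, hQ]
      linear_combination (exp := 1) -ε * pd (0, 1) (pd (0, 1) x) p * h1
        + ε * pd (0, 1) x p * h2 - (y p - b p.1) * d p * hε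
    refine ⟨fun h0 => ?_, k1, k2⟩
    have hp' := hpos p hp
    -- `Q` is `ε` times the squared speed of the leaf, hence nonzero. Therefore `d = 0` would make
    -- the velocity vanish.
    have hQ0 : Q p = ε * (ε * pd (0, 1) x p ^ 2 + pd (0, 1) y p ^ 2) := by
      simp only [hQ]; linear_combination -pd (0, 1) x p ^ 2 * hε
    have hε0 : ε ≠ 0 := by rintro rfl; simp at hε
    have hQ1 : Q p ≠ 0 := by rw [hQ0]; exact mul_ne_zero hε0 hp'.ne'
    rw [h0, mul_zero] at k1 k2
    have y0 : pd (0, 1) y p = 0 := by simpa [hQ1] using k1.symm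
    have x0 : pd (0, 1) x p = 0 := by simpa [hQ1, hε0] using k2.symm
    rw [x0, y0] at hp'
    simp at hp'
  have hQs : ContDiffOn ℝ ∞ Q U := (hxv.pow 2).add (contDiffOn_const.mul (hyv.pow 2))
  have hds : ContDiffOn ℝ ∞ d U := (hxv.mul hyvv).sub (hyv.mul hxvv)
  have hd0 : ∀ p ∈ U, d p ≠ 0 := fun p hp => (key p hp).1
  have ha : ContDiffOn ℝ ∞ a (Prod.fst '' U) := by
    refine smooth_of_fst_smooth hU (f := fun p => x p - Q p * pd (0, 1) y p / d p)
      (hx.sub ((hQs.mul hyv).div hds hd0)) (fun p hp => ?_)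
    obtain ⟨h0, h1, -⟩ := key p hp
    rw [← h1]; field_simp; ring
  have hb : ContDiffOn ℝ ∞ b (Prod.fst '' U) := by
    refine smooth_of_fst_smooth hU (f := fun p => y p - -ε * Q p * pd (0, 1) x p / d p)
      (hy.sub (((contDiffOn_const.mul hQs).mul hxv).div hds hd0)) (fun p hp => ?_)
    obtain ⟨h0, -, h1⟩ := key p hp
    rw [← h1]; field_simp; ring
  refine ⟨ha, hb, smooth_of_fst_smooth hU (f := fun p => (x p - a p.1) ^ 2
    + ε * (y p - b p.1) ^ 2) ?_ h⟩
  exact ((hx.sub (fst_smooth ha)).pow 2).add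
    (contDiffOn_const.mul ((hy.sub (fst_smooth hb)).pow 2))

end ConicSmoothness

/-! ### Fundamental forms along a conic leaf. -/

section ConicAlgebra

/-- Pointwise identities for the fundamental forms of a surface foliated by conics. -/
theorem conic_forms {ε ξ η R a₁ b₁ R₁ c₁ c₂ xu yu xv yv xuu yuu xuv yuv xvv yvv P Q : ℝ}
    (hε : ε ^ 2 = 1) (hR : R ≠ 0) (h0 : ξ ^ 2 + ε * η ^ 2 = R)
    (hP : P = ξ * a₁ + ε * η * b₁ + R₁ / 2) 
    (h1 : ξ * xu + ε * η * yu = P) (h2 : ξ * xv + ε * η * yv = 0)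
    (h11 : ξ * xuu + ε * η * yuu = Q - (xu - a₁) ^ 2 - ε * (yu - b₁) ^ 2)
    (h12 : ξ * xuv + ε * η * yuv = -(xu - a₁) * xv - ε * (yu - b₁) * yv)
    (h22 : ξ * xvv + ε * η * yvv = -xv ^ 2 - ε * yv ^ 2)
    {E F G e f g θ W Z : ℝ}
    (hE : E = ε * xu ^ 2 + yu ^ 2 - ε * c₁ ^ 2) (hF : F = ε * (xu * xv) + yu * yv)
    (hG : G = ε * xv ^ 2 + yv ^ 2)
    (he : e = c₁ * (ξ * xuu + ε * η * yuu) - P * c₂) (hf : f = c₁ * (ξ * xuv + ε * η * yuv))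
    (hg : g = c₁ * (ξ * xvv + ε * η * yvv))
    (hθ : θ = (ξ * yv - η * xv) / R) (hW : W = ε * (P ^ 2 - R * c₁ ^ 2))
    (hZ : Z = c₁ * (R * Q - R₁ ^ 2 / 4) - R * P * c₂) :
    E * G - F ^ 2 = θ ^ 2 * W ∧
    e * G - 2 * f * F + g * E = θ ^ 2 * (Z + c₁ * R₁ ^ 2 / 4 - c₁ * P * R₁
      - R * c₁ * (a₁ ^ 2 + ε * b₁ ^ 2) + R * c₁ ^ 3) ∧
    e * g - f ^ 2 = θ ^ 2 * (-ε * c₁ * Z) := by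
  -- Velocities are resolved into the radial direction `(ξ, η)` and the tangential direction `(-εη,
  -- ξ)`. The tangential components of `X_u` and `X_v` are `μ` and `θ`, and `X_v` has no radial
  -- component.
  set μ := (ξ * yu - η * xu) / R with hμ
  have hxu : xu = P / R * ξ - ε * μ * η := by
    rw [hμ]; field_simp; rw [← h1, ← h0]; ring
  have hyu : yu = P / R * η + μ * ξ := by
    rw [hμ]; field_simp; rw [← h1, ← h0]; ring
  have hxv : xv = -ε * θ * η := by
    rw [hθ]; field_simp; rw [← h0]; linear_combination ξ * h2
  have hyv : yv = θ * ξ := by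
    rw [hθ]; field_simp; rw [← h0]; linear_combination η * h2
  clear_value μ
  clear hθ hμ h1 h2
  obtain ⟨p, hp⟩ : ∃ p, p = P / R := ⟨_, rfl⟩
  have hPR : P = R * p := by rw [hp]; field_simp
  have hR₁' : R₁ = 2 * (R * p - (ξ * a₁ + ε * η * b₁)) := by rw [← hPR, hP]; ring
  rw [← hp] at hxu hyu
  -- `s` and `t` are the components of the centre's velocity in the same frame, unnormalized. Only
  -- `s² + ε t² = R A` is needed of them.
  obtain ⟨s, hs⟩ : ∃ s, s = ξ * a₁ + ε * η * b₁ := ⟨_, rfl⟩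
  obtain ⟨t, ht⟩ : ∃ t, t = ξ * b₁ - η * a₁ := ⟨_, rfl⟩
  obtain ⟨A, hA⟩ : ∃ A, A = a₁ ^ 2 + ε * b₁ ^ 2 := ⟨_, rfl⟩
  have hst : s ^ 2 + ε * t ^ 2 = R * A := by
    rw [hs, ht, hA, ← h0]; ring
  have hE' : E = ε * p ^ 2 * R + μ ^ 2 * R - ε * c₁ ^ 2 := by
    rw [hE, hxu, hyu, ← h0]
    linear_combination (μ ^ 2 * ε * η ^ 2 - 2 * p * μ * ξ * η - p ^ 2 * η ^ 2) * hε
  have hF' : F = R * θ * μ := by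
    rw [hF, hxu, hyu, hxv, hyv, ← h0]
    linear_combination (μ * θ * ε * η ^ 2 - p * θ * ξ * η) * hε
  have hG' : G = R * θ ^ 2 := by
    rw [hG, hxv, hyv, ← h0]
    linear_combination (θ ^ 2 * ε * η ^ 2) * hε
  have he' : e = c₁ * (Q - p ^ 2 * R - ε * μ ^ 2 * R + 2 * (p * s + ε * μ * t) - A)
      - R * p * c₂ := by
    rw [he, h11, hPR, hs, ht, hA, hxu, hyu, ← h0]
    ring
  have hf' : f = c₁ * (ε * θ * (t - R * μ)) := by
    rw [hf, h12, ht, hxu, hyu, hxv, hyv, ← h0]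
    ring
  have hg' : g = -(c₁ * ε * R * θ ^ 2) := by
    rw [hg, h22, hxv, hyv, ← h0]
    ring
  rw [← hs] at hR₁'
  rw [hE', hF', hG', he', hf', hg', hW, hZ, hR₁', hPR, ← hA]
  clear * - hε hst
  rcases sq_eq_one_iff.1 hε with rfl | rfl
  · exact ⟨by ring, by ring, by linear_combination -c₁ ^ 2 * θ ^ 2 * hst⟩
  · exact ⟨by ring, by ring, by linear_combination c₁ ^ 2 * θ ^ 2 * hst⟩

end ConicAlgebra

end Minkowski

namespace Minkowski

/-! ### Polynomial identities on a conic, by rational parametrization. -/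

section ConicPolynomials

open Polynomial

theorem poly_eq_zero {G : ℂ[X]} {S : Set ℂ} (hS : S.Infinite) (h : ∀ z ∈ S, G.eval z = 0) : G = 0 :=
  G.eq_zero_of_infinite_isRoot (hS.mono h)

/-- On a conic, the complex number `ξ + j η` with `j² = -ε` is a rational parameter. -/
theorem conic_parameter {ε ξ η R : ℝ} {j : ℂ} (hj : j ^ 2 = -ε) (h : ξ ^ 2 + ε * η ^ 2 = R) :
    ((ξ : ℂ) + j * η) * (ξ - j * η) = R := by
  rw [← h]; push_cast; linear_combination -(η : ℂ) ^ 2 * hj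

/-- As `(ξ + jη)(ξ - jη) = R ≠ 0`, the parameter determines the conjugate factor too. Infinitely
many points of the conic therefore give infinitely many values of `ζ`, enough to kill a polynomial.
-/
theorem conic_parameter_injOn {ε R : ℝ} {j : ℂ} (hj : j ^ 2 = -ε) (hε : ε ^ 2 = 1) (hR : R ≠ 0)
    {S : Set (ℝ × ℝ)} (hS : ∀ p ∈ S, p.1 ^ 2 + ε * p.2 ^ 2 = R) :
    Set.InjOn (fun p : ℝ × ℝ => (p.1 : ℂ) + j * p.2) S := by
  intro p hp q hq hpq
  have h1 := conic_parameter hj (hS p hp)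
  have h2 := conic_parameter hj (hS q hq)
  simp only at hpq
  have hz : (q.1 : ℂ) + j * q.2 ≠ 0 := by
    intro h0; rw [h0, zero_mul] at h2; exact hR (by exact_mod_cast h2.symm)
  rw [hpq] at h1
  have h3 := mul_left_cancel₀ hz (h1.trans h2.symm)
  have hj0 : j ≠ 0 := by
    rintro rfl
    have : ε = 0 := by simpa using hj
    rw [this] at hε; simp at hε
  have e1 : (p.1 : ℂ) = q.1 := by linear_combination (hpq + h3) / 2
  have e2 : j * ((p.2 : ℂ) - q.2) = 0 := by linear_combination (hpq - h3) / 2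
  have e3 : (p.2 : ℂ) = q.2 := by simpa [hj0, sub_eq_zero] using e2
  exact Prod.ext (by exact_mod_cast e1) (by exact_mod_cast e3)

theorem conic_affine {ε ξ η R : ℝ} {j ζ : ℂ} (hj : j ^ 2 = -ε) (h : ξ ^ 2 + ε * η ^ 2 = R)
    (hζ : ζ = ξ + j * η) (a b c : ℝ) :
    ζ * ((a * ξ + ε * b * η + c : ℝ) : ℂ) =
      (a - j * b) / 2 * ζ ^ 2 + c * ζ + (a + j * b) / 2 * R := by
  rw [← conic_parameter hj h, hζ]
  push_cast
  linear_combination ((ξ : ℂ) * b * η + j * η ^ 2 * b) * hj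

theorem conic_parameter_ne_zero {ε ξ η R : ℝ} {j : ℂ} (hj : j ^ 2 = -ε) (hR : R ≠ 0)
    (h : ξ ^ 2 + ε * η ^ 2 = R) : (ξ : ℂ) + j * η ≠ 0 := by
  intro h0
  have := conic_parameter hj h
  rw [h0, zero_mul] at this
  exact hR (by exact_mod_cast this.symm)

/-- Affine functions grow like `ζ` and `W` like `ζ²`, so `k₃² W⁶` is the only term of order `ζ¹²`.
Its coefficient is a nonzero multiple of `(a - jb)¹²`. -/
theorem conic_leading_coeff {ε R w₀ a b r za zb zc ta tb tc k₁ k₂ k₃ k₄ : ℝ} {j : ℂ}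
    (hj : j ^ 2 = -ε) (hε : ε ^ 2 = 1) (hR : R ≠ 0) (hk₃ : k₃ ≠ 0)
    {S : Set (ℝ × ℝ)} (hSi : S.Infinite) (hS : ∀ p ∈ S, p.1 ^ 2 + ε * p.2 ^ 2 = R)
    (h : ∀ p ∈ S, ∀ P Z T W : ℝ, P = a * p.1 + ε * b * p.2 + r →
      Z = za * p.1 + ε * zb * p.2 + zc → T = ta * p.1 + ε * tb * p.2 + tc →
      W = ε * (P ^ 2 - w₀) →
      (k₁ * Z * W + k₂ * T ^ 2 + k₃ * W ^ 3) ^ 2 = k₄ * T ^ 2 * W ^ 3) :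
    (a : ℂ) - j * b = 0 := by
  -- The variable is `ζ⁻¹`, so that the behaviour at infinity becomes evaluation at `0`. This
  -- polynomial represents `ζ⁻¹ (aξ + εbη + c)`.
  set aff : ℝ → ℝ → ℝ → ℂ[X] := fun a b c =>
    C (((a : ℂ) - j * b) / 2) + C (c : ℂ) * X + C (((a : ℂ) + j * b) / 2 * R) * X ^ 2 with haff
  set p := aff a b r
  set z := aff za zb zc
  set t := aff ta tb tc
  set w := C (ε : ℂ) * (p ^ 2 - C (w₀ : ℂ) * X ^ 2) with hw
  set G := (C (k₁ : ℂ) * z * w * X ^ 3 + C (k₂ : ℂ) * t ^ 2 * X ^ 4 + C (k₃ : ℂ) * w ^ 3) ^ 2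
    - C (k₄ : ℂ) * t ^ 2 * w ^ 3 * X ^ 4 with hG
  have hG0 : G = 0 := by
    have hinj := conic_parameter_injOn hj hε hR hS
    refine poly_eq_zero ((hSi.image hinj).image (f := fun ζ : ℂ => ζ⁻¹)
      inv_injective.injOn) ?_
    rintro _ ⟨_, ⟨s, hs, rfl⟩, rfl⟩
    obtain ⟨ζ, hζ⟩ : ∃ ζ : ℂ, ζ = s.1 + j * s.2 := ⟨_, rfl⟩
    have hζ0 : ζ ≠ 0 := hζ ▸ conic_parameter_ne_zero hj hR (hS s hs)
    simp only [← hζ]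
    have ev : ∀ a b c : ℝ, (aff a b c).eval ζ⁻¹ =
        ζ⁻¹ * ((a * s.1 + ε * b * s.2 + c : ℝ) : ℂ) := by
      intro a b c
      have := conic_affine hj (hS s hs) hζ a b c
      simp only [haff, eval_add, eval_mul, eval_C, eval_X, eval_pow]
      field_simp
      linear_combination -2 * this
    have hk := h s hs _ _ _ _ rfl rfl rfl rfl
    simp only [hG, hw, eval_sub, eval_add, eval_mul, eval_C, eval_X, eval_pow, p, z, t, ev]
    generalize a * s.1 + ε * b * s.2 + r = P at hk ⊢
    generalize za * s.1 + ε * zb * s.2 + zc = Z at hk ⊢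
    generalize ta * s.1 + ε * tb * s.2 + tc = T at hk ⊢
    have hw' : (ε : ℂ) * ((ζ⁻¹ * P) ^ 2 - w₀ * ζ⁻¹ ^ 2) = ζ⁻¹ ^ 2 * ((ε * (P ^ 2 - w₀) : ℝ) : ℂ) := by
      push_cast; ring
    rw [hw']
    generalize ε * (P ^ 2 - w₀) = W at hk ⊢
    have hk' : ((k₁ : ℂ) * Z * W + k₂ * T ^ 2 + k₃ * W ^ 3) ^ 2 = k₄ * T ^ 2 * W ^ 3 := by
      exact_mod_cast hk
    linear_combination (ζ⁻¹) ^ 12 * hk'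
  have h0 : G.eval 0 = 0 := by rw [hG0, eval_zero]
  have hk₃' : (k₃ : ℂ) ≠ 0 := by exact_mod_cast hk₃
  have hε0 : (ε : ℂ) ≠ 0 := by
    intro h; have : ε = 0 := by exact_mod_cast h
    rw [this] at hε; simp at hε
  simpa [hG, hw, p, haff, hk₃', hε0] using h0

theorem sextic_coeffs {S : Set ℂ} (hS : S.Infinite) {c₆ c₅ c₄ c₃ c₂ c₁ c₀ : ℂ}
    (h : ∀ z ∈ S, c₆ * z ^ 6 + c₅ * z ^ 5 + c₄ * z ^ 4 + c₃ * z ^ 3 + c₂ * z ^ 2 + c₁ * z + c₀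
      = 0) :
    c₆ = 0 ∧ c₅ = 0 ∧ c₄ = 0 ∧ c₃ = 0 ∧ c₂ = 0 ∧ c₁ = 0 ∧ c₀ = 0 := by
  have hG : C c₆ * X ^ 6 + C c₅ * X ^ 5 + C c₄ * X ^ 4 + C c₃ * X ^ 3 + C c₂ * X ^ 2 + C c₁ * X
      + C c₀ = 0 := poly_eq_zero hS (fun z hz => by simpa using h z hz)
  have hc := fun i => congrArg (fun G : ℂ[X] => G.coeff i) hG
  simp only [coeff_add, coeff_C_mul, coeff_X_pow, coeff_X, coeff_C, coeff_zero] at hc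
  exact ⟨by simpa using hc 6, by simpa using hc 5, by simpa using hc 4, by simpa using hc 3,
    by simpa using hc 2, by simpa using hc 1, by simpa using hc 0⟩

/-- If `P` is not constant, the extreme coefficients in `ζ` force `Z` to be constant. The left side
is then `k Z (P² - w₀)`, and with `w₀ ≠ 0` it can be the square of an affine function of `P` only if
both sides vanish. -/
theorem conic_divisibility {ε R w₀ a b r za zb zc k κ l : ℝ}
    (hε : ε ^ 2 = 1) (hR : R ≠ 0) (hk : k ≠ 0) (hw₀ : w₀ ≠ 0)
    {S : Set (ℝ × ℝ)} (hSi : S.Infinite) (hS : ∀ p ∈ S, p.1 ^ 2 + ε * p.2 ^ 2 = R)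
    (h : ∀ p ∈ S, ∀ P Z : ℝ, P = a * p.1 + ε * b * p.2 + r →
      Z = za * p.1 + ε * zb * p.2 + zc →
      k * Z * (P ^ 2 - w₀) = (Z + κ * P + l) ^ 2) :
    (a = 0 ∧ b = 0) ∨ (κ = 0 ∧ l = 0) := by
  obtain ⟨j, hj⟩ : ∃ j : ℂ, j ^ 2 = -ε := IsAlgClosed.exists_pow_nat_eq _ two_pos
  obtain ⟨α, hα⟩ : ∃ α : ℂ, α = ((a : ℂ) - j * b) / 2 := ⟨_, rfl⟩
  obtain ⟨β, hβ⟩ : ∃ β : ℂ, β = ((a : ℂ) + j * b) / 2 * R := ⟨_, rfl⟩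
  obtain ⟨x, hx⟩ : ∃ x : ℂ, x = ((za : ℂ) - j * zb) / 2 := ⟨_, rfl⟩
  obtain ⟨y, hy⟩ : ∃ y : ℂ, y = ((za : ℂ) + j * zb) / 2 * R := ⟨_, rfl⟩
  -- These are the coefficients of the identity times `ζ³`, after substituting `ζP = αζ² + rζ + β`
  -- and `ζZ = xζ² + zc ζ + y`.
  have hco := sextic_coeffs (hSi.image (conic_parameter_injOn hj hε hR hS))
    (c₆ := k * x * α ^ 2)
    (c₅ := k * (zc * α ^ 2 + x * (2 * α * r)) - (x + κ * α) ^ 2)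
    (c₄ := k * (x * (r ^ 2 + 2 * α * β - w₀) + zc * (2 * α * r) + y * α ^ 2)
          - 2 * (x + κ * α) * (zc + κ * r + l))
    (c₃ := k * (x * (2 * r * β) + zc * (r ^ 2 + 2 * α * β - w₀) + y * (2 * α * r))
          - (2 * (x + κ * α) * (y + κ * β) + (zc + κ * r + l) ^ 2))
    (c₂ := k * (x * β ^ 2 + zc * (2 * r * β) + y * (r ^ 2 + 2 * α * β - w₀))
          - 2 * (y + κ * β) * (zc + κ * r + l))
    (c₁ := k * (zc * β ^ 2 + y * (2 * r * β)) - (y + κ * β) ^ 2)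
    (c₀ := k * y * β ^ 2) (by
      rintro _ ⟨s, hs, rfl⟩
      obtain ⟨ζ, hζ⟩ : ∃ ζ : ℂ, ζ = s.1 + j * s.2 := ⟨_, rfl⟩
      simp only [← hζ]
      have e1 := conic_affine hj (hS s hs) hζ a b r
      have e2 := conic_affine hj (hS s hs) hζ za zb zc
      have hk := h s hs _ _ rfl rfl
      rw [← hα, ← hβ] at e1
      rw [← hx, ← hy] at e2
      generalize a * s.1 + ε * b * s.2 + r = P at hk e1
      generalize za * s.1 + ε * zb * s.2 + zc = Z at hk e2
      have hk' : (k : ℂ) * Z * (P ^ 2 - w₀) = (Z + κ * P + l) ^ 2 := by exact_mod_cast hk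
      have hk2 : k * (ζ * Z) * ((ζ * P) ^ 2 - w₀ * ζ ^ 2)
          = ζ * (ζ * Z + κ * (ζ * P) + l * ζ) ^ 2 := by linear_combination ζ ^ 3 * hk'
      rw [e1, e2] at hk2
      linear_combination hk2)
  obtain ⟨h6, h5, h4, h3, h2, h1, h0⟩ := hco
  have hkC : (k : ℂ) ≠ 0 := by exact_mod_cast hk
  have hwC : (w₀ : ℂ) ≠ 0 := by exact_mod_cast hw₀
  have hRC : (R : ℂ) ≠ 0 := by exact_mod_cast hR
  by_cases hab : α = 0 ∧ β = 0
  · left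
    obtain ⟨ha0, hb0⟩ := hab
    rw [ha0] at hα
    rw [hb0] at hβ
    have hβ' : (a : ℂ) + j * b = 0 := by
      have := hβ.symm
      simpa [hRC] using this
    have ha : (a : ℂ) = 0 := by linear_combination hβ' / 2 - hα
    have ha' : a = 0 := by exact_mod_cast ha
    have hj0 : j ≠ 0 := by
      rintro rfl
      have : ε = 0 := by simpa using hj
      rw [this] at hε; simp at hε
    rw [ha, zero_add] at hβ'
    exact ⟨ha', by simpa [hj0] using hβ'⟩
  right
  have hx0 : x = 0 := by
    by_cases hα0 : α = 0
    · rw [hα0] at h5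
      have : x ^ 2 = 0 := by linear_combination -h5
      simpa using this
    · simpa [hkC, hα0] using h6
  have hy0 : y = 0 := by
    by_cases hβ0 : β = 0
    · rw [hβ0] at h1
      have : y ^ 2 = 0 := by linear_combination -h1
      simpa using this
    · simpa [hkC, hβ0] using h0
  simp only [hx0, hy0] at h5 h4 h3 h2 h1
  -- The `P²` and `P` coefficients of `k zc (P² - w₀) = (κP + zc + l)²`, read off from whichever end
  -- of the polynomial in `ζ` does not degenerate.
  have hA : (k : ℂ) * zc = κ ^ 2 ∧ (κ : ℂ) * (zc + l) = 0 := by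
    by_cases hα0 : α = 0
    · have hβ0 : β ≠ 0 := fun h => hab ⟨hα0, h⟩
      have e1 : (k : ℂ) * zc = κ ^ 2 := by
        apply mul_right_cancel₀ (pow_ne_zero 2 hβ0); linear_combination h1
      refine ⟨e1, ?_⟩
      apply mul_right_cancel₀ hβ0
      linear_combination -h2 / 2 + r * β * e1
    · have e1 : (k : ℂ) * zc = κ ^ 2 := by
        apply mul_right_cancel₀ (pow_ne_zero 2 hα0); linear_combination h5
      refine ⟨e1, ?_⟩
      apply mul_right_cancel₀ hα0
      linear_combination -h4 / 2 + r * α * e1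
  obtain ⟨e1, e2⟩ := hA
  have e3 : (κ : ℂ) ^ 4 * w₀ = 0 := by
    linear_combination (-κ ^ 2) * h3 + (κ ^ 2 * (r ^ 2 + 2 * α * β - w₀)) * e1
      - (κ * (zc + l) + 2 * κ ^ 2 * r) * e2
  have hκ : (κ : ℂ) = 0 := by simpa [hwC] using e3
  rw [hκ] at e1 h3
  have hz : (zc : ℂ) = 0 := by
    have : (k : ℂ) * zc = 0 := by rw [e1]; ring
    simpa [hkC] using this
  rw [hz] at h3
  have hl : (l : ℂ) ^ 2 = 0 := by linear_combination -h3
  exact ⟨by exact_mod_cast hκ, by simpa using hl⟩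

end ConicPolynomials

end Minkowski

/-! ### Surfaces foliated by circles or hyperbolas: the relation along a leaf. -/

namespace Minkowski

/-- The surface `X` is foliated by the conics `(x - a)² + ε (y - b)² = R`, `z = c`, where
`x, y, z` are pseudo-orthonormal coordinates in which the metric is `ε x² + y² - ε z²`. -/
structure ConicFoliation (ε : ℝ) (i₀ i₁ i₂ : Fin 3) (X : ℝ × ℝ → E31) (U : Set (ℝ × ℝ))
    (a b R c : ℝ → ℝ) : Prop where
  sign : ε ^ 2 = 1
  form : ∀ V W : E31, lor V W = ε * (V i₀ * W i₀) + V i₁ * W i₁ - ε * (V i₂ * W i₂)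
  vec : ∀ α β γ : ℝ, ∃ V : E31, V i₀ = α ∧ V i₁ = β ∧ V i₂ = γ
  conic : ∀ p ∈ U, (X p i₀ - a p.1) ^ 2 + ε * (X p i₁ - b p.1) ^ 2 = R p.1
  plane : ∀ p ∈ U, X p i₂ = c p.1
  radius : ∀ p ∈ U, 0 < R p.1

section Conic

variable {ε : ℝ} {i₀ i₁ i₂ : Fin 3} {X N : ℝ × ℝ → E31} {U : Set (ℝ × ℝ)} {a b R c : ℝ → ℝ}
  {m n : ℝ} {q : ℝ × ℝ}

theorem pd_quadric {f g h : ℝ × ℝ → ℝ} {ε : ℝ} (hU : IsOpen U) (hf : ContDiffOn ℝ ∞ f U)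
    (hg : ContDiffOn ℝ ∞ g U) (e : ∀ p ∈ U, f p ^ 2 + ε * g p ^ 2 = h p) (w : ℝ × ℝ)
    (hq : q ∈ U) : 2 * (f q * pd w f q + ε * (g q * pd w g q)) = pd w h q := by
  have df := diffAt_of_smooth hU hf hq
  have dg := diffAt_of_smooth hU hg hq
  rw [← pd_congr (f := fun p => f p * f p + ε * (g p * g p)) (g := h) hU
    (fun p hp => by rw [← e p hp]; ring) hq w,
    pd_add (f := fun p => f p * f p) (g := fun p => ε * (g p * g p)) w (df.mul df)
      ((dg.mul dg).const_mul ε),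
    pd_mul w df df, pd_const_mul (f := fun p => g p * g p) w ε (dg.mul dg), pd_mul w dg dg]
  ring

theorem pd_pd_quadric {f g h : ℝ × ℝ → ℝ} {ε : ℝ} (hU : IsOpen U) (hf : ContDiffOn ℝ ∞ f U)
    (hg : ContDiffOn ℝ ∞ g U) (e : ∀ p ∈ U, f p ^ 2 + ε * g p ^ 2 = h p) (w w' : ℝ × ℝ)
    (hq : q ∈ U) : 2 * (pd w' f q * pd w f q + f q * pd w' (pd w f) q
      + ε * (pd w' g q * pd w g q + g q * pd w' (pd w g) q)) = pd w' (pd w h) q := by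
  have df := diffAt_of_smooth hU hf hq
  have dg := diffAt_of_smooth hU hg hq
  have dfw := diffAt_of_smooth hU (pd_smooth hU hf w) hq
  have dgw := diffAt_of_smooth hU (pd_smooth hU hg w) hq
  rw [← pd_congr (f := fun p => 2 * (f p * pd w f p + ε * (g p * pd w g p))) hU
    (fun p hp => pd_quadric hU hf hg e w hp) hq w',
    pd_const_mul (f := fun p => f p * pd w f p + ε * (g p * pd w g p)) w' 2
      ((df.mul dfw).add ((dg.mul dgw).const_mul ε)),
    pd_add (f := fun p => f p * pd w f p) (g := fun p => ε * (g p * pd w g p)) w' (df.mul dfw)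
      ((dg.mul dgw).const_mul ε),
    pd_mul w' df dfw, pd_const_mul (f := fun p => g p * pd w g p) w' ε (dg.mul dgw),
    pd_mul w' dg dgw]

namespace ConicFoliation

theorem leaf_pos (h : ConicFoliation ε i₀ i₁ i₂ X U a b R c) (hU : IsOpen U)
    (hX : IsSpacelikeImmersion X U) (hq : q ∈ U) :
    0 < ε * pd (0, 1) X q i₀ ^ 2 + pd (0, 1) X q i₁ ^ 2 := by
  have hG := (metric_pos hX hq).2
  rw [h.form] at hG
  have hz : pd (0, 1) X q i₂ = 0 := by
    rw [← pd_apply _ (diffAt_of_smooth hU hX.1 hq)]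
    have d := hasDerivAt_snd hU (comp_apply_smooth hX.1 i₂) hq
    have e : (fun s => X (q.1, s) i₂) =ᶠ[𝓝 q.2] fun _ => c q.1 := by
      filter_upwards [eventually_snd_mem hU hq] with s hs using h.plane _ hs
    exact d.unique ((hasDerivAt_const _ _).congr_of_eventuallyEq e)
  rw [hz] at hG
  linarith

theorem smooth (h : ConicFoliation ε i₀ i₁ i₂ X U a b R c) (hU : IsOpen U)
    (hX : IsSpacelikeImmersion X U) :
    ContDiffOn ℝ ∞ a (Prod.fst '' U) ∧ ContDiffOn ℝ ∞ b (Prod.fst '' U) ∧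
      ContDiffOn ℝ ∞ R (Prod.fst '' U) ∧ ContDiffOn ℝ ∞ c (Prod.fst '' U) := by
  obtain ⟨h1, h2, h3⟩ := conic_smooth hU h.sign (comp_apply_smooth hX.1 i₀)
    (comp_apply_smooth hX.1 i₁) h.conic (fun p hp => by
      rw [pd_apply _ (diffAt_of_smooth hU hX.1 hp), pd_apply _ (diffAt_of_smooth hU hX.1 hp)]
      exact h.leaf_pos hU hX hp)
  exact ⟨h1, h2, h3, smooth_of_fst_smooth hU (comp_apply_smooth hX.1 i₂) h.plane⟩

/-- The coordinate pairs, relative to the centre, of the points of the leaf through `q`. -/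
def leaf (X : ℝ × ℝ → E31) (U : Set (ℝ × ℝ)) (i₀ i₁ : Fin 3) (a b : ℝ → ℝ) (u : ℝ) :
    Set (ℝ × ℝ) :=
  (fun v => (X (u, v) i₀ - a u, X (u, v) i₁ - b u)) '' {v | (u, v) ∈ U}

/-- An interval of the leaf has connected image, and this image is not a single point because the
leaf has positive speed. -/
theorem leaf_infinite (h : ConicFoliation ε i₀ i₁ i₂ X U a b R c) (hU : IsOpen U)
    (hX : IsSpacelikeImmersion X U) (hq : q ∈ U) : (leaf X U i₀ i₁ a b q.1).Infinite := by
  obtain ⟨r, hr, hball⟩ := Metric.eventually_nhds_iff_ball.1 (eventually_snd_mem hU hq)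
  set J := Metric.ball q.2 r with hJ
  set g : ℝ → ℝ × ℝ := fun v => (X (q.1, v) i₀ - a q.1, X (q.1, v) i₁ - b q.1) with hg
  have d0 : ∀ v ∈ J, HasDerivAt (fun s => X (q.1, s) i₀) (pd (0, 1) (fun p => X p i₀) (q.1, v)) v :=
    fun v hv => hasDerivAt_snd hU (comp_apply_smooth hX.1 i₀) (hball v hv)
  have d1 : ∀ v ∈ J, HasDerivAt (fun s => X (q.1, s) i₁) (pd (0, 1) (fun p => X p i₁) (q.1, v)) v :=
    fun v hv => hasDerivAt_snd hU (comp_apply_smooth hX.1 i₁) (hball v hv)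
  have hcont : ContinuousOn g J := fun v hv =>
    (((d0 v hv).continuousAt.sub continuousAt_const).prodMk
      ((d1 v hv).continuousAt.sub continuousAt_const)).continuousWithinAt
  have hsub : g '' J ⊆ leaf X U i₀ i₁ a b q.1 := Set.image_mono hball
  refine Set.Infinite.mono hsub (IsPreconnected.infinite_of_nontrivial
    ((convex_ball q.2 r).isPreconnected.image g hcont) ?_)
  by_contra hnt
  rw [Set.not_nontrivial_iff] at hnt
  have hq2 : q.2 ∈ J := Metric.mem_ball_self hr
  have hev : ∀ᶠ v in 𝓝 q.2, g v = g q.2 := by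
    filter_upwards [Metric.ball_mem_nhds q.2 hr] with v hv
    exact hnt ⟨v, hv, rfl⟩ ⟨_, hq2, rfl⟩
  have z0 := (d0 _ hq2).unique ((hasDerivAt_const q.2 (X q i₀)).congr_of_eventuallyEq (by
    filter_upwards [hev] with v hv
    simpa [hg] using congrArg Prod.fst hv))
  have z1 := (d1 _ hq2).unique ((hasDerivAt_const q.2 (X q i₁)).congr_of_eventuallyEq (by
    filter_upwards [hev] with v hv
    simpa [hg] using congrArg Prod.snd hv))
  rw [pd_apply _ (diffAt_of_smooth hU hX.1 hq)] at z0 z1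
  have := h.leaf_pos hU hX hq
  rw [show pd (0, 1) X q i₀ = 0 from z0, show pd (0, 1) X q i₁ = 0 from z1] at this
  simp at this

/-- `P` and `Q` are half the first and second `u`-derivatives of the conic equation, up to terms in
the velocity of `(ξ, η)`. Along one leaf `P`, `Q`, `Z`, `T` are affine in `(ξ, η)` and `W` is
quadratic, which makes the relation usable as a polynomial identity. -/
theorem relation (h : ConicFoliation ε i₀ i₁ i₂ X U a b R c) (hU : IsOpen U)
    (hX : IsSpacelikeImmersion X U) (hN : IsGaussMap X N U) (hW : IsLinearWeingarten X N U m n)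
    (hq : q ∈ U) {ξ η P Q W Z T A : ℝ} (hξ : ξ = X q i₀ - a q.1) (hη : η = X q i₁ - b q.1)
    (hP : P = deriv a q.1 * ξ + ε * deriv b q.1 * η + deriv R q.1 / 2)
    (hQ : Q = deriv (deriv a) q.1 * ξ + ε * deriv (deriv b) q.1 * η + deriv (deriv R) q.1 / 2)
    (hA : A = deriv a q.1 ^ 2 + ε * deriv b q.1 ^ 2)
    (hW' : W = ε * (P ^ 2 - R q.1 * deriv c q.1 ^ 2))
    (hZ : Z = deriv c q.1 * (R q.1 * Q - deriv R q.1 ^ 2 / 4) - R q.1 * P * deriv (deriv c) q.1)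
    (hT : T = Z + deriv c q.1 * deriv R q.1 ^ 2 / 4 - deriv c q.1 * P * deriv R q.1
      - R q.1 * deriv c q.1 * A + R q.1 * deriv c q.1 ^ 3) :
    0 < W ∧ ∃ τ, τ ^ 2 = W ^ 3 ∧
      (1 + m) ^ 2 * (-ε * deriv c q.1 * Z) * W - m * T ^ 2 + n ^ 2 * W ^ 3
        = n * (1 - m) * τ * T := by
  obtain ⟨sa, sb, sR, sc⟩ := h.smooth hU hX
  have sX := hX.1
  have sx := comp_apply_smooth sX i₀
  have sy := comp_apply_smooth sX i₁
  have hε := h.sign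
  have hξs : ContDiffOn ℝ ∞ (fun p => X p i₀ - a p.1) U := sx.sub (fst_smooth sa)
  have hηs : ContDiffOn ℝ ∞ (fun p => X p i₁ - b p.1) U := sy.sub (fst_smooth sb)
  have dX := fun p hp => diffAt_of_smooth hU sX (q := p) hp
  have first : ∀ (i : Fin 3) {α : ℝ → ℝ}, ContDiffOn ℝ ∞ α (Prod.fst '' U) → ∀ w, ∀ p ∈ U,
      pd w (fun p => X p i - α p.1) p = pd w X p i - w.1 * deriv α p.1 := by
    intro i α hα w p hp
    rw [pd_sub (f := fun p => X p i) w (diffAt_of_smooth hU (comp_apply_smooth sX i) hp)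
      (diffAt_of_smooth hU (fst_smooth hα) hp), pd_apply w (dX p hp), pd_fst hU hα hp]
  have second : ∀ (i : Fin 3) {α : ℝ → ℝ}, ContDiffOn ℝ ∞ α (Prod.fst '' U) → ∀ w w',
      pd w' (pd w (fun p => X p i - α p.1)) q
        = pd w' (pd w X) q i - w'.1 * w.1 * deriv (deriv α) q.1 := by
    intro i α hα w w'
    have hα' := deriv_smooth (isOpen_fst_image hU) hα
    rw [pd_congr hU (first i hα w) hq w',
      pd_sub (f := fun p => pd w X p i) w'
        (diffAt_of_smooth hU (comp_apply_smooth (pd_smooth hU sX w) i) hq)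
        ((diffAt_of_smooth hU (fst_smooth hα') hq).const_mul _),
      pd_const_mul w' _ (diffAt_of_smooth hU (fst_smooth hα') hq), pd_fst hU hα' hq,
      pd_apply w' (diffAt_of_smooth hU (pd_smooth hU sX w) hq)]
    ring
  have F := fun w => pd_quadric hU hξs hηs h.conic w hq
  have S := fun w w' => pd_pd_quadric hU hξs hηs h.conic w w' hq
  simp only [first i₀ sa _ q hq, first i₁ sb _ q hq, second i₀ sa, second i₁ sb,
    pd_fst hU sR hq, pd_pd_fst hU sR hq] at F S
  have F1 := F (1, 0)
  have F2 := F (0, 1)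
  have S11 := S (1, 0) (1, 0)
  have S12 := S (0, 1) (1, 0)
  have S22 := S (0, 1) (0, 1)
  have plane1 : ∀ w, ∀ p ∈ U, pd w X p i₂ = w.1 * deriv c p.1 := by
    intro w p hp
    rw [← pd_apply w (dX p hp), pd_congr hU h.plane hp w, pd_fst hU sc hp]
  have plane2 : ∀ w w', pd w' (pd w X) q i₂ = w'.1 * w.1 * deriv (deriv c) q.1 := by
    intro w w'
    rw [← pd_pd_apply hU sX hq, pd_congr (g := pd w fun p => c p.1) hU
      (fun p hp => pd_congr hU h.plane hp w) hq w', pd_pd_fst hU sc hq]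
  have zu : pd (1, 0) X q i₂ = deriv c q.1 := by simp [plane1 _ q hq]
  have zv : pd (0, 1) X q i₂ = 0 := by simp [plane1 _ q hq]
  have zuu : pd (1, 0) (pd (1, 0) X) q i₂ = deriv (deriv c) q.1 := by simp [plane2]
  have zuv : pd (1, 0) (pd (0, 1) X) q i₂ = 0 := by simp [plane2]
  have zvv : pd (0, 1) (pd (0, 1) X) q i₂ = 0 := by simp [plane2]
  simp only [← hξ, ← hη] at F1 F2 S11 S12 S22
  have h0 : ξ ^ 2 + ε * η ^ 2 = R q.1 := by rw [hξ, hη]; exact h.conic q hq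
  -- An unnormalized normal: pairing with `ℓ` is `V ↦ c' (ξ V₀ + ε η V₁) - P V₂`, which kills `X_u`
  -- and `X_v`, and `⟨ℓ, ℓ⟩ = -W`.
  obtain ⟨ℓ, hℓ0, hℓ1, hℓ2⟩ := h.vec (ε * (deriv c q.1 * ξ)) (deriv c q.1 * (ε * η)) (ε * P)
  have hR := h.radius q hq
  have h1 : ξ * pd (1, 0) X q i₀ + ε * η * pd (1, 0) X q i₁ = P := by
    rw [hP]; linear_combination F1 / 2
  have h2 : ξ * pd (0, 1) X q i₀ + ε * η * pd (0, 1) X q i₁ = 0 := by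
    linear_combination F2 / 2
  have forms := conic_forms hε hR.ne' h0 (a₁ := deriv a q.1) (b₁ := deriv b q.1)
    (R₁ := deriv R q.1) (c₁ := deriv c q.1) (c₂ := deriv (deriv c) q.1) (P := P) (Q := Q)
    (xuu := pd (1, 0) (pd (1, 0) X) q i₀) (yuu := pd (1, 0) (pd (1, 0) X) q i₁)
    (xuv := pd (1, 0) (pd (0, 1) X) q i₀) (yuv := pd (1, 0) (pd (0, 1) X) q i₁)
    (xvv := pd (0, 1) (pd (0, 1) X) q i₀) (yvv := pd (0, 1) (pd (0, 1) X) q i₁)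
    (by rw [hP]; ring) h1 h2
    (by rw [hQ]; linear_combination S11 / 2)
    (by linear_combination S12 / 2)
    (by linear_combination S22 / 2)
    rfl rfl rfl rfl rfl rfl rfl hW' hZ
  obtain ⟨f1, f2, f3⟩ := forms
  have hlor : ∀ V, lor ℓ V = deriv c q.1 * (ξ * V i₀ + ε * η * V i₁) - P * V i₂ := by
    intro V
    rw [h.form, hℓ0, hℓ1, hℓ2]
    linear_combination (deriv c q.1 * ξ * V i₀ - P * V i₂) * hε
  have := weingarten_relation hU hX hN hW hq (ℓ := ℓ) (δ := 1) one_pos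
    (by rw [h.form, zu]; ring) (by rw [h.form, zu, zv]; ring) (by rw [h.form, zv]; ring)
    (by rw [hlor, h1, zu]; ring) (by rw [hlor, h2, zv]; ring)
    (by
      rw [hlor, hℓ0, hℓ1, hℓ2, hW', ← h0]
      ring)
    (by rw [hlor, zuu]) (by rw [hlor, zuv]; ring) (by rw [hlor, zvv]; ring) f1 f2 f3
  rw [hT, hA]
  simpa only [one_mul, mul_one] using this

end ConicFoliation

end Conic

end Minkowski

/-! ### Stationary centres, and the motion of the planes. -/

namespace Minkowski

namespace ConicFoliation

variable {ε : ℝ} {i₀ i₁ i₂ : Fin 3} {X N : ℝ × ℝ → E31} {U : Set (ℝ × ℝ)} {a b R c : ℝ → ℝ}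
  {m n : ℝ} {q : ℝ × ℝ}

theorem leaf_conic (h : ConicFoliation ε i₀ i₁ i₂ X U a b R c) (u : ℝ) :
    ∀ p ∈ leaf X U i₀ i₁ a b u, p.1 ^ 2 + ε * p.2 ^ 2 = R u := by
  rintro _ ⟨v, hv, rfl⟩
  exact h.conic _ hv

/-- If `n ≠ 0`, the centres of the leaves do not move. -/
theorem center_stationary_of_ne_zero (h : ConicFoliation ε i₀ i₁ i₂ X U a b R c) (hU : IsOpen U)
    (hX : IsSpacelikeImmersion X U) (hN : IsGaussMap X N U) (hW : IsLinearWeingarten X N U m n)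
    (hn : n ≠ 0) (hq : q ∈ U) : deriv a q.1 = 0 ∧ deriv b q.1 = 0 := by
  obtain ⟨j, hj⟩ : ∃ j : ℂ, j ^ 2 = -ε := IsAlgClosed.exists_pow_nat_eq _ two_pos
  set c₁ := deriv c q.1
  set c₂ := deriv (deriv c) q.1
  set a₁ := deriv a q.1
  set b₁ := deriv b q.1
  set R₁ := deriv R q.1
  set r := R q.1
  have key : ∀ j : ℂ, j ^ 2 = -ε → (a₁ : ℂ) - j * b₁ = 0 := by
    intro j hj
    refine conic_leading_coeff (w₀ := r * c₁ ^ 2) (r := R₁ / 2)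
      (za := c₁ * r * deriv (deriv a) q.1 - r * c₂ * a₁)
      (zb := c₁ * r * deriv (deriv b) q.1 - r * c₂ * b₁)
      (zc := c₁ * (r * (deriv (deriv R) q.1 / 2) - R₁ ^ 2 / 4) - r * c₂ * (R₁ / 2))
      (ta := c₁ * r * deriv (deriv a) q.1 - r * c₂ * a₁ - c₁ * R₁ * a₁)
      (tb := c₁ * r * deriv (deriv b) q.1 - r * c₂ * b₁ - c₁ * R₁ * b₁)
      (tc := c₁ * (r * (deriv (deriv R) q.1 / 2) - R₁ ^ 2 / 4) - r * c₂ * (R₁ / 2)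
        - c₁ * R₁ * (R₁ / 2) + c₁ * R₁ ^ 2 / 4 - r * c₁ * (a₁ ^ 2 + ε * b₁ ^ 2) + r * c₁ ^ 3)
      (k₁ := (1 + m) ^ 2 * (-ε * c₁)) (k₂ := -m) (k₃ := n ^ 2) (k₄ := (n * (1 - m)) ^ 2)
      hj h.sign (h.radius q hq).ne' (pow_ne_zero 2 hn) (h.leaf_infinite hU hX hq)
      (h.leaf_conic q.1) ?_
    rintro _ ⟨v, hv, rfl⟩ P Z T W hP hZ hT hW'
    obtain ⟨-, τ, hτ, e⟩ := h.relation hU hX hN hW hv rfl rfl hP rfl rfl hW' (Z := Z) (T := T)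
      (by rw [hZ, hP]; ring) (by rw [hT, hZ, hP]; ring)
    have e' : (1 + m) ^ 2 * (-ε * c₁) * Z * W + -m * T ^ 2 + n ^ 2 * W ^ 3
        = n * (1 - m) * τ * T := by rw [← e]; ring
    rw [e']
    -- Squaring eliminates the root `τ`.
    linear_combination (n * (1 - m) * T) ^ 2 * hτ
  have e1 := key j hj
  have e2 := key (-j) (by rw [neg_sq, hj])
  have ha : (a₁ : ℂ) = 0 := by linear_combination (e1 + e2) / 2
  have hj0 : j ≠ 0 := by
    rintro rfl
    have : ε = 0 := by simpa using hj
    have := h.sign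
    simp_all
  have hb : j * (b₁ : ℂ) = 0 := by linear_combination (e2 - e1) / 2
  exact ⟨by exact_mod_cast ha, by simpa [hj0] using hb⟩

/-- If `n = 0` and `m ≠ -1`, the centres do not move as long as the planes do. -/
theorem center_stationary_of_eq_zero (h : ConicFoliation ε i₀ i₁ i₂ X U a b R c) (hU : IsOpen U)
    (hX : IsSpacelikeImmersion X U) (hN : IsGaussMap X N U) (hW : IsLinearWeingarten X N U m 0)
    (hm : m ≠ 0) (hm1 : m ≠ -1) (hq : q ∈ U) (hc : deriv c q.1 ≠ 0) :
    deriv a q.1 = 0 ∧ deriv b q.1 = 0 := by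
  have hr := h.radius q hq
  have hε := h.sign
  set c₁ := deriv c q.1
  set c₂ := deriv (deriv c) q.1
  set a₁ := deriv a q.1
  set b₁ := deriv b q.1
  set R₁ := deriv R q.1
  set r := R q.1
  have hm1' : 1 + m ≠ 0 := fun h => hm1 (by linarith)
  have key := conic_divisibility (w₀ := r * c₁ ^ 2) (r := R₁ / 2) (a := a₁) (b := b₁)
      (za := c₁ * r * deriv (deriv a) q.1 - r * c₂ * a₁)
      (zb := c₁ * r * deriv (deriv b) q.1 - r * c₂ * b₁)
      (zc := c₁ * (r * (deriv (deriv R) q.1 / 2) - R₁ ^ 2 / 4) - r * c₂ * (R₁ / 2))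
      -- For `n = 0` the relation reads `-(1+m)² c₁ Z (P² - R c₁²) = m T²`, and `T = Z + κP + l`
      -- with these constants.
      (k := -((1 + m) ^ 2 * c₁ / m)) (κ := -(c₁ * R₁))
      (l := c₁ * R₁ ^ 2 / 4 - r * c₁ * (a₁ ^ 2 + ε * b₁ ^ 2) + r * c₁ ^ 3)
      hε hr.ne' (neg_ne_zero.2 (div_ne_zero (mul_ne_zero (pow_ne_zero 2 hm1') hc) hm))
      (mul_ne_zero hr.ne' (pow_ne_zero 2 hc)) (h.leaf_infinite hU hX hq) (h.leaf_conic q.1) (by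
        rintro _ ⟨v, hv, rfl⟩ P Z hP hZ
        obtain ⟨-, τ, hτ, e⟩ := h.relation hU hX hN hW hv rfl rfl hP rfl rfl rfl (Z := Z)
          (by rw [hZ, hP]; ring) rfl
        apply mul_left_cancel₀ hm
        have hdiv : m * (-((1 + m) ^ 2 * c₁ / m) * Z * (P ^ 2 - r * c₁ ^ 2))
            = -((1 + m) ^ 2 * c₁ * Z * (P ^ 2 - r * c₁ ^ 2)) := by field_simp
        rw [hdiv]
        linear_combination e + (1 + m) ^ 2 * c₁ * Z * (P ^ 2 - r * c₁ ^ 2) * hε)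
  refine key.resolve_right ?_
  rintro ⟨hκ, hl⟩
  have hR₁ : R₁ = 0 := by simpa [hc] using hκ
  have hA : a₁ ^ 2 + ε * b₁ ^ 2 = c₁ ^ 2 := by
    rw [hR₁] at hl
    have : r * c₁ * (c₁ ^ 2 - (a₁ ^ 2 + ε * b₁ ^ 2)) = 0 := by linear_combination hl
    have := (mul_eq_zero.1 this).resolve_left (mul_ne_zero hr.ne' hc)
    linarith
  obtain ⟨hpos, -⟩ := h.relation hU hX hN hW hq rfl rfl rfl rfl rfl rfl rfl rfl
  have hcon := h.conic q hq
  set ξ := X q i₀ - a q.1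
  set η := X q i₁ - b q.1
  -- In the exceptional case a Lagrange identity shows `W ≤ 0`, so the surface would not be
  -- spacelike.
  have e : ε * ((a₁ * ξ + ε * b₁ * η + R₁ / 2) ^ 2 - r * c₁ ^ 2) = -(ξ * b₁ - η * a₁) ^ 2 := by
    rw [hR₁, ← hA, show r = ξ ^ 2 + ε * η ^ 2 from hcon.symm]
    rcases sq_eq_one_iff.1 hε with rfl | rfl <;> ring
  have : 0 < -(ξ * b₁ - η * a₁) ^ 2 := e ▸ hpos
  nlinarith [sq_nonneg (ξ * b₁ - η * a₁)]

/-- For `c ≠ 0`, `z / c` is a root of a monic quadratic with coefficients `β` and `γ`; the estimate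
is the usual root bound, uniform in `c`. -/
theorem abs_le_of_quadratic {z c β γ : ℝ} (h : z ^ 2 + c * β * z + c ^ 2 * γ = 0) :
    |z| ≤ (1 + |β| + |γ|) * |c| := by
  by_cases hc : c = 0
  · subst hc
    have : z = 0 := by simpa using h
    simp [this]
  by_contra! hlt
  have hc' : 0 < |c| := abs_pos.2 hc
  have h1 : |z| ^ 2 ≤ |c| * |β| * |z| + |c| ^ 2 * |γ| := by
    calc |z| ^ 2 = |z ^ 2| := (abs_pow z 2).symm
      _ = |c * β * z + c ^ 2 * γ| := by rw [← abs_neg]; congr 1; linarith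
      _ ≤ |c * β * z| + |c ^ 2 * γ| := abs_add_le _ _
      _ = _ := by simp only [abs_mul, abs_pow]
  have hβ := abs_nonneg β
  have hγ := abs_nonneg γ
  have h2 : |c| ≤ |z| := by nlinarith
  have h3 : 0 < |z| := hc'.trans_le h2
  have h4 : |c| ^ 2 * |γ| ≤ |c| * |γ| * |z| := by
    have : 0 ≤ |c| * |γ| := by positivity
    nlinarith
  nlinarith [mul_lt_mul_of_pos_right hlt h3]

/-- With `n = 0` and `T = Z + c'B`, the relation is a quadratic equation for `Z` whose lower
coefficients carry the factors `c'` and `c'²`, so `Z = O(c')`. Since `R P c'' = c' Y - Z`, and `P ≠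
0` because `W > 0`, also `c'' = O(c')`. -/
theorem deriv_plane_bound (h : ConicFoliation 1 i₀ i₁ i₂ X U a b R c) (hU : IsOpen U)
    (hX : IsSpacelikeImmersion X U) (hN : IsGaussMap X N U) (hW : IsLinearWeingarten X N U m 0)
    (hm : m ≠ 0) :
    ∃ K : ℝ × ℝ → ℝ, ContinuousOn K U ∧
      ∀ p ∈ U, |deriv (deriv c) p.1| ≤ K p * |deriv c p.1| := by
  obtain ⟨sa, sb, sR, sc⟩ := h.smooth hU hX
  have hI := isOpen_fst_image hU
  have cont : ∀ {α : ℝ → ℝ}, ContDiffOn ℝ ∞ α (Prod.fst '' U) →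
      ContinuousOn (fun p : ℝ × ℝ => α p.1) U := fun hα => (fst_smooth hα).continuousOn
  have ca := cont sa
  have cb := cont sb
  have cR := cont sR
  have ca1 := cont (deriv_smooth hI sa)
  have cb1 := cont (deriv_smooth hI sb)
  have cR1 := cont (deriv_smooth hI sR)
  have cc1 := cont (deriv_smooth hI sc)
  have ca2 := cont (deriv_smooth hI (deriv_smooth hI sa))
  have cb2 := cont (deriv_smooth hI (deriv_smooth hI sb))
  have cR2 := cont (deriv_smooth hI (deriv_smooth hI sR))
  have cx := (comp_apply_smooth hX.1 i₀).continuousOn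
  have cy := (comp_apply_smooth hX.1 i₁).continuousOn
  set P : ℝ × ℝ → ℝ := fun p => deriv a p.1 * (X p i₀ - a p.1)
    + 1 * deriv b p.1 * (X p i₁ - b p.1) + deriv R p.1 / 2 with hP
  set Q : ℝ × ℝ → ℝ := fun p => deriv (deriv a) p.1 * (X p i₀ - a p.1)
    + 1 * deriv (deriv b) p.1 * (X p i₁ - b p.1) + deriv (deriv R) p.1 / 2
  have cP : ContinuousOn P U :=
    ((ca1.mul (cx.sub ca)).add ((continuousOn_const.mul cb1).mul (cy.sub cb))).add (cR1.div_const 2)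
  have cQ : ContinuousOn Q U :=
    ((ca2.mul (cx.sub ca)).add ((continuousOn_const.mul cb2).mul (cy.sub cb))).add (cR2.div_const 2)
  set W : ℝ × ℝ → ℝ := fun p => 1 * (P p ^ 2 - R p.1 * deriv c p.1 ^ 2)
  set B : ℝ × ℝ → ℝ := fun p => deriv R p.1 ^ 2 / 4 - P p * deriv R p.1
    - R p.1 * (deriv a p.1 ^ 2 + 1 * deriv b p.1 ^ 2) + R p.1 * deriv c p.1 ^ 2 with hB
  set Y : ℝ × ℝ → ℝ := fun p => R p.1 * Q p - deriv R p.1 ^ 2 / 4 with hY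
  set β : ℝ × ℝ → ℝ := fun p => 2 * B p + (1 + m) ^ 2 * W p / m with hβ
  have cW : ContinuousOn W U :=
    continuousOn_const.mul ((cP.pow 2).sub (cR.mul (cc1.pow 2)))
  have cB : ContinuousOn B U :=
    ((((cR1.pow 2).div_const 4).sub (cP.mul cR1)).sub
    (cR.mul ((ca1.pow 2).add (continuousOn_const.mul (cb1.pow 2))))).add (cR.mul (cc1.pow 2))
  have cY : ContinuousOn Y U :=
    (cR.mul cQ).sub ((cR1.pow 2).div_const 4)
  have cβ : ContinuousOn β U :=
    (continuousOn_const.mul cB).add ((continuousOn_const.mul cW).div_const m)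
  have hP0 : ∀ p ∈ U, R p.1 * P p ≠ 0 := by
    intro p hp
    obtain ⟨hpos, -⟩ := h.relation hU hX hN hW hp rfl rfl rfl rfl rfl rfl rfl rfl
    have hr := h.radius p hp
    have hpos' : 0 < 1 * (P p ^ 2 - R p.1 * deriv c p.1 ^ 2) := hpos
    refine mul_ne_zero hr.ne' fun h0 => ?_
    rw [h0] at hpos'
    nlinarith [sq_nonneg (deriv c p.1), mul_nonneg hr.le (sq_nonneg (deriv c p.1))]
  refine ⟨fun p => (|Y p| + (1 + |β p| + |B p ^ 2|)) / |R p.1 * P p|, ?_, fun p hp => ?_⟩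
  · refine ContinuousOn.div ?_ (cR.mul cP).abs (fun p hp => abs_ne_zero.2 (hP0 p hp))
    exact cY.abs.add ((continuousOn_const.add cβ.abs).add (cB.pow 2).abs)
  · obtain ⟨-, τ, hτ, e⟩ := h.relation hU hX hN hW hp rfl rfl (P := P p) rfl (Q := Q p) rfl rfl
      (W := W p) rfl rfl rfl
    set Z := deriv c p.1 * (R p.1 * Q p - deriv R p.1 ^ 2 / 4)
      - R p.1 * P p * deriv (deriv c) p.1 with hZ
    have hquad : Z ^ 2 + deriv c p.1 * β p * Z + deriv c p.1 ^ 2 * B p ^ 2 = 0 := by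
      have e' : (1 + m) ^ 2 * (-1 * deriv c p.1 * Z) * W p - m * (Z + deriv c p.1 * B p) ^ 2 = 0 := by
        simp only [hB]
        linear_combination e
      have : m * (Z ^ 2 + deriv c p.1 * β p * Z + deriv c p.1 ^ 2 * B p ^ 2) = 0 := by
        simp only [hβ]
        field_simp
        linear_combination -e'
      exact (mul_eq_zero.1 this).resolve_left hm
    have hbd := abs_le_of_quadratic hquad
    have hRP : 0 < |R p.1 * P p| := abs_pos.2 (hP0 p hp)
    rw [div_mul_eq_mul_div, le_div_iff₀ hRP, mul_comm, ← abs_mul]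
    calc |R p.1 * P p * deriv (deriv c) p.1| = |deriv c p.1 * Y p - Z| := by
          rw [hZ]; simp only [hY]; congr 1; ring
      _ ≤ |deriv c p.1 * Y p| + |Z| := abs_sub _ _
      _ ≤ _ := by rw [abs_mul]; linarith

/-- Grönwall's inequality to the right of `u`, and to the left by reflection. -/
theorem eq_zero_near {f : ℝ → ℝ} {u K r : ℝ}
    (hf : ∀ s, |s - u| < r → DifferentiableAt ℝ f s)
    (hb : ∀ s, |s - u| < r → |deriv f s| ≤ K * |f s|) (h0 : f u = 0) :
    ∀ s, |s - u| < r → f s = 0 := by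
  have right : ∀ (g : ℝ → ℝ), g 0 = 0 → (∀ s, 0 ≤ s → s < r → DifferentiableAt ℝ g s) →
      (∀ s, 0 ≤ s → s < r → |deriv g s| ≤ K * |g s|) → ∀ s, 0 ≤ s → s < r → g s = 0 := by
    intro g hg0 hd hb s hs hsr
    refine eq_zero_of_abs_deriv_le_mul_abs_self_of_eq_zero_right (f := g) (f' := deriv g) (K := K)
      (a := 0) (b := s) (fun t ht => (hd t ht.1 (ht.2.trans_lt hsr)).continuousAt.continuousWithinAt)
      (fun t ht => (hd t ht.1 (ht.2.trans hsr)).hasDerivAt.hasDerivWithinAt) hg0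
      (fun t ht => hb t ht.1 (ht.2.trans hsr)) s ⟨hs, le_rfl⟩
  intro s hs
  rcases le_total u s with hus | hsu
  · have hm : ∀ t, 0 ≤ t → t < r → |u + t - u| < r := fun t h1 h2 => by
      rw [add_sub_cancel_left, abs_of_nonneg h1]; exact h2
    have := right (fun t => f (u + t)) (by simpa using h0)
      (fun t h1 h2 => (hf _ (hm t h1 h2)).comp t (by fun_prop))
      (fun t h1 h2 => by
        rw [deriv_comp_const_add]; exact hb _ (hm t h1 h2)) (s - u) (by linarith)
      (by rwa [abs_of_nonneg (by linarith)] at hs)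
    simpa using this
  · have hm : ∀ t, 0 ≤ t → t < r → |u - t - u| < r := fun t h1 h2 => by
      rw [sub_sub_cancel_left, abs_neg, abs_of_nonneg h1]; exact h2
    have := right (fun t => f (u - t)) (by simpa using h0)
      (fun t h1 h2 => (hf _ (hm t h1 h2)).comp t (by fun_prop))
      (fun t h1 h2 => by
        rw [deriv_comp_const_sub, abs_neg]; exact hb _ (hm t h1 h2)) (u - s) (by linarith)
      (by rw [abs_of_nonpos (by linarith)] at hs; linarith)
    simpa using this

/-- For `n = 0`, the planes of the leaves are either moving everywhere or nowhere. -/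
theorem plane_dichotomy (h : ConicFoliation 1 i₀ i₁ i₂ X U a b R c) (hU : IsOpen U)
    (hUc : IsConnected U) (hX : IsSpacelikeImmersion X U) (hN : IsGaussMap X N U)
    (hW : IsLinearWeingarten X N U m 0) (hm : m ≠ 0) :
    (∀ p ∈ U, deriv c p.1 ≠ 0) ∨ (∀ p ∈ U, deriv c p.1 = 0) := by
  by_cases hex : ∀ p ∈ U, deriv c p.1 ≠ 0
  · exact Or.inl hex
  right
  push Not at hex
  obtain ⟨p₀, hp₀, hz⟩ := hex
  obtain ⟨-, -, -, sc⟩ := h.smooth hU hX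
  have sc1 := deriv_smooth (isOpen_fst_image hU) sc
  obtain ⟨K, hK, hb⟩ := h.deriv_plane_bound hU hX hN hW hm
  -- `S` is open by the Grönwall argument and relatively closed by continuity, hence all of the
  -- connected set `U`.
  set S := {p | p ∈ U ∧ deriv c p.1 = 0} with hS
  have hSo : IsOpen S := by
    rw [isOpen_iff_mem_nhds]
    rintro p ⟨hp, hpz⟩
    have hKe : ∀ᶠ x in 𝓝 p, K x < K p + 1 :=
      (hK.continuousAt (hU.mem_nhds hp)).eventually_lt continuousAt_const (by linarith)
    have hev : ∀ᶠ s in 𝓝 p.1, (s, p.2) ∈ U ∧ K (s, p.2) < K p + 1 :=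
      (eventually_fst_mem hU hp).and
        ((by fun_prop : Continuous fun s : ℝ => (s, p.2)).continuousAt.eventually hKe)
    obtain ⟨r, hr, hball⟩ := Metric.eventually_nhds_iff.1 hev
    have hzero := eq_zero_near (f := deriv c) (u := p.1) (K := K p + 1)
      (fun s hs => fst_diffAt (q := (s, p.2)) hU sc1 (hball hs).1)
      (fun s hs => (hb _ (hball hs).1).trans
        (mul_le_mul_of_nonneg_right (hball hs).2.le (abs_nonneg _))) hpz
    filter_upwards [hU.mem_nhds hp, continuousAt_fst.eventually (Metric.ball_mem_nhds p.1 hr)]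
      with x hx hx'
    exact ⟨hx, hzero _ hx'⟩
  have hsub : U ⊆ S := by
    refine hUc.isPreconnected.subset_of_closure_inter_subset hSo ⟨p₀, hp₀, hp₀, hz⟩ ?_
    rintro p ⟨hpc, hp⟩
    refine ⟨hp, ?_⟩
    have hct : ContinuousAt (fun x : ℝ × ℝ => deriv c x.1) p :=
      (diffAt_of_smooth hU (fst_smooth sc1) hp).continuousAt
    obtain hfr := mem_closure_iff_frequently.1 hpc
    by_contra hne
    exact hfr ((hct.eventually_ne hne).mono fun x hx hxS => hx hxS.2)
  exact fun p hp => (hsub hp).2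

end ConicFoliation

end Minkowski

/-! ### From stationary centres to rotational invariance. -/

namespace Minkowski

theorem smooth_snd_line {f : ℝ × ℝ → ℝ} {U : Set (ℝ × ℝ)} {q : ℝ × ℝ} (hU : IsOpen U)
    (hf : ContDiffOn ℝ ∞ f U) (hq : q ∈ U) : ContDiffAt ℝ ∞ (fun s => f (q.1, s)) q.2 :=
  ContDiffAt.comp q.2 (hf.contDiffAt (hU.mem_nhds hq))
    (by fun_prop : ContDiff ℝ ∞ fun s : ℝ => (q.1, s)).contDiffAt

/-- A function with nonzero derivative along a leaf takes all values close to a given one. -/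
theorem leaf_local_surjective {f : ℝ → ℝ} {f' v : ℝ} (hf : ContDiffAt ℝ ∞ f v)
    (hd : HasDerivAt f f' v) (hf' : f' ≠ 0) {S : Set ℝ} (hS : S ∈ 𝓝 v) : f '' S ∈ 𝓝 (f v) := by
  have h := (hf.hasStrictDerivAt (by simp)).map_nhds_eq (by rwa [hd.deriv])
  rw [← h]
  exact Filter.image_mem_map hS

/-- The sine component `S` relative to `(ξ₀, η₀)` fixes the cosine component up to sign; the
positivity in `hk` fixes the sign. -/
theorem conic_point {ε ξ₀ η₀ ξ η R C S : ℝ} (h0 : ξ₀ ^ 2 + ε * η₀ ^ 2 = R)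
    (h1 : ξ ^ 2 + ε * η ^ 2 = R) (hR : 0 < R) (hCS : C ^ 2 + ε * S ^ 2 = 1) (hC : 0 < C)
    (hk : 0 < ξ₀ * ξ + ε * (η₀ * η)) (hS : (ξ₀ * η - η₀ * ξ) / R = S) :
    ξ = ξ₀ * C - ε * (η₀ * S) ∧ η = η₀ * C + ξ₀ * S := by
  have hS' : ξ₀ * η - η₀ * ξ = R * S := by rw [← hS]; field_simp
  have hC' : ξ₀ * ξ + ε * (η₀ * η) = R * C := by
    have : (ξ₀ * ξ + ε * (η₀ * η)) ^ 2 = (R * C) ^ 2 := by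
      have e : (ξ₀ * ξ + ε * (η₀ * η)) ^ 2 = (ξ₀ ^ 2 + ε * η₀ ^ 2) * (ξ ^ 2 + ε * η ^ 2)
        - ε * (ξ₀ * η - η₀ * ξ) ^ 2 := by ring
      rw [e, h0, h1, hS']
      linear_combination -R ^ 2 * hCS
    exact (pow_left_inj₀ hk.le (by positivity) two_ne_zero).1 this
  constructor
  · apply mul_left_cancel₀ hR.ne'
    linear_combination ξ₀ * hC' - ε * η₀ * hS' - ξ * h0
  · apply mul_left_cancel₀ hR.ne'
    linear_combination η₀ * hC' + ξ₀ * hS' - η * h0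

theorem isRigidMotion_translation (w : E31) : IsRigidMotion fun x => x + w :=
  ⟨LinearMap.id, w, fun _ _ => rfl, fun _ => rfl⟩

theorem isRotationGroup_translate {R : ℝ → E31 → E31}
    (hR : R = rotTimelike ∨ R = rotSpacelike ∨ R = rotLightlike) (w : E31) :
    IsRotationGroup fun t x => R t (x - w) + w :=
  ⟨fun x => x + w, isRigidMotion_translation w, R, hR, fun t x => by simp⟩

namespace ConicFoliation

variable {ε : ℝ} {i₀ i₁ i₂ : Fin 3} {X N : ℝ × ℝ → E31} {U : Set (ℝ × ℝ)} {a b R c : ℝ → ℝ}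
  {m n : ℝ} {q : ℝ × ℝ}

/-- The sine of the angle (circular or hyperbolic) from the base point is a local coordinate on the
leaf, so every small rotation of the point is attained at a nearby parameter. -/
theorem rotate_leaf (h : ConicFoliation ε i₀ i₁ i₂ X U a b R c) (hU : IsOpen U)
    (hX : IsSpacelikeImmersion X U) {C S : ℝ → ℝ} (hC : ContinuousAt C 0) (hS : ContinuousAt S 0)
    (hC0 : C 0 = 1) (hS0 : S 0 = 0) (hCS : ∀ t, C t ^ 2 + ε * S t ^ 2 = 1) (hq : q ∈ U)
    {V : Set (ℝ × ℝ)} (hV : V ∈ 𝓝 q) :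
    ∀ᶠ t in 𝓝 (0 : ℝ), ∃ p ∈ V ∩ U, X p i₂ = X q i₂ ∧
      X p i₀ = a q.1 + ((X q i₀ - a q.1) * C t - ε * ((X q i₁ - b q.1) * S t)) ∧
      X p i₁ = b q.1 + ((X q i₁ - b q.1) * C t + (X q i₀ - a q.1) * S t) := by
  have hr := h.radius q hq
  have hcon := h.conic q hq
  set ξ₀ := X q i₀ - a q.1 with hξ₀
  set η₀ := X q i₁ - b q.1 with hη₀
  set r := R q.1
  set f : ℝ → ℝ := fun v => (ξ₀ * (X (q.1, v) i₁ - b q.1) - η₀ * (X (q.1, v) i₀ - a q.1)) / r with hf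
  have sx := comp_apply_smooth hX.1 i₀
  have sy := comp_apply_smooth hX.1 i₁
  have dx := hasDerivAt_snd hU sx hq
  have dy := hasDerivAt_snd hU sy hq
  have hfs : ContDiffAt ℝ ∞ f q.2 :=
    ((contDiffAt_const.mul ((smooth_snd_line hU sy hq).sub contDiffAt_const)).sub
      (contDiffAt_const.mul ((smooth_snd_line hU sx hq).sub contDiffAt_const))).div_const r
  have hfd := (((dy.sub_const (b q.1)).const_mul ξ₀).sub
    ((dx.sub_const (a q.1)).const_mul η₀)).div_const r
  have hf0 : f q.2 = 0 := by simp only [hf, hξ₀, hη₀]; ring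
  obtain ⟨h1, -⟩ := conic_leaf_derivatives (u := q.1) (v := q.2) (a := a q.1) (b := b q.1)
      (R := R q.1) hU sx sy (fun v hv => h.conic _ hv) hq
  have h1' : ξ₀ * pd (0, 1) (fun p => X p i₀) q + ε * (η₀ * pd (0, 1) (fun p => X p i₁) q) = 0 := h1
  have hpos := h.leaf_pos hU hX hq
  rw [← pd_apply _ (diffAt_of_smooth hU hX.1 hq), ← pd_apply _ (diffAt_of_smooth hU hX.1 hq)] at hpos
  set xv := pd (0, 1) (fun p => X p i₀) q
  set yv := pd (0, 1) (fun p => X p i₁) q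
  have hf' : (ξ₀ * yv - η₀ * xv) / r ≠ 0 := by
    refine div_ne_zero (fun h0 => ?_) hr.ne'
    have e1 : r * xv = 0 := by linear_combination ξ₀ * h1' - ε * η₀ * h0 - xv * hcon
    have e2 : r * yv = 0 := by linear_combination η₀ * h1' + ξ₀ * h0 - yv * hcon
    have e1' := (mul_eq_zero.1 e1).resolve_left hr.ne'
    have e2' := (mul_eq_zero.1 e2).resolve_left hr.ne'
    rw [e1', e2'] at hpos
    simp at hpos
  have hmemV : ∀ᶠ v in 𝓝 q.2, (q.1, v) ∈ V ∩ U :=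
    (by fun_prop : Continuous fun s : ℝ => (q.1, s)).continuousAt.eventually_mem
      (Filter.inter_mem hV (hU.mem_nhds hq))
  have hk : ∀ᶠ v in 𝓝 q.2,
      0 < ξ₀ * (X (q.1, v) i₀ - a q.1) + ε * (η₀ * (X (q.1, v) i₁ - b q.1)) := by
    have hct : ContinuousAt (fun v => ξ₀ * (X (q.1, v) i₀ - a q.1)
        + ε * (η₀ * (X (q.1, v) i₁ - b q.1))) q.2 :=
      (continuousAt_const.mul (dx.continuousAt.sub continuousAt_const)).add
        (continuousAt_const.mul (continuousAt_const.mul (dy.continuousAt.sub continuousAt_const)))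
    refine hct.eventually_const_lt ?_
    calc 0 < r := hr
      _ = _ := by rw [← hcon]; ring
  have him := leaf_local_surjective hfs hfd hf' (hmemV.and hk)
  rw [show f q.2 = S 0 from hf0.trans hS0.symm] at him
  filter_upwards [hS him, hC.eventually_const_lt (show (0 : ℝ) < C 0 by rw [hC0]; exact one_pos)]
    with t ht hCt
  obtain ⟨v, ⟨hv, hkv⟩, hfv⟩ := ht
  obtain ⟨e1, e2⟩ := conic_point hcon (h.conic (q.1, v) hv.2) hr (hCS t) hCt hkv hfv
  refine ⟨(q.1, v), hv, ?_, by linear_combination e1, by linear_combination e2⟩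
  rw [h.plane _ hv.2, h.plane _ hq]

/-- A surface with fixed centres is a surface of revolution: circles. -/
theorem revolution_of_circles (h : ConicFoliation 1 0 1 2 X U a b R c) (hU : IsOpen U)
    (hUc : IsConnected U) (hX : IsSpacelikeImmersion X U)
    (hs : ∀ p ∈ U, deriv a p.1 = 0 ∧ deriv b p.1 = 0) : IsSurfaceOfRevolution X U := by
  obtain ⟨sa, sb, -, -⟩ := h.smooth hU hX
  obtain ⟨A, hA⟩ := const_of_deriv_eq_zero hU hUc sa fun p hp => (hs p hp).1
  obtain ⟨B, hB⟩ := const_of_deriv_eq_zero hU hUc sb fun p hp => (hs p hp).2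
  refine ⟨_, isRotationGroup_translate (Or.inl rfl) ![A, B, 0], fun q hq V hV => ?_⟩
  -- The minus sign matches the clockwise convention of `rotTimelike`.
  filter_upwards [h.rotate_leaf hU hX (C := Real.cos) (S := fun t => -Real.sin t)
    Real.continuous_cos.continuousAt Real.continuous_sin.neg.continuousAt Real.cos_zero (by simp)
    (fun t => by rw [one_mul, neg_sq]; exact Real.cos_sq_add_sin_sq t) hq hV] with t ht
  obtain ⟨p, hp, e2, e0, e1⟩ := ht
  refine ⟨p, hp, ?_⟩
  rw [hA q hq] at e0 e1
  rw [hB q hq] at e0 e1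
  ext i
  fin_cases i
  · simp [rotTimelike, e0]; ring
  · simp [rotTimelike, e1]; ring
  · simp [rotTimelike, e2]

/-- A surface with fixed centres is a surface of revolution: hyperbolas. -/
theorem revolution_of_hyperbolas (h : ConicFoliation (-1) 2 1 0 X U a b R c) (hU : IsOpen U)
    (hUc : IsConnected U) (hX : IsSpacelikeImmersion X U)
    (hs : ∀ p ∈ U, deriv a p.1 = 0 ∧ deriv b p.1 = 0) : IsSurfaceOfRevolution X U := by
  obtain ⟨sa, sb, -, -⟩ := h.smooth hU hX
  obtain ⟨A, hA⟩ := const_of_deriv_eq_zero hU hUc sa fun p hp => (hs p hp).1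
  obtain ⟨B, hB⟩ := const_of_deriv_eq_zero hU hUc sb fun p hp => (hs p hp).2
  refine ⟨_, isRotationGroup_translate (Or.inr (Or.inl rfl)) ![0, B, A], fun q hq V hV => ?_⟩
  filter_upwards [h.rotate_leaf hU hX (C := Real.cosh) (S := Real.sinh)
    Real.continuous_cosh.continuousAt Real.continuous_sinh.continuousAt Real.cosh_zero
    Real.sinh_zero (fun t => by linear_combination Real.cosh_sq t) hq hV] with t ht
  obtain ⟨p, hp, e2, e0, e1⟩ := ht
  refine ⟨p, hp, ?_⟩
  rw [hA q hq] at e0 e1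
  rw [hB q hq] at e0 e1
  ext i
  fin_cases i
  · simp [rotSpacelike, e2]
  · simp [rotSpacelike, e1]; ring
  · simp [rotSpacelike, e0]; ring

/-- A surface contained in a horizontal plane is a surface of revolution. -/
theorem revolution_of_planar (hU : IsOpen U) (hX : IsSpacelikeImmersion X U) {k : ℝ}
    (hk : ∀ p ∈ U, X p 2 = k) : IsSurfaceOfRevolution X U := by
  refine ⟨_, isRotationGroup_translate (Or.inl rfl) 0, fun q hq V hV => ?_⟩
  have s0 := comp_apply_smooth hX.1 0
  have s1 := comp_apply_smooth hX.1 1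
  -- By the inverse function theorem the surface covers a neighbourhood of each of its points in the
  -- plane. Any vertical axis would do; the one through the origin is used.
  set F : ℝ × ℝ → ℝ × ℝ := fun p => (X p 0, X p 1) with hF
  have hFs : ContDiffAt ℝ ∞ F q :=
    (s0.contDiffAt (hU.mem_nhds hq)).prodMk (s1.contDiffAt (hU.mem_nhds hq))
  have hstrict := hFs.hasStrictFDerivAt (by simp)
  have hFd : ∀ w, fderiv ℝ F q w = (pd w X q 0, pd w X q 1) := by
    intro w
    have d := ((diffAt_of_smooth hU s0 hq).hasFDerivAt).prodMk
      ((diffAt_of_smooth hU s1 hq).hasFDerivAt)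
    rw [d.fderiv, ← pd_apply w (diffAt_of_smooth hU hX.1 hq),
      ← pd_apply w (diffAt_of_smooth hU hX.1 hq)]
    rfl
  have hinj : Function.Injective (fderiv ℝ F q) := by
    rw [injective_iff_map_eq_zero]
    intro w hw
    by_contra hne
    have hp := hX.2 q hq w hne
    rw [hFd w, Prod.mk_eq_zero] at hw
    have h2 : pd w X q 2 = 0 := by
      rw [← pd_apply w (diffAt_of_smooth hU hX.1 hq), pd_congr (g := fun _ => k) hU hk hq]
      simp [pd]
    have : lor (pd w X q) (pd w X q) = 0 := by simp [lor, hw.1, hw.2, h2]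
    exact hp.ne' this
  have hsurj : (fderiv ℝ F q).range = ⊤ :=
    LinearMap.range_eq_top.2 (LinearMap.injective_iff_surjective.1 hinj)
  have hmap := hstrict.map_nhds_eq_of_surj hsurj
  have hnhds : F '' (V ∩ U) ∈ 𝓝 (F q) := by
    rw [← hmap]
    exact Filter.image_mem_map (Filter.inter_mem hV (hU.mem_nhds hq))
  have hct : ContinuousAt (fun t : ℝ => (Real.cos t * X q 0 + Real.sin t * X q 1,
      -Real.sin t * X q 0 + Real.cos t * X q 1)) 0 := by fun_prop
  have h0 : (Real.cos 0 * X q 0 + Real.sin 0 * X q 1,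
      -Real.sin 0 * X q 0 + Real.cos 0 * X q 1) = F q := by simp [hF]
  filter_upwards [hct (by simpa only [h0] using hnhds)] with t ht
  obtain ⟨p, hp, hpe⟩ := ht
  refine ⟨p, hp, ?_⟩
  have e0 := congrArg Prod.fst hpe
  have e1 := congrArg Prod.snd hpe
  simp only [hF] at e0 e1
  ext i
  fin_cases i
  · simp [rotTimelike, e0]
  · simp [rotTimelike, e1]
  · simp [rotTimelike, hk p hp.2, hk q hq]

theorem revolution_timelike (h : ConicFoliation 1 0 1 2 X U a b R c) (hU : IsOpen U)
    (hUc : IsConnected U) (hX : IsSpacelikeImmersion X U) (hN : IsGaussMap X N U)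
    (hW : IsLinearWeingarten X N U m n) (hm : m ≠ 0) (hmn : ¬(m = -1 ∧ n = 0)) :
    IsSurfaceOfRevolution X U := by
  by_cases hn : n = 0
  · subst hn
    have hm1 : m ≠ -1 := fun h => hmn ⟨h, rfl⟩
    rcases h.plane_dichotomy hU hUc hX hN hW hm with hc | hc
    · exact h.revolution_of_circles hU hUc hX fun p hp =>
        h.center_stationary_of_eq_zero hU hX hN hW hm hm1 hp (hc p hp)
    · obtain ⟨k, hk⟩ := const_of_deriv_eq_zero hU hUc (h.smooth hU hX).2.2.2 hc
      exact revolution_of_planar hU hX fun p hp => (h.plane p hp).trans (hk p hp)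
  · exact h.revolution_of_circles hU hUc hX fun p hp =>
      h.center_stationary_of_ne_zero hU hX hN hW hn hp

theorem revolution_spacelike (h : ConicFoliation (-1) 2 1 0 X U a b R c) (hU : IsOpen U)
    (hUc : IsConnected U) (hX : IsSpacelikeImmersion X U) (hN : IsGaussMap X N U)
    (hW : IsLinearWeingarten X N U m n) (hm : m ≠ 0) (hmn : ¬(m = -1 ∧ n = 0)) :
    IsSurfaceOfRevolution X U := by
  by_cases hn : n = 0
  · subst hn
    have hm1 : m ≠ -1 := fun h => hmn ⟨h, rfl⟩
    refine h.revolution_of_hyperbolas hU hUc hX fun p hp =>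
        -- For `ε = -1`, `c' = 0` would give `W = -P² ≤ 0`.
        h.center_stationary_of_eq_zero hU hX hN hW hm hm1 hp fun hc => ?_
    obtain ⟨hpos, -⟩ := h.relation hU hX hN hW hp rfl rfl rfl rfl rfl rfl rfl rfl
    rw [hc] at hpos
    nlinarith [sq_nonneg (deriv a p.1 * (X p 2 - a p.1) + -1 * deriv b p.1 * (X p 1 - b p.1)
      + deriv R p.1 / 2)]
  · exact h.revolution_of_hyperbolas hU hUc hX fun p hp =>
      h.center_stationary_of_ne_zero hU hX hN hW hn hp

end ConicFoliation

end Minkowski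

/-! ### Algebra of a moving parabola. -/

namespace Minkowski

section ParabolaAlgebra

theorem negative_quadratic {L M Q : ℝ} (h : ∀ x : ℝ, L * x ^ 2 + M * x + Q < 0) :
    L ≤ 0 ∧ (L = 0 → M = 0) ∧ (L < 0 → 0 < 4 * L * Q - M ^ 2) := by
  refine ⟨?_, ?_, ?_⟩
  · by_contra! hL
    have h1 := h √(|Q| / L)
    have h2 := h (-√(|Q| / L))
    have h3 : √(|Q| / L) ^ 2 = |Q| / L := Real.sq_sqrt (by positivity)
    rw [neg_sq] at h2
    rw [h3, mul_div_cancel₀ _ hL.ne'] at h1 h2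
    linarith [neg_abs_le Q]
  · rintro rfl
    by_contra hM
    have := h (-Q / M)
    rw [mul_div_cancel₀ _ hM] at this
    linarith
  · intro hL
    have h1 := h (-M / (2 * L))
    have h2 : L * (-M / (2 * L)) ^ 2 + M * (-M / (2 * L)) + Q = (4 * L * Q - M ^ 2) / (4 * L) := by
      have := hL.ne
      field_simp; ring
    rw [h2] at h1
    by_contra! h3
    exact absurd (div_nonneg_of_nonpos h3 (by linarith)) (not_le.2 h1)

theorem quartic_coeffs {c₄ c₃ c₂ c₁ c₀ : ℝ}
    (h : ∀ x : ℝ, c₄ * x ^ 4 + c₃ * x ^ 3 + c₂ * x ^ 2 + c₁ * x + c₀ = 0) :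
    c₄ = 0 ∧ c₃ = 0 ∧ c₂ = 0 ∧ c₁ = 0 ∧ c₀ = 0 := by
  have h0 := h 0
  have h1 := h 1
  have h2 := h (-1)
  have h3 := h 2
  have h4 := h (-2)
  norm_num at h0 h1 h2 h3 h4
  refine ⟨?_, ?_, ?_, ?_, h0⟩ <;> linarith

/-- If a square of a quadratic polynomial is divisible by a definite quadratic polynomial, then the
two polynomials are proportional, and so is the cofactor. -/
theorem quadratic_square_divisible {L M Q k₂ k₁ k₀ t₂ t₁ t₀ m : ℝ} (hm : m ≠ 0) (hL : L ≠ 0)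
    (hΔ : 4 * L * Q - M ^ 2 ≠ 0)
    (h : ∀ x : ℝ, (L * x ^ 2 + M * x + Q) * (k₂ * x ^ 2 + k₁ * x + k₀)
      = m * (t₂ * x ^ 2 + t₁ * x + t₀) ^ 2) :
    ∃ κ l, t₂ = κ * L ∧ t₀ = κ * Q ∧ k₂ = l * L ∧ k₀ = l * Q := by
  -- Division with remainder: `t = κ D + (βx + γ)`, where `D` is the quadratic with coefficients
  -- `L`, `M`, `Q`. What remains is `D j = m (βx + γ)²`. By degree `j` is constant, and as a square
  -- has zero discriminant, `j = 0`.
  obtain ⟨κ, hκ⟩ : ∃ κ, κ = t₂ / L := ⟨_, rfl⟩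
  have ht₂ : t₂ = κ * L := by rw [hκ]; field_simp
  obtain ⟨β, hβ⟩ : ∃ β, β = t₁ - κ * M := ⟨_, rfl⟩
  obtain ⟨γ, hγ⟩ : ∃ γ, γ = t₀ - κ * Q := ⟨_, rfl⟩
  obtain ⟨j₂, hj₂⟩ : ∃ j, j = k₂ - m * κ ^ 2 * L := ⟨_, rfl⟩
  obtain ⟨j₁, hj₁⟩ : ∃ j, j = k₁ - m * κ ^ 2 * M - 2 * m * κ * β := ⟨_, rfl⟩
  obtain ⟨j₀, hj₀⟩ : ∃ j, j = k₀ - m * κ ^ 2 * Q - 2 * m * κ * γ := ⟨_, rfl⟩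
  obtain ⟨e4, e3, e2, e1, e0⟩ := quartic_coeffs (c₄ := L * j₂) (c₃ := L * j₁ + M * j₂)
    (c₂ := L * j₀ + M * j₁ + Q * j₂ - m * β ^ 2) (c₁ := M * j₀ + Q * j₁ - 2 * m * β * γ)
    (c₀ := Q * j₀ - m * γ ^ 2) (fun x => by
      rw [hj₂, hj₁, hj₀, hβ, hγ]
      have := h x
      rw [ht₂] at this
      linear_combination this)
  have z2 : j₂ = 0 := (mul_eq_zero.1 e4).resolve_left hL
  have z1 : j₁ = 0 := by
    rw [z2, mul_zero, add_zero] at e3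
    exact (mul_eq_zero.1 e3).resolve_left hL
  simp only [z1, z2] at e2 e1
  have z0 : j₀ = 0 := by
    have : (4 * L * Q - M ^ 2) * j₀ ^ 2 = 0 := by
      linear_combination 4 * Q * j₀ * e2 - (M * j₀ + 2 * m * β * γ) * e1 + 4 * m * β ^ 2 * e0
    simpa [hΔ] using this
  rw [z0] at e2 e0
  have b0 : β = 0 := by
    have : m * β ^ 2 = 0 := by linear_combination -e2
    simpa [hm] using this
  have g0 : γ = 0 := by
    have : m * γ ^ 2 = 0 := by linear_combination -e0
    simpa [hm] using this
  refine ⟨κ, m * κ ^ 2, ht₂, by linear_combination g0 - hγ, by linear_combination z2 - hj₂, ?_⟩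
  rw [g0] at hj₀
  linear_combination z0 - hj₀

/-- The linear Weingarten relation along a whole parabola forces the parabola to move by a
rotation with lightlike axis (to first order). -/
theorem parabola_rigidity {f g F₁ G₁ H₁ F₂ G₂ H₂ m n : ℝ} (hm : m ≠ 0) (hmn : ¬(m = -1 ∧ n = 0))
    (h : ∀ x D K T : ℝ, D = -(F₁ * x ^ 2 + G₁ * x + H₁ + (2 * f * x + g) ^ 2 / 4) →
      K = 2 * f * (F₂ * x ^ 2 + G₂ * x + H₂) - (2 * F₁ * x + G₁) ^ 2 →
      T = F₂ * x ^ 2 + G₂ * x + H₂ + (2 * F₁ * x + G₁) * (2 * f * x + g)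
        - 2 * f * (F₁ * x ^ 2 + G₁ * x + H₁) →
      0 < D ∧ ∃ τ, τ ^ 2 = 4 * D ^ 3 ∧
        (1 + m) ^ 2 * K * D - m * T ^ 2 + 4 * n ^ 2 * D ^ 3 = n * (1 - m) * τ * T) :
    F₁ = -f ^ 2 ∧ G₁ = -(f * g) := by
  -- `D = -(Lx² + Mx + Q)`, and the claim is `L = M = 0`. Positivity of `D` for all real `x` leaves
  -- only `L < 0` with nonzero discriminant to be excluded.
  obtain ⟨L, hL⟩ : ∃ L, L = F₁ + f ^ 2 := ⟨_, rfl⟩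
  obtain ⟨M, hM⟩ : ∃ M, M = G₁ + f * g := ⟨_, rfl⟩
  obtain ⟨Q, hQ⟩ : ∃ Q, Q = H₁ + g ^ 2 / 4 := ⟨_, rfl⟩
  obtain ⟨hL0, hM0, hΔ⟩ := negative_quadratic (L := L) (M := M) (Q := Q) (fun x => by
    have := (h x _ _ _ rfl rfl rfl).1
    rw [hL, hM, hQ]
    linarith)
  rcases hL0.eq_or_lt with hz | hneg
  · have := hM0 hz
    exact ⟨by linarith, by linarith⟩
  exfalso
  specialize hΔ hneg
  obtain ⟨k₂, hk₂⟩ : ∃ k, k = 2 * f * F₂ - 4 * F₁ ^ 2 := ⟨_, rfl⟩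
  obtain ⟨k₁, hk₁⟩ : ∃ k, k = 2 * f * G₂ - 4 * F₁ * G₁ := ⟨_, rfl⟩
  obtain ⟨k₀, hk₀⟩ : ∃ k, k = 2 * f * H₂ - G₁ ^ 2 := ⟨_, rfl⟩
  obtain ⟨t₂, ht₂⟩ : ∃ k, k = F₂ + 2 * f * F₁ := ⟨_, rfl⟩
  obtain ⟨t₁, ht₁⟩ : ∃ k, k = G₂ + 2 * F₁ * g := ⟨_, rfl⟩
  obtain ⟨t₀, ht₀⟩ : ∃ k, k = H₂ + G₁ * g - 2 * f * H₁ := ⟨_, rfl⟩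
  have h' : ∀ x D K T : ℝ, D = -(L * x ^ 2 + M * x + Q) → K = k₂ * x ^ 2 + k₁ * x + k₀ →
      T = t₂ * x ^ 2 + t₁ * x + t₀ → ∃ τ, τ ^ 2 = 4 * D ^ 3 ∧
        (1 + m) ^ 2 * K * D - m * T ^ 2 + 4 * n ^ 2 * D ^ 3 = n * (1 - m) * τ * T := by
    intro x D K T hD hK hT
    exact (h x D K T (by rw [hD, hL, hM, hQ]; ring) (by rw [hK, hk₂, hk₁, hk₀]; ring)
      (by rw [hT, ht₂, ht₁, ht₀]; ring)).2
  by_cases hn : n = 0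
  · have hm1 : 1 + m ≠ 0 := fun h => hmn ⟨by linarith, hn⟩
    obtain ⟨κ, l, e1, e2, e3, e4⟩ := quadratic_square_divisible (L := L) (M := M) (Q := Q)
      (k₂ := k₂) (k₁ := k₁) (k₀ := k₀) (t₂ := t₂) (t₁ := t₁) (t₀ := t₀)
      (m := -m / (1 + m) ^ 2) (div_ne_zero (neg_ne_zero.2 hm) (pow_ne_zero 2 hm1)) hneg.ne hΔ.ne'
      (fun x => by
        obtain ⟨τ, -, e⟩ := h' x _ _ _ rfl rfl rfl
        rw [hn] at e
        field_simp
        linear_combination -e)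
    -- Proportionality of `K` and `D` gives `k₀ L = k₂ Q`. Inserting `F₂` and `H₂` from the
    -- proportionality of `T` cancels `κ` and leaves this product.
    have : L * (4 * L * Q - M ^ 2) = 0 := by
      have e5 : k₀ * L - k₂ * Q = 0 := by rw [e3, e4]; ring
      rw [hk₀, hk₂] at e5
      have e6 : H₂ = κ * Q - G₁ * g + 2 * f * H₁ := by linear_combination e2 - ht₀
      have e7 : F₂ = κ * L - 2 * f * F₁ := by linear_combination e1 - ht₂
      rw [← e5, e6, e7, hM, hQ, hL]
      ring
    exact mul_ne_zero hneg.ne hΔ.ne' this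
  -- The squared relation at `x = 1/y`, multiplied by `y¹²`. Its value at `0`, obtained by
  -- continuity, is `16 n⁴ L⁶ ≠ 0`.
  · set Φ : ℝ → ℝ := fun y =>
      ((1 + m) ^ 2 * (k₂ + k₁ * y + k₀ * y ^ 2) * (-(L + M * y + Q * y ^ 2)) * y ^ 2
        - m * (t₂ + t₁ * y + t₀ * y ^ 2) ^ 2 * y ^ 2
        + 4 * n ^ 2 * (-(L + M * y + Q * y ^ 2)) ^ 3) ^ 2
      - n ^ 2 * (1 - m) ^ 2 * (4 * (-(L + M * y + Q * y ^ 2)) ^ 3)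
        * (t₂ + t₁ * y + t₀ * y ^ 2) ^ 2 * y ^ 2 with hΦ
    have hzero : ∀ y, y ≠ 0 → Φ y = 0 := by
      intro y hy
      obtain ⟨τ, hτ, e⟩ := h' y⁻¹ _ _ _ rfl rfl rfl
      have a1 : L + M * y + Q * y ^ 2 = y ^ 2 * (L * y⁻¹ ^ 2 + M * y⁻¹ + Q) := by
        field_simp
      have a2 : k₂ + k₁ * y + k₀ * y ^ 2 = y ^ 2 * (k₂ * y⁻¹ ^ 2 + k₁ * y⁻¹ + k₀) := by
        field_simp
      have a3 : t₂ + t₁ * y + t₀ * y ^ 2 = y ^ 2 * (t₂ * y⁻¹ ^ 2 + t₁ * y⁻¹ + t₀) := by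
        field_simp
      simp only [hΦ, a1, a2, a3]
      generalize L * y⁻¹ ^ 2 + M * y⁻¹ + Q = d at *
      generalize k₂ * y⁻¹ ^ 2 + k₁ * y⁻¹ + k₀ = k at *
      generalize t₂ * y⁻¹ ^ 2 + t₁ * y⁻¹ + t₀ = t at *
      linear_combination y ^ 12 * ((1 + m) ^ 2 * k * (-d) - m * t ^ 2 + 4 * n ^ 2 * (-d) ^ 3
        + n * (1 - m) * τ * t) * e + y ^ 12 * n ^ 2 * (1 - m) ^ 2 * t ^ 2 * hτ
    have hcont : Continuous Φ := by fun_prop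
    have hlim : Filter.Tendsto Φ (𝓝[≠] 0) (𝓝 (Φ 0)) := hcont.continuousAt.tendsto.mono_left
      nhdsWithin_le_nhds
    have h0 : Φ 0 = 0 := by
      refine tendsto_nhds_unique hlim (tendsto_const_nhds.congr' ?_)
      filter_upwards [self_mem_nhdsWithin] with y hy
      exact (hzero y hy).symm
    simp [hΦ, hn, hneg.ne] at h0

/-- Pointwise identities for the fundamental forms of a surface foliated by parabolas. -/
theorem parabola_forms {f τ ψ φ₁ φ₂ c₁ c₂ xu xv tu tv xuu xuv xvv tuu tuv tvv : ℝ}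
    (htu : tu = φ₁ + τ * xu) (htv : tv = τ * xv)
    (htuu : tuu = φ₂ + ψ * xu + (ψ + 2 * f * xu) * xu + τ * xuu)
    (htuv : tuv = (ψ + 2 * f * xu) * xv + τ * xuv) (htvv : tvv = 2 * f * xv ^ 2 + τ * xvv) :
    (xu ^ 2 - c₁ * tu) * xv ^ 2 - (xu * xv - c₁ * tv / 2) ^ 2
      = xv ^ 2 * -(c₁ * φ₁ + c₁ ^ 2 * τ ^ 2 / 4) ∧
    (c₁ * (tuu - τ * xuu) - φ₁ * c₂) * xv ^ 2
      - 2 * (c₁ * (tuv - τ * xuv)) * (xu * xv - c₁ * tv / 2)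
      + (c₁ * (tvv - τ * xvv)) * (xu ^ 2 - c₁ * tu)
      = xv ^ 2 * (c₁ * φ₂ - φ₁ * c₂ + c₁ ^ 2 * ψ * τ - 2 * c₁ ^ 2 * f * φ₁) ∧
    (c₁ * (tuu - τ * xuu) - φ₁ * c₂) * (c₁ * (tvv - τ * xvv)) - (c₁ * (tuv - τ * xuv)) ^ 2
      = xv ^ 2 * (2 * c₁ * f * (c₁ * φ₂ - φ₁ * c₂) - c₁ ^ 2 * ψ ^ 2) := by
  subst htu htv htuu htuv htvv
  exact ⟨by ring, by ring, by ring⟩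

end ParabolaAlgebra

end Minkowski

/-! ### Surfaces foliated by parabolas. -/

namespace Minkowski

/-- The surface `X` is foliated by the whole parabolas `x₂ + x₁ = f x₀² + g x₀ + h` in the
lightlike planes `x₂ - x₁ = c`. -/
structure ParabolaFoliation (X : ℝ × ℝ → E31) (U : Set (ℝ × ℝ)) (f g h c : ℝ → ℝ) : Prop where
  parabola : ∀ p ∈ U, X p 2 + X p 1 = f p.1 * X p 0 ^ 2 + g p.1 * X p 0 + h p.1
  plane : ∀ p ∈ U, X p 2 - X p 1 = c p.1
  ne_zero : ∀ p ∈ U, f p.1 ≠ 0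
  whole : ∀ p ∈ U, ∀ x : ℝ, ∃ v, (p.1, v) ∈ U ∧ X (p.1, v) 0 = x

theorem lor_null (V W : E31) :
    lor V W = V 0 * W 0 - ((V 2 - V 1) * (W 2 + W 1) + (V 2 + V 1) * (W 2 - W 1)) / 2 := by
  simp only [lor]; ring

theorem pd_quadratic {U : Set (ℝ × ℝ)} {q : ℝ × ℝ} {f g h : ℝ → ℝ} {x : ℝ × ℝ → ℝ} (hU : IsOpen U)
    (hf : ContDiffOn ℝ ∞ f (Prod.fst '' U)) (hg : ContDiffOn ℝ ∞ g (Prod.fst '' U))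
    (hh : ContDiffOn ℝ ∞ h (Prod.fst '' U)) (hx : ContDiffOn ℝ ∞ x U) (hq : q ∈ U) (w : ℝ × ℝ) :
    pd w (fun p => f p.1 * x p ^ 2 + g p.1 * x p + h p.1) q =
      w.1 * (deriv f q.1 * x q ^ 2 + deriv g q.1 * x q + deriv h q.1)
        + (2 * f q.1 * x q + g q.1) * pd w x q := by
  have df := diffAt_of_smooth hU (fst_smooth hf) hq
  have dg := diffAt_of_smooth hU (fst_smooth hg) hq
  have dh := diffAt_of_smooth hU (fst_smooth hh) hq
  have dx := diffAt_of_smooth hU hx hq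
  have e : (fun p : ℝ × ℝ => f p.1 * x p ^ 2 + g p.1 * x p + h p.1)
      = fun p => (f p.1 * (x p * x p) + g p.1 * x p) + h p.1 := by
    funext p; ring
  rw [e, pd_add (f := fun p : ℝ × ℝ => f p.1 * (x p * x p) + g p.1 * x p) w
      ((df.mul (dx.mul dx)).add (dg.mul dx)) dh,
    pd_add (f := fun p : ℝ × ℝ => f p.1 * (x p * x p)) (g := fun p => g p.1 * x p) w
      (df.mul (dx.mul dx)) (dg.mul dx),
    pd_mul (g := fun p => x p * x p) w df (dx.mul dx), pd_mul w dx dx, pd_mul w dg dx,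
    pd_fst hU hf hq, pd_fst hU hg hq, pd_fst hU hh hq]
  ring

namespace ParabolaFoliation

variable {X N : ℝ × ℝ → E31} {U : Set (ℝ × ℝ)} {f g h c : ℝ → ℝ} {m n : ℝ} {q : ℝ × ℝ}

theorem leaf_pos (H : ParabolaFoliation X U f g h c) (hU : IsOpen U)
    (hX : IsSpacelikeImmersion X U) (hq : q ∈ U) : pd (0, 1) X q 0 ≠ 0 := by
  have hG := (metric_pos hX hq).2
  have hz : pd (0, 1) X q 2 - pd (0, 1) X q 1 = 0 := by
    rw [← pd_apply _ (diffAt_of_smooth hU hX.1 hq), ← pd_apply _ (diffAt_of_smooth hU hX.1 hq)]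
    have d := (hasDerivAt_snd hU (comp_apply_smooth hX.1 2) hq).sub
      (hasDerivAt_snd hU (comp_apply_smooth hX.1 1) hq)
    have e : (fun s => X (q.1, s) 2 - X (q.1, s) 1) =ᶠ[𝓝 q.2] fun _ => c q.1 := by
      filter_upwards [eventually_snd_mem hU hq] with s hs using H.plane _ hs
    exact d.unique ((hasDerivAt_const _ _).congr_of_eventuallyEq e)
  rw [lor_null, hz] at hG
  intro h0
  rw [h0] at hG
  simp at hG

theorem smooth (H : ParabolaFoliation X U f g h c) (hU : IsOpen U)
    (hX : IsSpacelikeImmersion X U) :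
    ContDiffOn ℝ ∞ f (Prod.fst '' U) ∧ ContDiffOn ℝ ∞ g (Prod.fst '' U) ∧
      ContDiffOn ℝ ∞ h (Prod.fst '' U) ∧ ContDiffOn ℝ ∞ c (Prod.fst '' U) := by
  have sx : ContDiffOn ℝ ∞ (fun p => X p 0) U := comp_apply_smooth hX.1 0
  have s1 := comp_apply_smooth hX.1 1
  have s2 := comp_apply_smooth hX.1 2
  set x : ℝ × ℝ → ℝ := fun p => X p 0 with hx
  set t : ℝ × ℝ → ℝ := fun p => X p 2 + X p 1 with ht
  have st : ContDiffOn ℝ ∞ t U := s2.add s1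
  have sxv := pd_smooth hU sx (0, 1)
  have stv := pd_smooth hU st (0, 1)
  have sxvv := pd_smooth hU sxv (0, 1)
  have stvv := pd_smooth hU stv (0, 1)
  have hxv : ∀ p ∈ U, pd (0, 1) x p ≠ 0 := fun p hp => by
    rw [hx, pd_apply _ (diffAt_of_smooth hU hX.1 hp)]
    exact H.leaf_pos hU hX hp
  have first : ∀ p ∈ U, pd (0, 1) t p = (2 * f p.1 * x p + g p.1) * pd (0, 1) x p := by
    intro p hp
    have dx := hasDerivAt_snd hU sx hp
    have d := (((dx.pow 2).const_mul (f p.1)).add (dx.const_mul (g p.1))).add_const (h p.1)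
    have e : (fun s => t (p.1, s)) =ᶠ[𝓝 p.2]
        fun s => f p.1 * x (p.1, s) ^ 2 + g p.1 * x (p.1, s) + h p.1 := by
      filter_upwards [eventually_snd_mem hU hp] with s hs using H.parabola _ hs
    have := (hasDerivAt_snd hU st hp).unique (d.congr_of_eventuallyEq e)
    rw [this]
    simp
    ring
  have second : ∀ p ∈ U, pd (0, 1) (pd (0, 1) t) p =
      2 * f p.1 * pd (0, 1) x p ^ 2 + (2 * f p.1 * x p + g p.1) * pd (0, 1) (pd (0, 1) x) p := by
    intro p hp
    have d := (((hasDerivAt_snd hU sx hp).const_mul (2 * f p.1)).add_const (g p.1)).mul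
      (hasDerivAt_snd hU sxv hp)
    have e : (fun s => pd (0, 1) t (p.1, s)) =ᶠ[𝓝 p.2]
        fun s => (2 * f p.1 * x (p.1, s) + g p.1) * pd (0, 1) x (p.1, s) := by
      filter_upwards [eventually_snd_mem hU hp] with s hs using first _ hs
    rw [(hasDerivAt_snd hU stv hp).unique (d.congr_of_eventuallyEq e)]
    ring
  have hf : ContDiffOn ℝ ∞ f (Prod.fst '' U) := by
    -- `2f` is the second derivative of `t` with respect to `x` along the leaf.
    refine smooth_of_fst_smooth hU (f := fun p => (pd (0, 1) (pd (0, 1) t) p * pd (0, 1) x p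
      - pd (0, 1) t p * pd (0, 1) (pd (0, 1) x) p) / (2 * pd (0, 1) x p ^ 3))
      (((stvv.mul sxv).sub (stv.mul sxvv)).div (contDiffOn_const.mul (sxv.pow 3))
        (fun p hp => mul_ne_zero two_ne_zero (pow_ne_zero 3 (hxv p hp)))) (fun p hp => ?_)
    rw [first p hp, second p hp]
    have := hxv p hp
    field_simp
    ring
  have hg : ContDiffOn ℝ ∞ g (Prod.fst '' U) := by
    refine smooth_of_fst_smooth hU (f := fun p => pd (0, 1) t p / pd (0, 1) x p
      - 2 * f p.1 * x p) ((stv.div sxv hxv).sub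
        ((contDiffOn_const.mul (fst_smooth hf)).mul sx)) (fun p hp => ?_)
    rw [first p hp]
    have := hxv p hp
    field_simp
    ring
  refine ⟨hf, hg, smooth_of_fst_smooth hU (f := fun p => t p - f p.1 * x p ^ 2 - g p.1 * x p)
    ((st.sub ((fst_smooth hf).mul (sx.pow 2))).sub ((fst_smooth hg).mul sx)) (fun p hp => ?_),
    smooth_of_fst_smooth hU (s2.sub s1) H.plane⟩
  have := H.parabola p hp
  simp only [ht, hx]
  linarith

/-- Here `φ₁`, `φ₂` are the `u`-derivatives of the quadratic at fixed `x`, `τ` is its slope in `x`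
and `ψ` the `u`-derivative of that slope. The normal chosen has square `-4W`, which accounts for the
factors `4`. -/
theorem relation (H : ParabolaFoliation X U f g h c) (hU : IsOpen U)
    (hX : IsSpacelikeImmersion X U) (hN : IsGaussMap X N U) (hW : IsLinearWeingarten X N U m n)
    (hq : q ∈ U) {x τ ψ φ₁ φ₂ W S : ℝ} (hx : x = X q 0) (hτ : τ = 2 * f q.1 * x + g q.1)
    (hψ : ψ = 2 * deriv f q.1 * x + deriv g q.1)
    (hφ₁ : φ₁ = deriv f q.1 * x ^ 2 + deriv g q.1 * x + deriv h q.1)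
    (hφ₂ : φ₂ = deriv (deriv f) q.1 * x ^ 2 + deriv (deriv g) q.1 * x + deriv (deriv h) q.1)
    (hW' : W = -(deriv c q.1 * φ₁ + deriv c q.1 ^ 2 * τ ^ 2 / 4))
    (hS : S = deriv c q.1 * φ₂ - φ₁ * deriv (deriv c) q.1 + deriv c q.1 ^ 2 * ψ * τ
      - 2 * deriv c q.1 ^ 2 * f q.1 * φ₁) :
    0 < W ∧ ∃ σ, σ ^ 2 = 4 * W ^ 3 ∧
      (1 + m) ^ 2 * (2 * deriv c q.1 * f q.1 * (deriv c q.1 * φ₂ - φ₁ * deriv (deriv c) q.1)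
        - deriv c q.1 ^ 2 * ψ ^ 2) * W - m * S ^ 2 + 4 * n ^ 2 * W ^ 3
        = n * (1 - m) * σ * S := by
  obtain ⟨sf, sg, sh, sc⟩ := H.smooth hU hX
  have hI := isOpen_fst_image hU
  have sX := hX.1
  have s0 := comp_apply_smooth sX 0
  have s1 := comp_apply_smooth sX 1
  have s2 := comp_apply_smooth sX 2
  have sf1 := deriv_smooth hI sf
  have sg1 := deriv_smooth hI sg
  have sh1 := deriv_smooth hI sh
  have dX := fun p hp => diffAt_of_smooth hU sX (q := p) hp
  have first : ∀ w, ∀ p ∈ U, pd w X p 2 + pd w X p 1 =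
      w.1 * (deriv f p.1 * X p 0 ^ 2 + deriv g p.1 * X p 0 + deriv h p.1)
        + (2 * f p.1 * X p 0 + g p.1) * pd w X p 0 := by
    intro w p hp
    have := pd_quadratic hU sf sg sh s0 hp w
    rw [← pd_congr hU H.parabola hp w, pd_add (f := fun p => X p 2) (g := fun p => X p 1) w
      (diffAt_of_smooth hU s2 hp) (diffAt_of_smooth hU s1 hp), pd_apply w (dX p hp),
      pd_apply w (dX p hp), pd_apply w (dX p hp)] at this
    exact this
  have plane1 : ∀ w, ∀ p ∈ U, pd w X p 2 - pd w X p 1 = w.1 * deriv c p.1 := by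
    intro w p hp
    have := pd_fst hU sc hp w
    rwa [← pd_congr hU H.plane hp w, pd_sub (f := fun p => X p 2) (g := fun p => X p 1) w
      (diffAt_of_smooth hU s2 hp) (diffAt_of_smooth hU s1 hp), pd_apply w (dX p hp),
      pd_apply w (dX p hp)] at this
  have sub2 : ∀ w w', pd w' (fun p => pd w X p 2 - pd w X p 1) q
      = pd w' (pd w X) q 2 - pd w' (pd w X) q 1 := fun w w' => by
    have sw := pd_smooth hU sX w
    rw [pd_sub (f := fun p => pd w X p 2) (g := fun p => pd w X p 1) w'
      (diffAt_of_smooth hU (comp_apply_smooth sw 2) hq)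
      (diffAt_of_smooth hU (comp_apply_smooth sw 1) hq),
      pd_apply w' (diffAt_of_smooth hU sw hq), pd_apply w' (diffAt_of_smooth hU sw hq)]
  have add2 : ∀ w w', pd w' (fun p => pd w X p 2 + pd w X p 1) q
      = pd w' (pd w X) q 2 + pd w' (pd w X) q 1 := fun w w' => by
    have sw := pd_smooth hU sX w
    rw [pd_add (f := fun p => pd w X p 2) (g := fun p => pd w X p 1) w'
      (diffAt_of_smooth hU (comp_apply_smooth sw 2) hq)
      (diffAt_of_smooth hU (comp_apply_smooth sw 1) hq),
      pd_apply w' (diffAt_of_smooth hU sw hq), pd_apply w' (diffAt_of_smooth hU sw hq)]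
  have plane2 : ∀ w w', pd w' (pd w X) q 2 - pd w' (pd w X) q 1
      = w'.1 * w.1 * deriv (deriv c) q.1 := by
    intro w w'
    have sc1 := deriv_smooth hI sc
    rw [← sub2, pd_congr hU (plane1 w) hq w',
      pd_const_mul w' _ (diffAt_of_smooth hU (fst_smooth sc1) hq), pd_fst hU sc1 hq]
    ring
  have second : ∀ w w', pd w' (pd w X) q 2 + pd w' (pd w X) q 1 =
      w.1 * (w'.1 * φ₂ + ψ * pd w' X q 0) + (w'.1 * ψ + 2 * f q.1 * pd w' X q 0) * pd w X q 0
        + τ * pd w' (pd w X) q 0 := by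
    intro w w'
    have sw := comp_apply_smooth (pd_smooth hU sX w) 0
    have sA : ContDiffOn ℝ ∞ (fun p : ℝ × ℝ => deriv f p.1 * X p 0 ^ 2 + deriv g p.1 * X p 0
        + deriv h p.1) U :=
      (((fst_smooth sf1).mul (s0.pow 2)).add ((fst_smooth sg1).mul s0)).add (fst_smooth sh1)
    have sB : ContDiffOn ℝ ∞ (fun p : ℝ × ℝ => 2 * f p.1 * X p 0 + g p.1) U :=
      ((contDiffOn_const.mul (fst_smooth sf)).mul s0).add (fst_smooth sg)
    have dA := diffAt_of_smooth hU sA hq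
    have dB := diffAt_of_smooth hU sB hq
    have dw := diffAt_of_smooth hU sw hq
    have eB : pd w' (fun p : ℝ × ℝ => 2 * f p.1 * X p 0 + g p.1) q
        = w'.1 * ψ + 2 * f q.1 * pd w' X q 0 := by
      rw [pd_add (f := fun p : ℝ × ℝ => 2 * f p.1 * X p 0) w'
        (diffAt_of_smooth hU ((contDiffOn_const.mul (fst_smooth sf)).mul s0) hq)
        (diffAt_of_smooth hU (fst_smooth sg) hq),
        pd_mul (f := fun p : ℝ × ℝ => 2 * f p.1) w'
          (diffAt_of_smooth hU (contDiffOn_const.mul (fst_smooth sf)) hq)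
          (diffAt_of_smooth hU s0 hq),
        pd_const_mul w' 2 (diffAt_of_smooth hU (fst_smooth sf) hq), pd_fst hU sf hq,
        pd_fst hU sg hq, pd_apply w' (dX q hq), hψ, hx]
      ring
    rw [← add2, pd_congr hU (first w) hq w',
      pd_add (f := fun p : ℝ × ℝ => w.1 * (deriv f p.1 * X p 0 ^ 2 + deriv g p.1 * X p 0
        + deriv h p.1)) (g := fun p : ℝ × ℝ => (2 * f p.1 * X p 0 + g p.1) * pd w X p 0) w'
        (dA.const_mul _) (dB.mul dw), pd_const_mul w' _ dA, pd_mul w' dB dw,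
      pd_quadratic hU sf1 sg1 sh1 s0 hq, eB, pd_apply w' (dX q hq),
      pd_apply w' (diffAt_of_smooth hU (pd_smooth hU sX w) hq), hφ₂, hτ, hψ, hx]
    ring
  have su : pd (1, 0) X q 2 - pd (1, 0) X q 1 = deriv c q.1 := by simp [plane1 _ q hq]
  have sv : pd (0, 1) X q 2 - pd (0, 1) X q 1 = 0 := by simp [plane1 _ q hq]
  have suu : pd (1, 0) (pd (1, 0) X) q 2 - pd (1, 0) (pd (1, 0) X) q 1 = deriv (deriv c) q.1 := by
    simp [plane2]
  have suv : pd (1, 0) (pd (0, 1) X) q 2 - pd (1, 0) (pd (0, 1) X) q 1 = 0 := by simp [plane2]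
  have svv : pd (0, 1) (pd (0, 1) X) q 2 - pd (0, 1) (pd (0, 1) X) q 1 = 0 := by simp [plane2]
  have tu : pd (1, 0) X q 2 + pd (1, 0) X q 1 = φ₁ + τ * pd (1, 0) X q 0 := by
    rw [first _ q hq, hφ₁, hτ, hx, one_mul]
  have tv : pd (0, 1) X q 2 + pd (0, 1) X q 1 = τ * pd (0, 1) X q 0 := by
    rw [first _ q hq, hτ, hx, zero_mul, zero_add]
  obtain ⟨f1, f2, f3⟩ := parabola_forms (f := f q.1) (τ := τ) (ψ := ψ) (φ₁ := φ₁) (φ₂ := φ₂)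
    (c₁ := deriv c q.1) (c₂ := deriv (deriv c) q.1)
    (tuu := pd (1, 0) (pd (1, 0) X) q 2 + pd (1, 0) (pd (1, 0) X) q 1)
    (xuu := pd (1, 0) (pd (1, 0) X) q 0)
    (tuv := pd (1, 0) (pd (0, 1) X) q 2 + pd (1, 0) (pd (0, 1) X) q 1)
    (xuv := pd (1, 0) (pd (0, 1) X) q 0)
    (tvv := pd (0, 1) (pd (0, 1) X) q 2 + pd (0, 1) (pd (0, 1) X) q 1)
    (xvv := pd (0, 1) (pd (0, 1) X) q 0)
    tu tv (by rw [second]; ring) (by rw [second]; ring) (by rw [second]; ring)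
  have hlor : ∀ V, lor ![-(deriv c q.1 * τ), φ₁ + deriv c q.1, φ₁ - deriv c q.1] V
      = deriv c q.1 * ((V 2 + V 1) - τ * V 0) - φ₁ * (V 2 - V 1) := by
    intro V
    rw [lor_null]
    simp
    ring
  have := weingarten_relation hU hX hN hW hq (δ := 4) (W := W) four_pos
    (ℓ := ![-(deriv c q.1 * τ), φ₁ + deriv c q.1, φ₁ - deriv c q.1])
    (by rw [lor_null, su]; ring) (by rw [lor_null, su, sv]; ring) (by rw [lor_null, sv]; ring)
    (by rw [hlor, su, tu]; ring) (by rw [hlor, sv, tv]; ring)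
    (by rw [hlor, hW']; simp; ring)
    (by rw [hlor, suu]) (by rw [hlor, suv]; ring) (by rw [hlor, svv]; ring)
    (by rw [hW']; exact f1) f2 f3
  rw [hS]
  exact this

theorem leaf_motion (H : ParabolaFoliation X U f g h c) (hU : IsOpen U)
    (hX : IsSpacelikeImmersion X U) (hN : IsGaussMap X N U) (hW : IsLinearWeingarten X N U m n)
    (hm : m ≠ 0) (hmn : ¬(m = -1 ∧ n = 0)) (hq : q ∈ U) :
    deriv f q.1 = -f q.1 ^ 2 * deriv c q.1 ∧ deriv g q.1 = -(f q.1 * g q.1) * deriv c q.1 := by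
  have hc : deriv c q.1 ≠ 0 := by
    intro h0
    obtain ⟨hpos, -⟩ := H.relation hU hX hN hW hq rfl rfl rfl rfl rfl rfl rfl
    rw [h0] at hpos
    simp at hpos
  set c₁ := deriv c q.1
  set c₂ := deriv (deriv c) q.1
  -- Spacelikeness gives `c' ≠ 0`, so `c` can serve as parameter. `F₁`, `F₂` and their analogues are
  -- the first and second derivatives with respect to `c`.
  have key := parabola_rigidity (f := f q.1) (g := g q.1) (F₁ := deriv f q.1 / c₁)
    (G₁ := deriv g q.1 / c₁) (H₁ := deriv h q.1 / c₁)
    (F₂ := (deriv (deriv f) q.1 - c₂ * (deriv f q.1 / c₁)) / c₁ ^ 2)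
    (G₂ := (deriv (deriv g) q.1 - c₂ * (deriv g q.1 / c₁)) / c₁ ^ 2)
    (H₂ := (deriv (deriv h) q.1 - c₂ * (deriv h q.1 / c₁)) / c₁ ^ 2) hm hmn (by
      intro x D K T hD hK hT
      obtain ⟨v, hv, hx⟩ := H.whole q hq x
      obtain ⟨hpos, σ, hσ, e⟩ := H.relation hU hX hN hW hv hx.symm rfl rfl rfl rfl
        (W := c₁ ^ 2 * D) (S := c₁ ^ 3 * T) (by rw [hD]; simp only; field_simp; ring)
        (by rw [hT]; simp only; field_simp; ring)
      refine ⟨pos_of_mul_pos_right hpos (sq_nonneg _), σ / c₁ ^ 3, ?_, ?_⟩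
      · rw [div_pow, hσ]; field_simp
      · have hK' : 2 * c₁ * f q.1 * (c₁ * (deriv (deriv f) q.1 * x ^ 2 + deriv (deriv g) q.1 * x
            + deriv (deriv h) q.1) - (deriv f q.1 * x ^ 2 + deriv g q.1 * x + deriv h q.1) * c₂)
            - c₁ ^ 2 * (2 * deriv f q.1 * x + deriv g q.1) ^ 2 = c₁ ^ 4 * K := by
          rw [hK]; field_simp; ring
        have e' : (1 + m) ^ 2 * (c₁ ^ 4 * K) * (c₁ ^ 2 * D) - m * (c₁ ^ 3 * T) ^ 2
            + 4 * n ^ 2 * (c₁ ^ 2 * D) ^ 3 = n * (1 - m) * σ * (c₁ ^ 3 * T) := by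
          rw [← hK']; exact e
        field_simp
        apply mul_left_cancel₀ (pow_ne_zero 3 hc)
        linear_combination e')
  obtain ⟨k1, k2⟩ := key
  rw [div_eq_iff hc] at k1 k2
  exact ⟨k1, k2⟩

theorem revolution (H : ParabolaFoliation X U f g h c) (hU : IsOpen U) (hUc : IsConnected U)
    (hX : IsSpacelikeImmersion X U) (hN : IsGaussMap X N U) (hW : IsLinearWeingarten X N U m n)
    (hm : m ≠ 0) (hmn : ¬(m = -1 ∧ n = 0)) : IsSurfaceOfRevolution X U := by
  obtain ⟨sf, sg, -, sc⟩ := H.smooth hU hX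
  have nz : ∀ u ∈ Prod.fst '' U, f u ≠ 0 := by rintro _ ⟨p, hp, rfl⟩; exact H.ne_zero p hp
  obtain ⟨k, hk⟩ := const_of_deriv_eq_zero (a := fun u => g u / f u) hU hUc (sg.div sf nz) (by
    intro p hp
    obtain ⟨e1, e2⟩ := H.leaf_motion hU hX hN hW hm hmn hp
    have hd := (fst_diffAt hU sg hp).hasDerivAt.div (fst_diffAt hU sf hp).hasDerivAt
      (H.ne_zero p hp)
    refine hd.deriv.trans ?_
    rw [e1, e2]
    field_simp
    ring)
  obtain ⟨s₀, hs⟩ := const_of_deriv_eq_zero (a := fun u => c u - (f u)⁻¹) hU hUc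
    (sc.sub (sf.inv nz)) (by
    intro p hp
    obtain ⟨e1, -⟩ := H.leaf_motion hU hX hN hW hm hmn hp
    have hf0 := H.ne_zero p hp
    have hd := (fst_diffAt hU sc hp).hasDerivAt.sub ((fst_diffAt hU sf hp).hasDerivAt.inv hf0)
    refine hd.deriv.trans ?_
    rw [e1]
    field_simp
    ring)
  -- The axis passes through this point. Relative to it the height `x₂ - x₁` of a leaf is `1/f`, so
  -- rotation by `t` moves `x₀` by `t/f`.
  refine ⟨_, isRotationGroup_translate (Or.inr (Or.inr rfl)) ![-k / 2, 0, s₀],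
    fun q hq V hV => ?_⟩
  have hf0 := H.ne_zero q hq
  have hg : g q.1 = k * f q.1 := by rw [← hk q hq]; field_simp
  have hc : c q.1 - s₀ = (f q.1)⁻¹ := by rw [← hs q hq]; ring
  have s0 := comp_apply_smooth hX.1 0
  have hder : pd (0, 1) (fun p => X p 0) q ≠ 0 := by
    rw [pd_apply _ (diffAt_of_smooth hU hX.1 hq)]
    exact H.leaf_pos hU hX hq
  have hmemV : ∀ᶠ v in 𝓝 q.2, (q.1, v) ∈ V ∩ U :=
    (by fun_prop : Continuous fun s : ℝ => (q.1, s)).continuousAt.eventually_mem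
      (Filter.inter_mem hV (hU.mem_nhds hq))
  have him := leaf_local_surjective (smooth_snd_line hU s0 hq) (hasDerivAt_snd hU s0 hq) hder hmemV
  have hct : ContinuousAt (fun t : ℝ => X q 0 + t * (f q.1)⁻¹) 0 := by fun_prop
  have hev := hct (by simpa using him)
  filter_upwards [hev] with t ht
  obtain ⟨v, hv, hxv⟩ := ht
  refine ⟨(q.1, v), hv, ?_⟩
  have hxv' : X (q.1, v) 0 = X q 0 + t * (f q.1)⁻¹ := hxv
  have p1 := H.parabola _ hv.2
  have p2 := H.plane _ hv.2
  have q1 := H.parabola _ hq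
  have q2 := H.plane _ hq
  simp only at p1 p2
  have hcq : X q 2 - X q 1 = s₀ + (f q.1)⁻¹ := by rw [q2]; linarith
  have hcp : X (q.1, v) 2 - X (q.1, v) 1 = s₀ + (f q.1)⁻¹ := by rw [p2]; linarith
  have hsum : X (q.1, v) 2 + X (q.1, v) 1 = X q 2 + X q 1 + 2 * t * X q 0 + t * k
      + t ^ 2 * (f q.1)⁻¹ := by
    rw [p1, q1, hxv', hg]
    field_simp
    ring
  ext i
  fin_cases i
  · simp [rotLightlike, hxv']
    linear_combination -t * hcq
  · simp [rotLightlike]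
    linear_combination hsum / 2 - hcp / 2 + (1 - t ^ 2) / 2 * hcq
  · simp [rotLightlike]
    linear_combination hsum / 2 + hcp / 2 - (1 + t ^ 2) / 2 * hcq

end ParabolaFoliation

end Minkowski

/-! ### Invariance of the hypotheses and the conclusion under linear isometries. -/

namespace Minkowski

section Isometry

/-- A linear map preserving the metric is bijective. -/
theorem exists_equiv_of_isometry {L : E31 →ₗ[ℝ] E31} (hL : ∀ x y, lor (L x) (L y) = lor x y) :
    ∃ e : E31 ≃ₗ[ℝ] E31, ∀ x, e x = L x := by
  have hinj : Function.Injective L := by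
    rw [injective_iff_map_eq_zero]
    intro x hx
    have h : ∀ y, lor x y = 0 := fun y => by rw [← hL, hx]; simp [lor]
    have h0 := h ![1, 0, 0]
    have h1 := h ![0, 1, 0]
    have h2 := h ![0, 0, 1]
    simp [lor] at h0 h1 h2
    ext i
    fin_cases i
    · exact h0
    · exact h1
    · exact h2
  exact ⟨LinearEquiv.ofInjectiveEndo L hinj, fun x => rfl⟩

theorem lor_symm_left {e : E31 ≃ₗ[ℝ] E31} (he : ∀ x y, lor (e x) (e y) = lor x y) (x y : E31) :
    lor (e.symm x) y = lor x (e y) := by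
  rw [← he, e.apply_symm_apply]

variable {U : Set (ℝ × ℝ)} {X N : ℝ × ℝ → E31} {m n : ℝ} {e : E31 ≃ₗ[ℝ] E31}

theorem fderiv_equiv_comp (e : E31 ≃ₗ[ℝ] E31) (X : ℝ × ℝ → E31) (q w : ℝ × ℝ) :
    fderiv ℝ (fun p => e (X p)) q w = e (fderiv ℝ X q w) := by
  have := (e.toContinuousLinearEquiv).comp_fderiv (f := X) (x := q)
  exact congrArg (fun F : ℝ × ℝ →L[ℝ] E31 => F w) this

theorem contDiffOn_equiv_comp (e : E31 ≃ₗ[ℝ] E31) (hX : ContDiffOn ℝ ∞ X U) :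
    ContDiffOn ℝ ∞ (fun p => e (X p)) U :=
  e.toContinuousLinearEquiv.contDiff.comp_contDiffOn hX

theorem IsSpacelikeImmersion.isometry (hX : IsSpacelikeImmersion X U)
    (he : ∀ x y, lor (e x) (e y) = lor x y) : IsSpacelikeImmersion (fun p => e (X p)) U :=
  ⟨contDiffOn_equiv_comp e hX.1, fun q hq w hw => by
    rw [fderiv_equiv_comp, he]; exact hX.2 q hq w hw⟩

theorem IsGaussMap.isometry (hN : IsGaussMap X N U) (he : ∀ x y, lor (e x) (e y) = lor x y) :
    IsGaussMap (fun p => e (X p)) (fun p => e (N p)) U :=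
  ⟨contDiffOn_equiv_comp e hN.1, fun q hq => ⟨by rw [he]; exact (hN.2 q hq).1, fun w => by
    rw [fderiv_equiv_comp, he]; exact (hN.2 q hq).2 w⟩⟩

theorem IsLinearWeingarten.isometry (hW : IsLinearWeingarten X N U m n)
    (he : ∀ x y, lor (e x) (e y) = lor x y) :
    IsLinearWeingarten (fun p => e (X p)) (fun p => e (N p)) U m n := by
  intro q hq
  obtain ⟨k₁, k₂, ⟨a, b, h1, h2, h3, h4, h5⟩, hk⟩ := hW q hq
  refine ⟨k₁, k₂, ⟨a, b, ?_, ?_, ?_, ?_, ?_⟩, hk⟩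
  · rw [fderiv_equiv_comp, he, h1]
  · rw [fderiv_equiv_comp, he, h2]
  · rw [fderiv_equiv_comp, fderiv_equiv_comp, he, h3]
  · rw [fderiv_equiv_comp, fderiv_equiv_comp, ← map_neg, h4, map_smul]
  · rw [fderiv_equiv_comp, fderiv_equiv_comp, ← map_neg, h5, map_smul]

theorem IsSurfaceOfRevolution.of_isometry (he : ∀ x y, lor (e x) (e y) = lor x y)
    (h : IsSurfaceOfRevolution (fun p => e (X p)) U) : IsSurfaceOfRevolution X U := by
  obtain ⟨ρ, ⟨g, ⟨L, w, hL, hg⟩, R, hR, hρ⟩, hrot⟩ := h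
  -- The rotation group is conjugated by `e`.
  refine ⟨fun t x => e.symm (ρ t (e x)), ⟨fun x => e.symm (g x),
    ⟨e.symm.toLinearMap.comp L, e.symm w, fun x y => ?_, fun x => ?_⟩, R, hR, fun t x => ?_⟩,
    fun q hq V hV => ?_⟩
  · simp only [LinearMap.comp_apply, LinearEquiv.coe_coe]
    rw [lor_symm_left he, e.apply_symm_apply, hL]
  · change e.symm (g x) = _
    rw [hg, map_add]
    rfl
  · simp [hρ]
  · filter_upwards [hrot q hq V hV] with t ht
    obtain ⟨p, hp, hpe⟩ := ht
    refine ⟨p, hp, ?_⟩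
    simp only at hpe
    rw [← hpe, e.symm_apply_apply]

end Isometry

/-! ### Circles in coordinates adapted to their plane. -/

section Circles

theorem hasDerivAt_rotTimelike (p : E31) :
    HasDerivAt (fun t => rotTimelike t p) ![p 1, -p 0, 0] 0 := by
  rw [hasDerivAt_pi]
  intro i
  fin_cases i
  · have := ((Real.hasDerivAt_cos 0).mul_const (p 0)).add ((Real.hasDerivAt_sin 0).mul_const (p 1))
    convert this using 1
    · funext t
      simp [rotTimelike]
    · simp
  · have := ((Real.hasDerivAt_sin 0).neg.mul_const (p 0)).add
      ((Real.hasDerivAt_cos 0).mul_const (p 1))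
    convert this using 1
    · funext t
      simp [rotTimelike]
    · simp
  · exact hasDerivAt_const _ _

theorem hasDerivAt_rotSpacelike (p : E31) :
    HasDerivAt (fun t => rotSpacelike t p) ![0, p 2, p 1] 0 := by
  rw [hasDerivAt_pi]
  intro i
  fin_cases i
  · exact hasDerivAt_const _ _
  · have := ((Real.hasDerivAt_cosh 0).mul_const (p 1)).add
      ((Real.hasDerivAt_sinh 0).mul_const (p 2))
    convert this using 1
    · funext t
      simp [rotSpacelike]
    · simp
  · have := ((Real.hasDerivAt_sinh 0).mul_const (p 1)).add
      ((Real.hasDerivAt_cosh 0).mul_const (p 2))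
    convert this using 1
    · funext t
      simp [rotSpacelike]
    · simp

theorem hasDerivAt_rotLightlike (p : E31) :
    HasDerivAt (fun t => rotLightlike t p) ![p 2 - p 1, p 0, p 0] 0 := by
  have hid := hasDerivAt_id (0 : ℝ)
  have hsq := ((hid.pow 2).div_const 2)
  rw [hasDerivAt_pi]
  intro i
  fin_cases i
  · have := ((hid.mul_const (p 1)).const_sub (p 0)).add (hid.mul_const (p 2))
    convert this using 1
    · funext t
      simp [rotLightlike]
    · simp
      ring
  · have := ((hid.mul_const (p 0)).add ((hsq.const_sub 1).mul_const (p 1))).add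
      (hsq.mul_const (p 2))
    convert this using 1
    · funext t
      simp [rotLightlike]
    · simp
  · have := ((hid.mul_const (p 0)).sub (hsq.mul_const (p 1))).add
      ((hsq.const_add 1).mul_const (p 2))
    convert this using 1
    · funext t
      simp [rotLightlike]
    · simp

/-- A circle in a plane with normal `ν` is, up to a rigid motion, a standard orbit, and the axis of
the rotation group is parallel to `ν`. -/
theorem circle_normal_form {C : Set E31} {ν : E31} {c : ℝ} (hC : IsCircle C) (hν : ν ≠ 0)
    (hplane : ∀ x ∈ C, lor x ν = c) :
    ∃ (e : E31 ≃ₗ[ℝ] E31) (w p : E31), (∀ x y, lor (e x) (e y) = lor x y) ∧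
      ((lor ν ν < 0 ∧ e.symm ν 0 = 0 ∧ e.symm ν 1 = 0 ∧ 0 < p 0 ^ 2 + p 1 ^ 2 ∧
          C = Set.range fun t => e (rotTimelike t p) + w) ∨
        (0 < lor ν ν ∧ e.symm ν 1 = 0 ∧ e.symm ν 2 = 0 ∧ 0 < p 2 ^ 2 - p 1 ^ 2 ∧
          C = Set.range fun t => e (rotSpacelike t p) + w) ∨
        (lor ν ν = 0 ∧ e.symm ν 0 = 0 ∧ e.symm ν 1 = e.symm ν 2 ∧ p 2 - p 1 ≠ 0 ∧
          C = Set.range fun t => e (rotLightlike t p) + w)) := by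
  obtain ⟨ρ, P, ⟨g, ⟨L, w, hL, hg⟩, R, hR, hρ⟩, hCr, hreg⟩ := hC
  obtain ⟨e, heL⟩ := exists_equiv_of_isometry hL
  have he : ∀ x y, lor (e x) (e y) = lor x y := fun x y => by rw [heL, heL, hL]
  obtain ⟨p, hp⟩ : ∃ p, p = e.symm (P - w) := ⟨_, rfl⟩
  have hP : P = g p := by rw [hg, ← heL, hp]; simp
  have horb : ∀ t, ρ t P = e (R t p) + w := fun t => by rw [hP, hρ, hg, heL]
  have hCe : C = Set.range fun t => e (R t p) + w := by rw [hCr]; simp only [horb]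
  obtain ⟨μ, hμ⟩ : ∃ μ, μ = e.symm ν := ⟨_, rfl⟩
  have hνμ : ν = e μ := by rw [hμ]; simp
  have hμ0 : μ ≠ 0 := fun h => hν (by rw [hνμ, h, map_zero])
  have hνν : lor ν ν = lor μ μ := by rw [hνμ, he]
  -- The normal `μ` is orthogonal to all chords of the orbit. Two chords from `t = 0`, together with
  -- the nonzero speed there, force it to be parallel to the axis.
  have hconst : ∀ t, lor (R t p) μ = lor (R 0 p) μ := by
    intro t
    have h1 := hplane (e (R t p) + w) (by rw [hCe]; exact ⟨t, rfl⟩)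
    have h2 := hplane (e (R 0 p) + w) (by rw [hCe]; exact ⟨0, rfl⟩)
    rw [hνμ, lor_add_left, he] at h1 h2
    linarith
  have hspeed : ∀ d, HasDerivAt (fun t => R t p) d 0 → 0 < lor d d := by
    intro d hd
    have h1 : HasDerivAt (fun s => ρ s P) (e d) 0 := by
      simp only [horb]
      exact ((e.toContinuousLinearEquiv.toContinuousLinearMap.hasFDerivAt).comp_hasDerivAt 0
        hd).add_const w
    have := hreg 0
    rwa [h1.deriv, he] at this
  have hext : ∀ {x y z : ℝ}, μ 0 = x → μ 1 = y → μ 2 = z → ¬(x = 0 ∧ y = 0 ∧ z = 0) := by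
    rintro x y z h0 h1 h2 ⟨rfl, rfl, rfl⟩
    apply hμ0
    ext i
    fin_cases i
    · exact h0
    · exact h1
    · exact h2
  refine ⟨e, w, p, he, ?_⟩
  rw [hνν, ← hμ, hCe]
  rcases hR with rfl | rfl | rfl
  · left
    have hsp := hspeed _ (hasDerivAt_rotTimelike p)
    have h1 := hconst Real.pi
    have h2 := hconst (Real.pi / 2)
    simp [lor, rotTimelike] at hsp h1 h2
    have hr : 0 < p 0 ^ 2 + p 1 ^ 2 := by nlinarith
    have k1 : (p 0 ^ 2 + p 1 ^ 2) * μ 0 = 0 := by linear_combination -(p 0 + p 1) / 2 * h1 + p 1 * h2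
    have k2 : (p 0 ^ 2 + p 1 ^ 2) * μ 1 = 0 := by linear_combination (p 0 - p 1) / 2 * h1 - p 0 * h2
    have z0 := (mul_eq_zero.1 k1).resolve_left hr.ne'
    have z1 := (mul_eq_zero.1 k2).resolve_left hr.ne'
    have z2 : μ 2 ≠ 0 := fun h => hext z0 z1 h ⟨rfl, rfl, rfl⟩
    refine ⟨?_, z0, z1, hr, rfl⟩
    simp only [lor, z0, z1]
    have : 0 < μ 2 ^ 2 := by positivity
    linarith
  · right; left
    have hsp := hspeed _ (hasDerivAt_rotSpacelike p)
    have h1 := hconst 1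
    have h2 := hconst (-1)
    simp [lor, rotSpacelike] at hsp h1 h2
    have hr : 0 < p 2 ^ 2 - p 1 ^ 2 := by nlinarith
    have hs : Real.sinh 1 ≠ 0 := (Real.sinh_pos_iff.2 one_pos).ne'
    have hch : Real.cosh 1 - 1 ≠ 0 := by
      have := Real.one_lt_cosh.2 (one_ne_zero (α := ℝ))
      linarith
    have k1 : (Real.cosh 1 - 1) * (p 1 * μ 1 - p 2 * μ 2) = 0 := by linear_combination (h1 + h2) / 2
    have k2 : Real.sinh 1 * (p 2 * μ 1 - p 1 * μ 2) = 0 := by linear_combination (h1 - h2) / 2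
    have k1' := (mul_eq_zero.1 k1).resolve_left hch
    have k2' := (mul_eq_zero.1 k2).resolve_left hs
    have j1 : (p 2 ^ 2 - p 1 ^ 2) * μ 1 = 0 := by linear_combination p 2 * k2' - p 1 * k1'
    have j2 : (p 2 ^ 2 - p 1 ^ 2) * μ 2 = 0 := by linear_combination p 1 * k2' - p 2 * k1'
    have z1 := (mul_eq_zero.1 j1).resolve_left hr.ne'
    have z2 := (mul_eq_zero.1 j2).resolve_left hr.ne'
    have z0 : μ 0 ≠ 0 := fun h => hext h z1 z2 ⟨rfl, rfl, rfl⟩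
    refine ⟨?_, z1, z2, hr, rfl⟩
    simp only [lor, z1, z2]
    have : 0 < μ 0 ^ 2 := by positivity
    linarith
  · right; right
    have hsp := hspeed _ (hasDerivAt_rotLightlike p)
    have h1 := hconst 1
    have h2 := hconst (-1)
    simp [lor, rotLightlike] at hsp h1 h2
    have hw : p 2 - p 1 ≠ 0 := by
      intro h
      rw [h] at hsp
      simp at hsp
    have k1 : (p 2 - p 1) * (μ 1 - μ 2) = 0 := by linear_combination h1 + h2
    have k1' := (mul_eq_zero.1 k1).resolve_left hw
    have k2 : (p 2 - p 1) * μ 0 = 0 := by linear_combination (h1 - h2) / 2 - p 0 * k1'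
    have z0 := (mul_eq_zero.1 k2).resolve_left hw
    have z1 : μ 1 = μ 2 := by linarith
    refine ⟨?_, z0, z1, hw, rfl⟩
    simp only [lor, z0, z1]
    ring

variable {e : E31 ≃ₗ[ℝ] E31} {w p ν : E31}

/-- The vector from the centre `o` on the axis to a point of the orbit is orthogonal to `ν` and has
constant square. Both facts survive the isometry `e`. -/
theorem timelike_circle_coords (he : ∀ x y, lor (e x) (e y) = lor x y) (hν : ν ≠ 0)
    (h0 : ν 0 = 0) (h1 : ν 1 = 0) (hs0 : e.symm ν 0 = 0) (hs1 : e.symm ν 1 = 0)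
    (hp : 0 < p 0 ^ 2 + p 1 ^ 2) :
    ∃ a b R c : ℝ, 0 < R ∧ ∀ x ∈ Set.range (fun t => e (rotTimelike t p) + w),
      (x 0 - a) ^ 2 + 1 * (x 1 - b) ^ 2 = R ∧ x 2 = c := by
  obtain ⟨o, ho⟩ : ∃ o, o = e ![0, 0, p 2] + w := ⟨_, rfl⟩
  refine ⟨o 0, o 1, p 0 ^ 2 + p 1 ^ 2, o 2, hp, ?_⟩
  rintro _ ⟨t, rfl⟩
  set x := e (rotTimelike t p) + w with hx
  have hd : x - o = e (rotTimelike t p - ![0, 0, p 2]) := by rw [hx, ho, map_sub]; abel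
  have hν2 : ν 2 ≠ 0 := by
    intro h
    apply hν
    ext i
    fin_cases i
    · exact h0
    · exact h1
    · exact h
  have e1 : lor (x - o) ν = 0 := by
    rw [hd, lor_comm, ← lor_symm_left he]
    simp [lor, rotTimelike, hs0, hs1]
  have e2 : x 2 = o 2 := by
    simp [lor, h0, h1, hν2] at e1
    linarith
  have e3 : lor (x - o) (x - o) = p 0 ^ 2 + p 1 ^ 2 := by
    rw [hd, he]
    simp [lor, rotTimelike]
    linear_combination (p 0 ^ 2 + p 1 ^ 2) * Real.sin_sq_add_cos_sq t
  refine ⟨?_, e2⟩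
  simp only [lor, Pi.sub_apply, e2] at e3
  linear_combination e3

theorem spacelike_circle_coords (he : ∀ x y, lor (e x) (e y) = lor x y) (hν : ν ≠ 0)
    (h1 : ν 1 = 0) (h2 : ν 2 = 0) (hs1 : e.symm ν 1 = 0) (hs2 : e.symm ν 2 = 0)
    (hp : 0 < p 2 ^ 2 - p 1 ^ 2) :
    ∃ a b R c : ℝ, 0 < R ∧ ∀ x ∈ Set.range (fun t => e (rotSpacelike t p) + w),
      (x 2 - a) ^ 2 + -1 * (x 1 - b) ^ 2 = R ∧ x 0 = c := by
  obtain ⟨o, ho⟩ : ∃ o, o = e ![p 0, 0, 0] + w := ⟨_, rfl⟩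
  refine ⟨o 2, o 1, p 2 ^ 2 - p 1 ^ 2, o 0, hp, ?_⟩
  rintro _ ⟨t, rfl⟩
  set x := e (rotSpacelike t p) + w with hx
  have hd : x - o = e (rotSpacelike t p - ![p 0, 0, 0]) := by rw [hx, ho, map_sub]; abel
  have hν0 : ν 0 ≠ 0 := by
    intro h
    apply hν
    ext i
    fin_cases i
    · exact h
    · exact h1
    · exact h2
  have e1 : lor (x - o) ν = 0 := by
    rw [hd, lor_comm, ← lor_symm_left he]
    simp [lor, rotSpacelike, hs1, hs2]
  have e2 : x 0 = o 0 := by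
    simp [lor, h1, h2, hν0] at e1
    linarith
  have e3 : lor (x - o) (x - o) = p 1 ^ 2 - p 2 ^ 2 := by
    rw [hd, he]
    simp [lor, rotSpacelike]
    linear_combination (p 1 ^ 2 - p 2 ^ 2) * Real.cosh_sq t
  refine ⟨?_, e2⟩
  simp only [lor, Pi.sub_apply, e2] at e3
  linear_combination -e3

theorem lightlike_circle_coords (he : ∀ x y, lor (e x) (e y) = lor x y) (hν : ν ≠ 0)
    (h0 : ν 0 = 0) (h1 : ν 1 = ν 2) (hs0 : e.symm ν 0 = 0) (hs1 : e.symm ν 1 = e.symm ν 2)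
    (hp : p 2 - p 1 ≠ 0) :
    ∃ f g h c : ℝ, f ≠ 0 ∧ (∀ x ∈ Set.range (fun t => e (rotLightlike t p) + w),
      x 2 + x 1 = f * x 0 ^ 2 + g * x 0 + h ∧ x 2 - x 1 = c) ∧
      ∀ s : ℝ, ∃ x ∈ Set.range (fun t => e (rotLightlike t p) + w), x 0 = s := by
  obtain ⟨k, hk⟩ : ∃ k, k = e.symm ν 2 := ⟨_, rfl⟩
  have hsν : e.symm ν = k • ![0, 1, 1] := by
    ext i
    fin_cases i
    · simp [hs0]
    · simp [hs1, hk]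
    · simp [hk]
  have hνe : ν = k • e ![0, 1, 1] := by
    rw [← map_smul, ← hsν, e.apply_symm_apply]
  have hk0 : k ≠ 0 := by
    rintro rfl
    exact hν (by rw [hνe, zero_smul])
  have hν2 : ν 2 ≠ 0 := by
    intro h
    apply hν
    ext i
    fin_cases i
    · exact h0
    · exact h1.trans h
    · exact h
  obtain ⟨l, hl⟩ : ∃ l, l = e ![0, 1, 1] 2 := ⟨_, rfl⟩
  have l0 : e ![0, 1, 1] 0 = 0 := by
    have := congrFun hνe 0
    simpa [h0, hk0] using this.symm
  have l1 : e ![0, 1, 1] 1 = l := by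
    have a1 := congrFun hνe 1
    have a2 := congrFun hνe 2
    simp only [Pi.smul_apply, smul_eq_mul] at a1 a2
    rw [hl]
    apply mul_left_cancel₀ hk0
    linarith
  have hl0 : l ≠ 0 := by
    intro h
    have a2 := congrFun hνe 2
    simp only [Pi.smul_apply, smul_eq_mul] at a2
    rw [← hl, h, mul_zero] at a2
    exact hν2 a2
  obtain ⟨d, hd⟩ : ∃ d, d = p 2 - p 1 := ⟨_, rfl⟩
  rw [← hd] at hp
  -- `A` is the velocity of the orbit at `t = 0`. Orthogonality to `ν` gives `A 1 = A 2`, and `⟨A,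
  -- A⟩ = d²` gives `A 0 ≠ 0`; so `x₀` is an affine bijective function of `t`.
  obtain ⟨A, hA⟩ : ∃ A, A = e ![d, p 0, p 0] := ⟨_, rfl⟩
  have hAν : lor A ν = 0 := by
    rw [hA, lor_comm, ← lor_symm_left he, hsν]
    simp [lor]
  have hA12 : A 1 = A 2 := by
    simp only [lor, h0, h1, mul_zero, zero_add, ← sub_mul] at hAν
    have := (mul_eq_zero.1 hAν).resolve_right hν2
    linarith
  have hAA : A 0 ^ 2 = d ^ 2 := by
    have : lor A A = d ^ 2 := by rw [hA, he]; simp [lor]; ring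
    rw [← this]
    simp only [lor, hA12]
    ring
  have hA0 : A 0 ≠ 0 := by
    intro h
    rw [h] at hAA
    exact hp (by simpa using hAA.symm)
  obtain ⟨o, ho⟩ : ∃ o, o = e p + w := ⟨_, rfl⟩
  have hx : ∀ t, e (rotLightlike t p) + w = o + t • A + (t ^ 2 / 2 * d) • e ![0, 1, 1] := by
    intro t
    have : rotLightlike t p = p + t • ![d, p 0, p 0] + (t ^ 2 / 2 * d) • ![0, 1, 1] := by
      ext i
      fin_cases i
      · change p 0 - t * p 1 + t * p 2 = p 0 + t * d + t ^ 2 / 2 * d * 0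
        rw [hd]; ring
      · change t * p 0 + (1 - t ^ 2 / 2) * p 1 + t ^ 2 / 2 * p 2 =
          p 1 + t * p 0 + t ^ 2 / 2 * d * 1
        rw [hd]; ring
      · change t * p 0 - t ^ 2 / 2 * p 1 + (1 + t ^ 2 / 2) * p 2 =
          p 2 + t * p 0 + t ^ 2 / 2 * d * 1
        rw [hd]; ring
    rw [this, map_add, map_add, map_smul, map_smul, ho, hA]
    abel
  have x0 : ∀ t, (e (rotLightlike t p) + w) 0 = o 0 + t * A 0 := fun t => by
    rw [hx]; simp [l0]
  have x1 : ∀ t, (e (rotLightlike t p) + w) 1 = o 1 + t * A 2 + t ^ 2 / 2 * d * l := fun t => by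
    rw [hx]; simp [l1, hA12]
  have x2 : ∀ t, (e (rotLightlike t p) + w) 2 = o 2 + t * A 2 + t ^ 2 / 2 * d * l := fun t => by
    rw [hx]; simp [hl]
  refine ⟨d * l / A 0 ^ 2, 2 * A 2 / A 0 - 2 * (d * l / A 0 ^ 2) * o 0,
    o 2 + o 1 - 2 * A 2 * o 0 / A 0 + d * l / A 0 ^ 2 * o 0 ^ 2, o 2 - o 1,
    div_ne_zero (mul_ne_zero hp hl0) (pow_ne_zero 2 hA0), ?_, fun s => ?_⟩
  · rintro _ ⟨t, rfl⟩
    simp only [x0, x1, x2]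
    constructor
    · field_simp
      ring
    · ring
  · refine ⟨_, ⟨(s - o 0) / A 0, rfl⟩, ?_⟩
    simp only [x0]
    field_simp
    ring

end Circles

end Minkowski

/-! ### Reduction to the three model foliations and conclusion. -/

namespace Minkowski

theorem range_orbit_trans {e e₀ : E31 ≃ₗ[ℝ] E31} {r : ℝ → E31} {w x : E31}
    (hx : x ∈ Set.range fun t => e (r t) + w) :
    e₀.symm x ∈ Set.range fun t => e.trans e₀.symm (r t) + e₀.symm w := by
  obtain ⟨t, rfl⟩ := hx
  exact ⟨t, by simp⟩

theorem IsFoliatedByCircles.revolution {U : Set (ℝ × ℝ)} {X N : ℝ × ℝ → E31} {m n : ℝ}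
    (hfol : IsFoliatedByCircles X U) (hU : IsOpen U) (hUc : IsConnected U)
    (hX : IsSpacelikeImmersion X U) (hN : IsGaussMap X N U) (hW : IsLinearWeingarten X N U m n)
    (hm : m ≠ 0) (hmn : ¬(m = -1 ∧ n = 0)) : IsSurfaceOfRevolution X U := by
  obtain ⟨ν, hν, hleaf⟩ := hfol
  obtain ⟨q, hq⟩ := hUc.nonempty
  obtain ⟨C₀, c₀, hC₀, hp₀, -, -⟩ := hleaf q.1 ⟨q.2, hq⟩
  -- The isometry of a single leaf normalizes all of them: every axis is parallel to `ν`, whose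
  -- causal type also decides which rotation group occurs.
  obtain ⟨e₀, _, _, he₀, hcase⟩ := circle_normal_form hC₀ hν hp₀
  have hA : ∀ x y, lor (e₀.symm x) (e₀.symm y) = lor x y := fun x y => by
    rw [lor_symm_left he₀, e₀.apply_symm_apply]
  have hν' : e₀.symm ν ≠ 0 := fun h => hν (e₀.symm.map_eq_zero_iff.1 h)
  have hX' := hX.isometry hA
  have hN' := hN.isometry hA
  have hW' := hW.isometry hA
  have htrans : ∀ {e : E31 ≃ₗ[ℝ] E31}, (∀ x y, lor (e x) (e y) = lor x y) →
      ∀ x y, lor (e.trans e₀.symm x) (e.trans e₀.symm y) = lor x y := fun he x y => by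
    rw [LinearEquiv.trans_apply, LinearEquiv.trans_apply, hA, he]
  have hsymm : ∀ e : E31 ≃ₗ[ℝ] E31, (e.trans e₀.symm).symm (e₀.symm ν) = e.symm ν := fun e => by
    simp
  refine IsSurfaceOfRevolution.of_isometry hA ?_
  rcases hcase with ⟨hs, z0, z1, -, -⟩ | ⟨hs, z1, z2, -, -⟩ | ⟨hs, z0, z1, -, -⟩
  · have key : ∀ u, ∃ a b R c : ℝ, ∀ v, (u, v) ∈ U → 0 < R ∧
        (e₀.symm (X (u, v)) 0 - a) ^ 2 + 1 * (e₀.symm (X (u, v)) 1 - b) ^ 2 = R ∧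
          e₀.symm (X (u, v)) 2 = c := by
      intro u
      by_cases hu : ∃ v, (u, v) ∈ U
      · obtain ⟨C, k, hC, hpl, hin, -⟩ := hleaf u hu
        obtain ⟨e, w, p, he, ⟨-, y0, y1, hp, hCe⟩ | ⟨hs', -⟩ | ⟨hs', -⟩⟩ :=
          circle_normal_form hC hν hpl
        · rw [← hsymm] at y0 y1
          obtain ⟨a, b, R, c, hR, hall⟩ :=
            timelike_circle_coords (w := e₀.symm w) (htrans he) hν' z0 z1 y0 y1 hp
          exact ⟨a, b, R, c, fun v hv => ⟨hR, hall _ (range_orbit_trans (hCe ▸ hin v hv))⟩⟩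
        · linarith
        · linarith
      -- Arbitrary values for `u` without a leaf; the conditions are only imposed where a leaf
      -- exists.
      · exact ⟨0, 0, 0, 0, fun v hv => absurd ⟨v, hv⟩ hu⟩
    choose a b R c key using key
    have H : ConicFoliation 1 0 1 2 (fun p => e₀.symm (X p)) U a b R c :=
      ⟨by norm_num, fun V W => by simp only [lor]; ring, fun α β γ => ⟨![α, β, γ], rfl, rfl, rfl⟩,
        fun p hp => (key p.1 p.2 hp).2.1, fun p hp => (key p.1 p.2 hp).2.2,
        fun p hp => (key p.1 p.2 hp).1⟩
    exact H.revolution_timelike hU hUc hX' hN' hW' hm hmn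
  · have key : ∀ u, ∃ a b R c : ℝ, ∀ v, (u, v) ∈ U → 0 < R ∧
        (e₀.symm (X (u, v)) 2 - a) ^ 2 + -1 * (e₀.symm (X (u, v)) 1 - b) ^ 2 = R ∧
          e₀.symm (X (u, v)) 0 = c := by
      intro u
      by_cases hu : ∃ v, (u, v) ∈ U
      · obtain ⟨C, k, hC, hpl, hin, -⟩ := hleaf u hu
        obtain ⟨e, w, p, he, ⟨hs', -⟩ | ⟨-, y1, y2, hp, hCe⟩ | ⟨hs', -⟩⟩ :=
          circle_normal_form hC hν hpl
        · linarith
        · rw [← hsymm] at y1 y2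
          obtain ⟨a, b, R, c, hR, hall⟩ :=
            spacelike_circle_coords (w := e₀.symm w) (htrans he) hν' z1 z2 y1 y2 hp
          exact ⟨a, b, R, c, fun v hv => ⟨hR, hall _ (range_orbit_trans (hCe ▸ hin v hv))⟩⟩
        · linarith
      · exact ⟨0, 0, 0, 0, fun v hv => absurd ⟨v, hv⟩ hu⟩
    choose a b R c key using key
    have H : ConicFoliation (-1) 2 1 0 (fun p => e₀.symm (X p)) U a b R c :=
      ⟨by norm_num, fun V W => by simp only [lor]; ring, fun α β γ => ⟨![γ, β, α], rfl, rfl, rfl⟩,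
        fun p hp => (key p.1 p.2 hp).2.1, fun p hp => (key p.1 p.2 hp).2.2,
        fun p hp => (key p.1 p.2 hp).1⟩
    exact H.revolution_spacelike hU hUc hX' hN' hW' hm hmn
  · have key : ∀ u, ∃ f g h c : ℝ, ∀ v, (u, v) ∈ U → f ≠ 0 ∧
        (e₀.symm (X (u, v)) 2 + e₀.symm (X (u, v)) 1 =
            f * e₀.symm (X (u, v)) 0 ^ 2 + g * e₀.symm (X (u, v)) 0 + h ∧
          e₀.symm (X (u, v)) 2 - e₀.symm (X (u, v)) 1 = c) ∧
        ∀ s : ℝ, ∃ v', (u, v') ∈ U ∧ e₀.symm (X (u, v')) 0 = s := by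
      intro u
      by_cases hu : ∃ v, (u, v) ∈ U
      · obtain ⟨C, k, hC, hpl, hin, hwhole⟩ := hleaf u hu
        obtain ⟨e, w, p, he, ⟨hs', -⟩ | ⟨hs', -⟩ | ⟨-, y0, y1, hp, hCe⟩⟩ :=
          circle_normal_form hC hν hpl
        · linarith
        · linarith
        · rw [← hsymm] at y0 y1
          obtain ⟨f, g, h, c, hf, hall, hsurj⟩ :=
            lightlike_circle_coords (w := e₀.symm w) (htrans he) hν' z0 z1 y0 y1 hp
          refine ⟨f, g, h, c, fun v hv =>
            ⟨hf, hall _ (range_orbit_trans (hCe ▸ hin v hv)), fun s => ?_⟩⟩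
          obtain ⟨_, ⟨t, rfl⟩, hts⟩ := hsurj s
          obtain ⟨v', hv', hXv⟩ := hwhole hs (e (rotLightlike t p) + w) (by rw [hCe]; exact ⟨t, rfl⟩)
          refine ⟨v', hv', ?_⟩
          rw [hXv, map_add]
          exact hts
      · exact ⟨0, 0, 0, 0, fun v hv => absurd ⟨v, hv⟩ hu⟩
    choose f g h c key using key
    have H : ParabolaFoliation (fun p => e₀.symm (X p)) U f g h c :=
      ⟨fun p hp => (key p.1 p.2 hp).2.1.1, fun p hp => (key p.1 p.2 hp).2.1.2,
        fun p hp => (key p.1 p.2 hp).1, fun p hp => (key p.1 p.2 hp).2.2⟩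
    exact H.revolution hU hUc hX' hN' hW' hm hmn

end Minkowski

theorem theorem1 (U : Set (ℝ × ℝ)) (hUo : IsOpen U) (hUc : IsConnected U)
    (X N : ℝ × ℝ → Minkowski.E31) (m n : ℝ) (hm : m ≠ 0)
    (hX : Minkowski.IsSpacelikeImmersion X U) (hN : Minkowski.IsGaussMap X N U)
    (hfol : Minkowski.IsFoliatedByCircles X U)
    (hW : Minkowski.IsLinearWeingarten X N U m n) :
    Minkowski.IsSurfaceOfRevolution X U ∨
      (m = -1 ∧ n = 0 ∧ Minkowski.IsRiemannExample X N U) := by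
  by_cases hmn : m = -1 ∧ n = 0
  · by_cases hrev : Minkowski.IsSurfaceOfRevolution X U
    · exact Or.inl hrev
    · refine Or.inr ⟨hmn.1, hmn.2, hX, hN, hfol, fun q hq => ?_, hrev⟩
      obtain ⟨k₁, k₂, hk, hrel⟩ := hW q hq
      refine ⟨k₁, k₂, hk, ?_⟩
      rw [hrel, hmn.1, hmn.2]
      ring
  · exact Or.inl (hfol.revolution hUo hUc hX hN hW hm hmn)
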